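/- Let $(\Omega,\mathcal A,\mathbb P)$ be a probability space with a filtration $\mathbb F=(\mathcal F_t)_{t\ge0}$ satisfying the usual conditions. Let $X$ be a real $\mathbb F$-adapted process with almost surely càdlàg paths, $X^*_t=\inf_{s\le t}X_s$, and let $L$ be a real random variable. The default time is $$\tau=\inf\{t: X_t\le L\}=\inf\{t:X^*_t=L\}\in[0,\infty]\quad(\inf\emptyset=+\infty),$$ where the two expressions are assumed to agree almost surely (they do if $X$ is continuous and $X_0>L$). Let $P^L$ be the law of $L$ and assume Jacod's density hypothesis: for every $t\ge 0$, almost surely $\mathbb P(L\in\cdot\,|\,\mathcal F_t)\sim P^L$. Let $p_t(x)\ge 0$ be an $\mathcal F_t\otimes\mathcal B(\mathbb R)$-measurable version of the density of $\mathbb P(L\in\cdot\,|\,\mathcal F_t)$ with respect to $P^L$ such that $(p_t(x))_{t\ge0}$ is, for each $x$, an almost surely càdlàg $(\mathbb F,\mathbb P)$-martingale. Put $$F^M_t(x)=p_t(x)\mathbf 1_{\{X^*_t>x\}}.$$ Let $0\le t\le T$, let $R$ (discount factor) be a strictly positive $\mathbb F$-predictable process, and let $(C,G,Z)$ be a claim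 of maturity $T$: $C$ is $\mathcal F_T$-measurable, $G$ is $\mathbb F$-adapted, continuous, of finite variation with $G_0=0$, and $Z$ is $\mathbb F$-predictable. Integrals from $t$ to $T$ are over $(t,T]$. Assume that $CR_T^{-1}\mathbf 1_{\{\tau>T\}}$, $\int_t^T\mathbf 1_{\{\tau>u\}}R_u^{-1}\,d|G|_u$ and $Z_\tau R_\tau^{-1}\mathbf 1_{\{\tau\le T\}}$ are $\mathbb P$-integrable, and that for $P^L$-almost every $x$ the stochastic integral $\int_t^T Z_sR_s^{-1}dF^M_s(x)$ exists in the following $L^1$ sense: for some localizing sequence of stopping times $(\sigma_n)$, the stopped integrals $\int_t^TZ_sR_s^{-1}\mathbf 1_{\{s\le\sigma_n\}}dF^M_s(x)$ exist as Daniell integrals with values in $L^1(\mathbb P)$, and they converge in $L^1(\mathbb P)$ to $\int_t^T Z_sR_s^{-1}dF^M_s(x)$. Here, for a process $Y$ and a stepwise predictable $K=\sum_i\xi_i\mathbf 1_{(a_i,b_i]}$ on $(t,T]$ ($\xi_i$ bounded and $\mathcal F_{a_i}$-measurable), $\int K\,dY=\sum_i\xi_i(Y_{b_i}-Y_{a_i})$;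 and $I\in L^1(\mathbb P)$ is the Daniell integral of $H$ if there are stepwise predictable $K_n$ with $\|H-K_n\|_Y\to0$ and $\int K_n\,dY\to I$ in $L^1(\mathbb P)$, where $\|H\|_Y$ is the infimum of $\sup_m\sup\{E_{\mathbb P}|\int J\,dY|: J\text{ stepwise predictable},\ |J|\le K_m\}$ over increasing sequences $(K_m)$ of nonnegative stepwise predictable processes with $|H|\le\sup_mK_m$. The manager's filtration is $\mathcal G^M_t=\mathcal F_t\vee\sigma(L)$, and the manager's (pre-default) value of the claim under $\mathbb P$ at time $t$ is $$V^M_t=\mathbf 1_{\{\tau>t\}}R_t\,E_{\mathbb P}\Big[CR_T^{-1}\mathbf 1_{\{\tau>T\}}+\int_t^T\mathbf 1_{\{\tau>u\}}R_u^{-1}dG_u+Z_\tau\mathbf 1_{\{\tau\le T\}}R_\tau^{-1}\,\Big|\,\mathcal G^M_t\Big].$$ Then the random variable inside this conditional expectation is integrable; for $P^L$-almost every $x$, $\int_t^TF^M_s(x)R_s^{-1}dG_s$ is almost surely an absolutely convergent pathwise integral and the random variable inside the conditional expectation below is integrable; the family $$\widetilde V^M_t(x)=R_t\,E_{\mathbb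 P}\Big[CR_T^{-1}F^M_T(x)+\int_t^TF^M_s(x)R_s^{-1}dG_s-\int_t^TZ_sR_s^{-1}dF^M_s(x)\,\Big|\,\mathcal F_t\Big]$$ (for $P^L$-almost every $x$) has an $\mathcal F_t\otimes\mathcal B(\mathbb R)$-measurable version; and for every such version, almost surely, $$V^M_t=\mathbf 1_{\{\tau>t\}}\,\frac{\widetilde V^M_t(L)}{p_t(L)}.$$ -/

import Mathlib

open MeasureTheory ProbabilityTheory Filter Topology Set
open scoped NNReal ENNReal

noncomputable section

namespace CreditRisk

variable {Ω : Type*} {mΩ : MeasurableSpace Ω}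

/-! ### Paths, filtrations, default time -/

/-- Right-continuous with left limits. -/
def IsCadlag (f : ℝ≥0 → ℝ) : Prop :=
  ∀ t, ContinuousWithinAt f (Ici t) t ∧ ∃ l, Tendsto f (𝓝[<] t) (𝓝 l)

/-- The usual conditions: right-continuity, and every `P`-null set belongs to `𝓕 0`. -/
structure UsualConditions (P : Measure Ω) (𝓕 : Filtration ℝ≥0 mΩ) : Prop where
  rightContinuous : 𝓕.IsRightContinuous
  complete : ∀ s : Set Ω, P s = 0 → MeasurableSet[𝓕 0] s

/-- The infimum process `X*_t = inf_{s ≤ t} X_s`. -/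
def runningInf (X : ℝ≥0 → Ω → ℝ) (t : ℝ≥0) (ω : Ω) : ℝ := ⨅ s : Iic t, X s ω

/-- The infimum of a set of times, with `inf ∅ = ∞`. -/
def firstTime (S : Set ℝ≥0) : ℝ≥0∞ := ⨅ s ∈ S, (s : ℝ≥0∞)

/-- The default time `τ = inf {t : X_t ≤ L}`. -/
def defaultTime (X : ℝ≥0 → Ω → ℝ) (L : Ω → ℝ) (ω : Ω) : ℝ≥0∞ :=
  firstTime {t | X t ω ≤ L ω}

/-- The manager's filtration `𝓖ᴹ_t = 𝓕_t ∨ σ(L)`. -/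
def managerFiltration (𝓕 : Filtration ℝ≥0 mΩ) (L : Ω → ℝ) (hL : Measurable L) :
    Filtration ℝ≥0 mΩ where
  seq t := 𝓕 t ⊔ MeasurableSpace.comap L inferInstance
  mono' _ _ hst := sup_le_sup_right (𝓕.mono hst) _
  le' t := sup_le (𝓕.le t) hL.comap_le

/-! ### Conditional law of the barrier and its density -/

/-- A regular version of the conditional law of `L` given `𝓕_t`. -/
def condLaw (P : Measure Ω) [IsProbabilityMeasure P] (𝓕 : Filtration ℝ≥0 mΩ) (L : Ω → ℝ)
    (t : ℝ≥0) (ω : Ω) : Measure ℝ :=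
  @condDistrib Ω Ω ℝ _ _ _ mΩ (𝓕 t) L id P _ ω

/-- Jacod's density hypothesis: for every `t`, almost surely the conditional law of `L` given
`𝓕_t` is equivalent to the law of `L`. -/
def JacodHypothesis (P : Measure Ω) [IsProbabilityMeasure P] (𝓕 : Filtration ℝ≥0 mΩ)
    (L : Ω → ℝ) : Prop :=
  ∀ t, ∀ᵐ ω ∂P, condLaw P 𝓕 L t ω ≪ P.map L ∧ P.map L ≪ condLaw P 𝓕 L t ω

/-- `p t x ω` is a (good) version of the conditional density
`p_t(x)(ω) = dP^L_t(ω, ·) / dP^L (x)`: nonnegative, `𝓕_t ⊗ 𝓑(ℝ)`-measurable for each `t`, and for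
each `x` a càdlàg `(𝓕, P)`-martingale. -/
structure IsCondDensity (P : Measure Ω) [IsProbabilityMeasure P] (𝓕 : Filtration ℝ≥0 mΩ)
    (L : Ω → ℝ) (p : ℝ≥0 → ℝ → Ω → ℝ) : Prop where
  nonneg : ∀ t x ω, 0 ≤ p t x ω
  measurable : ∀ t, Measurable[(𝓕 t).prod inferInstance] (fun z : Ω × ℝ => p t z.2 z.1)
  density : ∀ t, ∀ᵐ ω ∂P,
    condLaw P 𝓕 L t ω = (P.map L).withDensity (fun x => ENNReal.ofReal (p t x ω))
  martingale : ∀ x, Martingale (fun t ω => p t x ω) 𝓕 P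
  cadlag : ∀ x, ∀ᵐ ω ∂P, IsCadlag (fun t => p t x ω)

/-- `Fᴹ_t(x) = p_t(x) 1_{X*_t > x}`. -/
def survivalDensity (X : ℝ≥0 → Ω → ℝ) (p : ℝ≥0 → ℝ → Ω → ℝ) (t : ℝ≥0) (x : ℝ) (ω : Ω) : ℝ :=
  p t x ω * {ω' | x < runningInf X t ω'}.indicator 1 ω

/-! ### Pathwise integrals against a function of finite variation -/

open scoped Classical in
/-- The variation measure `|dg|` of the path `g` on `[0, T]`. -/
def pathVariation (g : ℝ≥0 → ℝ) (T : ℝ≥0) : Measure ℝ≥0 :=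
  if h : BoundedVariationOn (fun u => g (min u T)) univ then h.vectorMeasure.variation else 0

open scoped Classical in
/-- The Lebesgue-Stieltjes integral `∫_(t,T] φ dg`. -/
def pathIntegral (g φ : ℝ≥0 → ℝ) (t T : ℝ≥0) : ℝ :=
  if h : BoundedVariationOn (fun u => g (min u T)) univ then
    ∫ᵛ u in Ioc t T, φ u ∂•h.vectorMeasure
  else 0

/-! ### The stochastic integral in `L¹`

The integral of predictable integrands against a càdlàg adapted integrable process `Y`, obtained
from the elementary integral by Daniell's extension procedure with values in `L¹(P)`, followed by
localization. -/

/-- A representation `∑ᵢ ξᵢ 1_(aᵢ, bᵢ]` of a stepwise (simple) predictable process on `(t, T]`: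
`t ≤ aᵢ ≤ bᵢ ≤ T`, with `ξᵢ` bounded and `𝓕_{aᵢ}`-measurable. -/
structure SimplePredictable (𝓕 : Filtration ℝ≥0 mΩ) (t T : ℝ≥0) where
  n : ℕ
  left : Fin n → ℝ≥0
  right : Fin n → ℝ≥0
  coeff : Fin n → Ω → ℝ
  le_left : ∀ i, t ≤ left i
  left_le_right : ∀ i, left i ≤ right i
  right_le : ∀ i, right i ≤ T
  measurable : ∀ i, StronglyMeasurable[𝓕 (left i)] (coeff i)
  bounded : ∃ c : ℝ, ∀ i ω, |coeff i ω| ≤ c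

namespace SimplePredictable

variable {𝓕 : Filtration ℝ≥0 mΩ} {t T : ℝ≥0}

/-- The process `∑ᵢ ξᵢ 1_(aᵢ, bᵢ]`. -/
def process (K : SimplePredictable 𝓕 t T) (u : ℝ≥0) (ω : Ω) : ℝ :=
  ∑ i, (Ioc (K.left i) (K.right i)).indicator (fun _ => K.coeff i ω) u

/-- The elementary stochastic integral `∑ᵢ ξᵢ (Y_{bᵢ} - Y_{aᵢ})`. -/
def integral (K : SimplePredictable 𝓕 t T) (Y : ℝ≥0 → Ω → ℝ) (ω : Ω) : ℝ :=
  ∑ i, K.coeff i ω * (Y (K.right i) ω - Y (K.left i) ω)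

/-- For `K ≥ 0`: the supremum of `E|∫ J dY|` over the simple predictable `J` with `|J| ≤ K`. -/
def size (P : Measure Ω) (Y : ℝ≥0 → Ω → ℝ) (K : SimplePredictable 𝓕 t T) : ℝ≥0∞ :=
  ⨆ (J : SimplePredictable 𝓕 t T)
    (_ : ∀ u ∈ Ioc t T, ∀ ω, |J.process u ω| ≤ K.process u ω),
    ∫⁻ ω, ‖J.integral Y ω‖ₑ ∂P

end SimplePredictable

/-- The Daniell mean of a process `H` on `(t, T]`: the infimum of `supₙ size(Kₙ)` over the
increasing sequences `(Kₙ)` of nonnegative simple predictable processes with `|H| ≤ supₙ Kₙ`. -/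
def daniellMean (P : Measure Ω) (𝓕 : Filtration ℝ≥0 mΩ) (Y H : ℝ≥0 → Ω → ℝ) (t T : ℝ≥0) : ℝ≥0∞ :=
  ⨅ (K : ℕ → SimplePredictable 𝓕 t T)
    (_ : ∀ u ∈ Ioc t T, ∀ ω, (∀ n, 0 ≤ (K n).process u ω) ∧
      (Monotone fun n => (K n).process u ω) ∧
      ENNReal.ofReal |H u ω| ≤ ⨆ n, ENNReal.ofReal ((K n).process u ω)),
    ⨆ n, (K n).size P Y

/-- `I` is the Daniell integral `∫_(t,T] H dY`: there are simple predictable `Kₙ` converging to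
`H` in Daniell mean whose elementary integrals converge to `I` in `L¹(P)`. -/
def IsDaniellIntegral (P : Measure Ω) (𝓕 : Filtration ℝ≥0 mΩ) (Y H : ℝ≥0 → Ω → ℝ) (t T : ℝ≥0)
    (I : Ω → ℝ) : Prop :=
  Integrable I P ∧ ∃ K : ℕ → SimplePredictable 𝓕 t T,
    Tendsto (fun n => daniellMean P 𝓕 Y (fun u ω => H u ω - (K n).process u ω) t T)
      atTop (𝓝 0) ∧
    Tendsto (fun n => ∫⁻ ω, ‖(K n).integral Y ω - I ω‖ₑ ∂P) atTop (𝓝 0)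

/-- `I` is (a version of) the stochastic integral `∫_(t,T] H dY`, obtained by localization: for
some localizing sequence `(σₙ)` of stopping times, the Daniell integrals of `H 1_[0, σₙ]` exist and
converge to `I` in `L¹(P)`. -/
def IsStochIntegral (P : Measure Ω) (𝓕 : Filtration ℝ≥0 mΩ) (Y H : ℝ≥0 → Ω → ℝ) (t T : ℝ≥0)
    (I : Ω → ℝ) : Prop :=
  Integrable I P ∧ ∃ (σ : ℕ → Ω → WithTop ℝ≥0) (J : ℕ → Ω → ℝ),
    IsLocalizingSequence 𝓕 σ P ∧
    (∀ n, IsDaniellIntegral P 𝓕 Y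
      (fun u ω => {ω' | (u : WithTop ℝ≥0) ≤ σ n ω'}.indicator (H u) ω) t T (J n)) ∧
    Tendsto (fun n => ∫⁻ ω, ‖J n ω - I ω‖ₑ ∂P) atTop (𝓝 0)

/-- `H` is integrable with respect to `Y` over `(t, T]`. -/
def StochIntegrable (P : Measure Ω) (𝓕 : Filtration ℝ≥0 mΩ) (Y H : ℝ≥0 → Ω → ℝ)
    (t T : ℝ≥0) : Prop :=
  ∃ I, IsStochIntegral P 𝓕 Y H t T I

open scoped Classical in
/-- The stochastic integral `∫_(t,T] H dY` (a version of it; `0` if `H` is not integrable). -/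
def stochIntegral (P : Measure Ω) (𝓕 : Filtration ℝ≥0 mΩ) (Y H : ℝ≥0 → Ω → ℝ)
    (t T : ℝ≥0) : Ω → ℝ :=
  if h : StochIntegrable P 𝓕 Y H t T then h.choose else 0

/-! ### Contingent claims and their values -/

/-- A credit-sensitive claim `(C, G, Z)` of maturity `T`. -/
structure IsClaim (P : Measure Ω) (𝓕 : Filtration ℝ≥0 mΩ) (T : ℝ≥0)
    (C : Ω → ℝ) (G Z : ℝ≥0 → Ω → ℝ) : Prop where
  terminal : StronglyMeasurable[𝓕 T] C
  dividend_adapted : StronglyAdapted 𝓕 G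
  dividend_zero : ∀ᵐ ω ∂P, G 0 ω = 0
  dividend_continuous : ∀ᵐ ω ∂P, Continuous (fun u => G u ω)
  dividend_variation : ∀ᵐ ω ∂P, LocallyBoundedVariationOn (fun u => G u ω) univ
  recovery : IsStronglyPredictable 𝓕 Z

/-- `Z_τ 1_{τ ≤ T} R_τ⁻¹`. -/
def discountedRecovery (R Z : ℝ≥0 → Ω → ℝ) (τ : Ω → ℝ≥0∞) (T : ℝ≥0) (ω : Ω) : ℝ :=
  {ω' | τ ω' ≤ T}.indicator (fun ω' => Z (τ ω').toNNReal ω' * (R (τ ω').toNNReal ω')⁻¹) ω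

/-- `1_{τ > u} R_u⁻¹`, the integrand of the dividend term. -/
def discountedSurvival (R : ℝ≥0 → Ω → ℝ) (τ : Ω → ℝ≥0∞) (u : ℝ≥0) (ω : Ω) : ℝ :=
  {ω' | (u : ℝ≥0∞) < τ ω'}.indicator (fun ω' => (R u ω')⁻¹) ω

/-- The discounted cash flow
`C R_T⁻¹ 1_{τ > T} + ∫_(t,T] 1_{τ > u} R_u⁻¹ dG_u + Z_τ 1_{τ ≤ T} R_τ⁻¹`. -/
def discountedPayoff (R : ℝ≥0 → Ω → ℝ) (τ : Ω → ℝ≥0∞) (C : Ω → ℝ) (G Z : ℝ≥0 → Ω → ℝ)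
    (t T : ℝ≥0) (ω : Ω) : ℝ :=
  C ω * discountedSurvival R τ T ω
    + pathIntegral (fun u => G u ω) (fun u => discountedSurvival R τ u ω) t T
    + discountedRecovery R Z τ T ω

/-- The (pre-default) value at time `t` of the claim for an agent with information `𝓗` and
pricing measure `P`: `V_t = 1_{τ > t} R_t E[discounted cash flow | 𝓗_t]`. -/
def valueProcess (P : Measure Ω) (𝓗 : Filtration ℝ≥0 mΩ) (R : ℝ≥0 → Ω → ℝ) (τ : Ω → ℝ≥0∞)
    (C : Ω → ℝ) (G Z : ℝ≥0 → Ω → ℝ) (t T : ℝ≥0) (ω : Ω) : ℝ :=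
  {ω' | (t : ℝ≥0∞) < τ ω'}.indicator
    (fun ω' => R t ω' * P[discountedPayoff R τ C G Z t T | 𝓗 t] ω') ω

/-- `C R_T⁻¹ Fᴹ_T(x) + ∫_(t,T] Fᴹ_s(x) R_s⁻¹ dG_s - ∫_(t,T] Z_s R_s⁻¹ dFᴹ_s(x)`, where `F` is
`Fᴹ`. -/
def fullInfoPayoff (P : Measure Ω) (𝓕 : Filtration ℝ≥0 mΩ) (R : ℝ≥0 → Ω → ℝ)
    (F : ℝ≥0 → ℝ → Ω → ℝ) (C : Ω → ℝ) (G Z : ℝ≥0 → Ω → ℝ) (t T : ℝ≥0) (x : ℝ) (ω : Ω) : ℝ :=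
  C ω * (R T ω)⁻¹ * F T x ω
    + pathIntegral (fun u => G u ω) (fun u => F u x ω * (R u ω)⁻¹) t T
    - stochIntegral P 𝓕 (fun u => F u x) (fun u ω' => Z u ω' * (R u ω')⁻¹) t T ω

/-- `W` is an `𝓕_t ⊗ 𝓑(ℝ)`-measurable version of
`x ↦ Ṽᴹ_t(x) = R_t E[C R_T⁻¹ Fᴹ_T(x) + ∫ Fᴹ_s(x) R_s⁻¹ dG_s - ∫ Z_s R_s⁻¹ dFᴹ_s(x) | 𝓕_t]`
(for almost every `x` with respect to the law of `L`), so that it may be evaluated at `x = L`. -/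
def IsFullInfoValue (P : Measure Ω) (𝓕 : Filtration ℝ≥0 mΩ) (L : Ω → ℝ) (R : ℝ≥0 → Ω → ℝ)
    (F : ℝ≥0 → ℝ → Ω → ℝ) (C : Ω → ℝ) (G Z : ℝ≥0 → Ω → ℝ) (t T : ℝ≥0)
    (W : ℝ → Ω → ℝ) : Prop :=
  Measurable[(𝓕 t).prod inferInstance] (fun z : Ω × ℝ => W z.2 z.1) ∧
  ∀ᵐ x ∂(P.map L), W x =ᵐ[P] fun ω => R t ω * P[fullInfoPayoff P 𝓕 R F C G Z t T x | 𝓕 t] ω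

end CreditRisk

end

noncomputable section

namespace CreditRisk

variable {Ω : Type*} {mΩ : MeasurableSpace Ω}

/-! The manager's σ-field at time t is generated by ω ↦ (ω, L ω) from 𝓕_t ⊗ 𝓑(ℝ), and on 𝓕_s ⊗ 𝓑(ℝ)
the law of this map has density p_s(x) with respect to P ⊗ P^L (`lintegral_comp_barrier`). If a cash
flow is f(ω, L ω) with f measurable for 𝓕_T ⊗ 𝓑(ℝ), Bayes' rule therefore gives its conditional
expectation as W(ω, L ω) / p_t(L), where W(·, x) is a jointly measurable version of E[f(·, x) p_T(x)
| 𝓕_t] (`exists_joint_condExp`, `BarrierModel.condExp_payoff`). Restricted to {τ > t}, the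
discounted payoff has this form with f = `barrierPayoff`, because almost surely τ > u means X*_u >
L.

It remains to see that, for almost every fixed level x, f(·, x) p_T(x) and the full information
payoff have the same conditional expectation given 𝓕_t (`BarrierModel.ae_setIntegral_payoff`). The
terminal terms coincide. In the dividend term a nonnegative càdlàg martingale, integrated against an
adapted random measure, may be replaced by its terminal value (`lintegral_martingale_weight`); this
is applied to each Jordan part of dG, with weight 1_{X* > x} R⁻¹.

For the recovery term, Fᴹ(x) is the martingale p(x) killed at the time ϑ when X* first drops to x or
below. For an elementary integrand K = ξ 1_(a, b] the martingale property gives E ∫ K dFᴹ = -E[ξ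
p_T; a < ϑ ≤ b], which is minus the mean of K_ϑ p_T over default in (t, T]
(`setIntegral_integral_eq`). The Daniell mean of H dominates the mean of |H_ϑ| p_T on that event
(`lintegral_exitTime_le_daniellMean`), so the identity extends to Daniell integrals. It passes
through the localization by dominated convergence, the bound coming from the integrability of Z_τ
R_τ⁻¹ 1_{τ ≤ T} (`IsStochIntegral.setIntegral_eq`). -/

/-! ### Disintegration along the barrier, and terminal values of martingales -/

/-- The conditional density disintegrates the joint law of the path information and `L`. -/
lemma lintegral_comp_barrier {P : Measure Ω} [IsProbabilityMeasure P] {𝓕 : Filtration ℝ≥0 mΩ}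
    {L : Ω → ℝ} (hL : Measurable L) {p : ℝ≥0 → ℝ → Ω → ℝ} (hp : IsCondDensity P 𝓕 L p) (s : ℝ≥0)
    {f : Ω × ℝ → ℝ≥0∞} (hf : Measurable[(𝓕 s).prod inferInstance] f) :
    ∫⁻ ω, f (ω, L ω) ∂P = ∫⁻ x, ∫⁻ ω, f (ω, x) * ENNReal.ofReal (p s x ω) ∂P ∂(P.map L) := by
  have hprod : (𝓕 s).prod (inferInstance : MeasurableSpace ℝ) ≤ mΩ.prod inferInstance :=
    sup_le_sup_right (MeasurableSpace.comap_mono (𝓕.le s)) _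
  have hf' : Measurable f := hf.mono hprod le_rfl
  have hp' : Measurable fun z : Ω × ℝ => p s z.2 z.1 := (hp.measurable s).mono hprod le_rfl
  -- The identity is read as a map from (Ω, mΩ) to (Ω, 𝓕 s). The conditional distribution of L given
  -- this map is `condLaw`, and the joint law lives on 𝓕_s ⊗ 𝓑(ℝ).
  have hid : @Measurable Ω Ω mΩ (𝓕 s) id := measurable_id'' (𝓕.le s)
  have hpair : @Measurable Ω (Ω × ℝ) mΩ ((𝓕 s).prod inferInstance) fun a => (id a, L a) :=
    Measurable.prodMk hid hL
  have h := @compProd_map_condDistrib Ω Ω ℝ _ _ _ mΩ P _ id L (𝓕 s) hL.aemeasurable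
  have e1 : ∫⁻ ω, f (ω, L ω) ∂P =
      ∫⁻ z, f z ∂(@Measure.map Ω (Ω × ℝ) mΩ ((𝓕 s).prod inferInstance)
        (fun a => (id a, L a)) P) := by
    rw [@lintegral_map Ω (Ω × ℝ) mΩ ((𝓕 s).prod inferInstance) P f _ hf
      hpair]
    rfl
  rw [e1, ← h, @Measure.lintegral_compProd Ω ℝ (𝓕 s) _ _ _ inferInstance inferInstance f hf]
  rw [@lintegral_map Ω Ω mΩ (𝓕 s) P _ id
    (@Measurable.lintegral_kernel_prod_right' Ω ℝ (𝓕 s) _ _ inferInstance _ hf) hid]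
  have e2 : ∀ᵐ ω ∂P, ∫⁻ b, f (id ω, b) ∂(@condDistrib Ω Ω ℝ _ _ _ mΩ (𝓕 s) L id P _ (id ω)) =
      ∫⁻ x, f (ω, x) * ENNReal.ofReal (p s x ω) ∂(P.map L) := by
    filter_upwards [hp.density s] with ω hω
    change ∫⁻ b, f (ω, b) ∂(condLaw P 𝓕 L s ω) = _
    rw [hω, lintegral_withDensity_eq_lintegral_mul]
    · simp_rw [Pi.mul_apply, mul_comm]
    · exact (hp'.comp (measurable_prodMk_left (x := ω))).ennreal_ofReal
    · exact hf'.comp measurable_prodMk_left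
  rw [lintegral_congr_ae e2]
  have := Measure.isProbabilityMeasure_map (μ := P) hL.aemeasurable
  exact lintegral_lintegral_swap (hf'.mul hp'.ennreal_ofReal).aemeasurable

/-- A nonnegative martingale may be replaced by its terminal value against adapted weights. -/
lemma lintegral_mul_martingale {P : Measure Ω} [IsProbabilityMeasure P] {𝓕 : Filtration ℝ≥0 mΩ}
    {M : ℝ≥0 → Ω → ℝ} (hM : Martingale M 𝓕 P) (hM0 : ∀ t ω, 0 ≤ M t ω) {s T : ℝ≥0} (hsT : s ≤ T)
    {f : Ω → ℝ≥0∞} (hf : Measurable[𝓕 s] f) :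
    ∫⁻ ω, ENNReal.ofReal (M s ω) * f ω ∂P = ∫⁻ ω, ENNReal.ofReal (M T ω) * f ω ∂P := by
  have hm : ∀ u, Measurable fun ω => ENNReal.ofReal (M u ω) := fun u =>
    ((hM.1 u).mono (𝓕.le u)).measurable.ennreal_ofReal
  -- The martingale property says that the measures M_s P and M_T P agree on 𝓕_s. In this form it
  -- applies to every nonnegative 𝓕_s-measurable weight, without integrability.
  have key : (P.withDensity fun ω => ENNReal.ofReal (M s ω)).trim (𝓕.le s) =
      (P.withDensity fun ω => ENNReal.ofReal (M T ω)).trim (𝓕.le s) := by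
    refine @Measure.ext _ (𝓕 s) _ _ fun A hA => ?_
    rw [trim_measurableSet_eq _ hA, trim_measurableSet_eq _ hA,
      withDensity_apply _ (𝓕.le s _ hA), withDensity_apply _ (𝓕.le s _ hA),
      ← ofReal_integral_eq_lintegral_ofReal (hM.integrable s).integrableOn
        (ae_of_all _ (hM0 s)),
      ← ofReal_integral_eq_lintegral_ofReal (hM.integrable T).integrableOn
        (ae_of_all _ (hM0 T)), hM.setIntegral_eq hsT hA]
  have hf' : Measurable f := hf.mono (𝓕.le s) le_rfl
  have h1 := lintegral_withDensity_eq_lintegral_mul P (hm s) hf'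
  have h2 := lintegral_withDensity_eq_lintegral_mul P (hm T) hf'
  rw [← lintegral_trim (𝓕.le s) hf] at h1 h2
  rw [key] at h1
  simpa [Pi.mul_apply] using h1.symm.trans h2

/-- Real-valued form of `lintegral_mul_martingale` for bounded weights. -/
lemma integral_mul_martingale {P : Measure Ω} [IsProbabilityMeasure P] {𝓕 : Filtration ℝ≥0 mΩ}
    {M : ℝ≥0 → Ω → ℝ} (hM : Martingale M 𝓕 P) {s T : ℝ≥0} (hsT : s ≤ T)
    {f : Ω → ℝ} (hf : StronglyMeasurable[𝓕 s] f) {c : ℝ} (hc : ∀ ω, |f ω| ≤ c) :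
    ∫ ω, f ω * M s ω ∂P = ∫ ω, f ω * M T ω ∂P := by
  have hint : Integrable (fun ω => f ω * M T ω) P :=
    (hM.integrable T).bdd_mul (hf.mono (𝓕.le s)).aestronglyMeasurable (ae_of_all _ hc)
  have h1 : P[fun ω => f ω * M T ω|𝓕 s] =ᵐ[P] fun ω => f ω * M s ω := by
    filter_upwards [condExp_mul_of_stronglyMeasurable_left hf hint (hM.integrable T),
      hM.condExp_ae_eq hsT] with ω h2 h3
    rw [show (P[fun ω => f ω * M T ω|𝓕 s]) ω = (P[f * M T|𝓕 s]) ω from rfl, h2]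
    simp [h3]
  rw [← integral_congr_ae h1, integral_condExp]

/-! ### Conditional expectations measurable in the parameter -/

lemma measurable_tsum_ennreal {α : Type*} {m : MeasurableSpace α} {f : ℕ → α → ℝ≥0∞}
    (hf : ∀ n, Measurable (f n)) : Measurable fun z => ∑' n, f n z :=
  Measurable.tsum hf

lemma measurable_section {Ω : Type*} {m mΩ : MeasurableSpace Ω} (hm : m ≤ mΩ)
    {W : Ω × ℝ → ℝ≥0∞} (hW : Measurable[m.prod inferInstance] W) (x : ℝ) :
    Measurable fun ω => W (ω, x) :=
  (hW.comp (@measurable_prodMk_right Ω ℝ m _ x)).mono hm le_rfl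

/-- Jointly measurable version of the conditional expectations of the sections of a set. -/
lemma exists_joint_condProb {Ω : Type*} {m mΩ : MeasurableSpace Ω} {P : Measure Ω}
    [IsProbabilityMeasure P]
    (hm : m ≤ mΩ) {S : Set (Ω × ℝ)} (hS : MeasurableSet S) :
    ∃ W : Ω × ℝ → ℝ≥0∞, Measurable[m.prod inferInstance] W ∧
      ∀ x A, MeasurableSet[m] A →
        ∫⁻ ω in A, W (ω, x) ∂P = ∫⁻ ω in A, S.indicator 1 (ω, x) ∂P := by
  -- Dynkin's argument from rectangles A × B, where P(A | m)(ω) 1_B(x) works. No regular conditional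
  -- probability on Ω is needed, and the identity holds for every x.
  induction S, hS using MeasurableSpace.induction_on_inter
    (generateFrom_prod.symm : _ = MeasurableSpace.generateFrom _) isPiSystem_prod with
  | empty => exact ⟨0, measurable_const, by simp⟩
  | basic S hS =>
    obtain ⟨A, hA, B, hB, rfl⟩ := hS
    have hA : MeasurableSet A := hA
    have hB : MeasurableSet B := hB
    let g : Ω → ℝ≥0∞ := fun ω => ENNReal.ofReal ((P[A.indicator (fun _ => (1 : ℝ))|m]) ω)
    have hg : Measurable[m] g := stronglyMeasurable_condExp.measurable.ennreal_ofReal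
    have hgA : ∀ A', MeasurableSet[m] A' → ∫⁻ ω in A', g ω ∂P = ∫⁻ ω in A', A.indicator 1 ω ∂P := by
      intro A' hA'
      have hi : Integrable (A.indicator (fun _ => (1 : ℝ))) P :=
        (integrable_const 1).indicator hA
      have h0 : 0 ≤ᵐ[P] P[A.indicator (fun _ => (1 : ℝ))|m] :=
        condExp_nonneg (ae_of_all _ fun ω => indicator_nonneg (by simp) ω)
      rw [← ofReal_integral_eq_lintegral_ofReal integrable_condExp.integrableOn
        (ae_restrict_of_ae h0), setIntegral_condExp hm hi hA',
        ofReal_integral_eq_lintegral_ofReal hi.integrableOn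
        (ae_of_all _ fun ω => indicator_nonneg (by simp) ω)]
      congr 1 with ω
      by_cases h : ω ∈ A <;> simp [h]
    refine ⟨fun z => g z.1 * B.indicator 1 z.2, ?_, ?_⟩
    · exact (hg.comp (@measurable_fst Ω ℝ m _)).mul
        ((measurable_one.indicator hB).comp (@measurable_snd Ω ℝ m _))
    · intro x A' hA'
      by_cases hx : x ∈ B
      · simp only [hx, indicator_of_mem, Pi.one_apply, mul_one]
        rw [hgA A' hA']
        congr 1 with ω
        by_cases h : ω ∈ A <;> simp [h, hx]
      · simp [hx]
  | compl S hS ih =>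
    obtain ⟨W, hW, hWA⟩ := ih
    refine ⟨fun z => 1 - W z, measurable_const.sub hW, fun x A hA => ?_⟩
    have hWx : Measurable[m] fun ω => W (ω, x) :=
      hW.comp (@measurable_prodMk_right Ω ℝ m _ x)
    -- W(·, x) is known only through its integrals, so it is at most 1 merely almost everywhere.
    -- This makes the truncated difference 1 - W a true difference under the integral.
    have hle : (fun ω => W (ω, x)) ≤ᵐ[P.trim hm] fun _ => 1 := by
      refine @ae_le_of_forall_setLIntegral_le_of_sigmaFinite Ω m _ _ _ _ hWx
        fun s hs _ => ?_
      rw [restrict_trim hm _ hs, lintegral_trim hm hWx, hWA x s hs,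
        lintegral_trim hm measurable_const]
      exact lintegral_mono fun ω => indicator_le_self' (by simp) _
    have hle' : (fun ω => W (ω, x)) ≤ᵐ[P.restrict A] fun _ => 1 :=
      ae_restrict_of_ae (ae_of_ae_trim hm hle)
    have hfin : ∫⁻ ω in A, W (ω, x) ∂P ≠ ∞ :=
      ((lintegral_mono_ae hle').trans_lt (by simp)).ne
    have hSx : Measurable fun ω => S.indicator (1 : Ω × ℝ → ℝ≥0∞) (ω, x) :=
      (measurable_one.indicator hS).comp measurable_prodMk_right
    have hle1 : ∀ ω, S.indicator (1 : Ω × ℝ → ℝ≥0∞) (ω, x) ≤ 1 := fun ω =>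
      indicator_le_self' (by simp) _
    rw [lintegral_sub (hWx.mono hm le_rfl) hfin hle', hWA x A hA, ← lintegral_sub hSx
      (by rwa [← hWA x A hA]) (ae_of_all _ hle1)]
    congr 1 with ω
    by_cases h : (ω, x) ∈ S <;> simp [h]
  | iUnion S hd hS ih =>
    choose W hW hWA using ih
    refine ⟨fun z => ∑' n, W n z, measurable_tsum_ennreal hW, fun x A hA => ?_⟩
    dsimp only
    have hSx : ∀ n, Measurable fun ω => (S n).indicator (1 : Ω × ℝ → ℝ≥0∞) (ω, x) := fun n =>
      (measurable_one.indicator (hS n)).comp measurable_prodMk_right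
    rw [lintegral_tsum fun n => (measurable_section hm (hW n) x).aemeasurable]
    simp_rw [fun n => hWA n x A hA]
    rw [← lintegral_tsum fun n => (hSx n).aemeasurable]
    congr 1 with ω
    exact (congrFun (indicator_iUnion_of_pairwise_disjoint S hd 1) (ω, x)).symm

/-- Jointly measurable version of the conditional expectations of the sections of a function. -/
lemma exists_joint_condLExp {Ω : Type*} {m mΩ : MeasurableSpace Ω} {P : Measure Ω}
    [IsProbabilityMeasure P]
    (hm : m ≤ mΩ) {f : Ω × ℝ → ℝ≥0∞} (hf : Measurable f) :
    ∃ W : Ω × ℝ → ℝ≥0∞, Measurable[m.prod inferInstance] W ∧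
      ∀ x A, MeasurableSet[m] A →
        ∫⁻ ω in A, W (ω, x) ∂P = ∫⁻ ω in A, f (ω, x) ∂P := by
  have hsimple : ∀ φ : SimpleFunc (Ω × ℝ) ℝ≥0,
      ∃ W : Ω × ℝ → ℝ≥0∞, Measurable[m.prod inferInstance] W ∧
      ∀ x A, MeasurableSet[m] A →
        ∫⁻ ω in A, W (ω, x) ∂P = ∫⁻ ω in A, (φ (ω, x) : ℝ≥0∞) ∂P := by
    intro φ
    induction φ using SimpleFunc.induction with
    | @const c s hs =>
      obtain ⟨W, hW, hWA⟩ := exists_joint_condProb (P := P) hm hs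
      refine ⟨fun z => c * W z, hW.const_mul _, fun x A hA => ?_⟩
      have hsx : Measurable fun ω => s.indicator (1 : Ω × ℝ → ℝ≥0∞) (ω, x) :=
        (measurable_one.indicator hs).comp measurable_prodMk_right
      dsimp only
      rw [lintegral_const_mul _ (measurable_section hm hW x), hWA x A hA,
        ← lintegral_const_mul _ hsx]
      congr 1 with ω
      by_cases h : (ω, x) ∈ s <;> simp [h]
    | @add f g _ hf hg =>
      obtain ⟨W, hW, hWA⟩ := hf
      obtain ⟨V, hV, hVA⟩ := hg
      refine ⟨fun z => W z + V z, hW.add hV, fun x A hA => ?_⟩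
      have hfx : Measurable fun ω => (f (ω, x) : ℝ≥0∞) :=
        f.measurable.coe_nnreal_ennreal.comp measurable_prodMk_right
      dsimp only
      rw [lintegral_add_left (measurable_section hm hW x), hWA x A hA, hVA x A hA,
        ← lintegral_add_left hfx]
      simp
  -- Increments of a simple approximation are used because their versions can be summed; versions of
  -- an increasing sequence need not increase pointwise.
  choose W hW hWA using fun n => hsimple (SimpleFunc.eapproxDiff f n)
  refine ⟨fun z => ∑' n, W n z, measurable_tsum_ennreal hW, fun x A hA => ?_⟩
  dsimp only
  have hfx : ∀ n, Measurable fun ω => (SimpleFunc.eapproxDiff f n (ω, x) : ℝ≥0∞) := fun n =>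
    (SimpleFunc.measurable _).coe_nnreal_ennreal.comp measurable_prodMk_right
  rw [lintegral_tsum fun n => (measurable_section hm (hW n) x).aemeasurable]
  simp_rw [fun n => hWA n x A hA]
  rw [← lintegral_tsum fun n => (hfx n).aemeasurable]
  simp_rw [SimpleFunc.tsum_eapproxDiff f hf]

/-! ### Integrals against a martingale killed at an exit time -/

/-- `ϑ` is, on `S t \ S T`, the time at which the adapted decreasing family of sets `S` is left. -/
structure IsExitTime (𝓕 : Filtration ℝ≥0 mΩ) (S : ℝ≥0 → Set Ω) (ϑ : Ω → ℝ≥0) (t T : ℝ≥0) :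
    Prop where
  antitone : Antitone S
  measurableSet : ∀ u, MeasurableSet[𝓕 u] (S u)
  lt_iff : ∀ ω ∈ S t \ S T, ∀ u, t ≤ u → u ≤ T → (u < ϑ ω ↔ ω ∈ S u)

section ExitTime

variable {P : Measure Ω} {𝓕 : Filtration ℝ≥0 mΩ} {M : ℝ≥0 → Ω → ℝ}
  {S : ℝ≥0 → Set Ω} {ϑ : Ω → ℝ≥0} {t T : ℝ≥0} {Y H : ℝ≥0 → Ω → ℝ}

lemma IsExitTime.mem_Ioc (hS : IsExitTime 𝓕 S ϑ t T) (htT : t ≤ T) {ω : Ω}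
    (hω : ω ∈ S t \ S T) : ϑ ω ∈ Ioc t T :=
  ⟨(hS.lt_iff ω hω t le_rfl htT).2 hω.1,
    not_lt.1 fun h => hω.2 ((hS.lt_iff ω hω T htT le_rfl).1 h)⟩

/-- On S t \ S T, ϑ lies in (a, b] exactly when ω lies in S a \ S b. Evaluation at ϑ, which is not
adapted information at time a, thus becomes a combination of indicators of adapted sets. -/
lemma SimplePredictable.process_exitTime (K : SimplePredictable 𝓕 t T)
    (hS : IsExitTime 𝓕 S ϑ t T) (N : Ω → ℝ) (ω : Ω) :
    K.process (ϑ ω) ω * (S t \ S T).indicator N ω =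
      ∑ i, K.coeff i ω * (S (K.left i) \ S (K.right i)).indicator N ω := by
  rw [SimplePredictable.process, Finset.sum_mul]
  refine Finset.sum_congr rfl fun i _ => ?_
  have hl := K.le_left i
  have hlr := K.left_le_right i
  have hr := K.right_le i
  by_cases hω : ω ∈ S t \ S T
  · have h1 := hS.lt_iff ω hω (K.left i) hl (hlr.trans hr)
    have h2 := hS.lt_iff ω hω (K.right i) (hl.trans hlr) hr
    by_cases h : ω ∈ S (K.left i) \ S (K.right i)
    · have : ϑ ω ∈ Ioc (K.left i) (K.right i) := ⟨h1.2 h.1, not_lt.1 fun h' => h.2 (h2.1 h')⟩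
      simp [hω, h, this]
    · have : ϑ ω ∉ Ioc (K.left i) (K.right i) :=
        fun h' => h ⟨h1.1 h'.1, fun h3 => (h2.2 h3).not_ge h'.2⟩
      simp [h, this]
  · have : ω ∉ S (K.left i) \ S (K.right i) :=
      fun h => hω ⟨hS.antitone hl h.1, fun h' => h.2 (hS.antitone hr h')⟩
    simp [hω, this]

lemma integrable_coeff_mul (hM : Martingale M 𝓕 P) (K : SimplePredictable 𝓕 t T)
    (i : Fin K.n) {B : Set Ω} (hB : MeasurableSet B) (u : ℝ≥0) :
    Integrable (fun ω => K.coeff i ω * B.indicator (M u) ω) P := by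
  obtain ⟨c, hc⟩ := K.bounded
  exact ((hM.integrable u).indicator hB).bdd_mul
    ((K.measurable i).mono (𝓕.le _)).aestronglyMeasurable (ae_of_all _ (hc i))

lemma integrable_process_exitTime (hM : Martingale M 𝓕 P) (hS : IsExitTime 𝓕 S ϑ t T)
    (K : SimplePredictable 𝓕 t T) :
    Integrable (fun ω => K.process (ϑ ω) ω * (S t \ S T).indicator (M T) ω) P := by
  simp_rw [K.process_exitTime hS]
  exact integrable_finsetSum _ fun i _ => integrable_coeff_mul hM K i
    (((𝓕.le _) _ (hS.measurableSet _)).diff ((𝓕.le _) _ (hS.measurableSet _))) T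

/-- An elementary integral involves finitely many times, so equality almost surely at each fixed
time is enough. -/
lemma integral_ae_eq (hY : ∀ u, Y u =ᵐ[P] (S u).indicator (M u)) (K : SimplePredictable 𝓕 t T) :
    K.integral Y =ᵐ[P] fun ω => ∑ i, (K.coeff i ω * (S (K.right i)).indicator (M (K.right i)) ω
      - K.coeff i ω * (S (K.left i)).indicator (M (K.left i)) ω) := by
  have h : ∀ᵐ ω ∂P, ∀ i : Fin K.n,
      Y (K.right i) ω = (S (K.right i)).indicator (M (K.right i)) ω ∧
      Y (K.left i) ω = (S (K.left i)).indicator (M (K.left i)) ω :=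
    ae_all_iff.2 fun i => (hY _).and (hY _)
  filter_upwards [h] with ω hω
  exact Finset.sum_congr rfl fun i _ => by rw [(hω i).1, (hω i).2, mul_sub]

lemma integrable_integral (hM : Martingale M 𝓕 P) (hS : IsExitTime 𝓕 S ϑ t T)
    (hY : ∀ u, Y u =ᵐ[P] (S u).indicator (M u)) (K : SimplePredictable 𝓕 t T) :
    Integrable (K.integral Y) P := by
  refine Integrable.congr ?_ (integral_ae_eq hY K).symm
  exact integrable_finsetSum _ fun i _ =>
    (integrable_coeff_mul hM K i ((𝓕.le _) _ (hS.measurableSet _)) _).sub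
    (integrable_coeff_mul hM K i ((𝓕.le _) _ (hS.measurableSet _)) _)

/-- The elementary integral against a martingale killed at `ϑ` is minus evaluation at `ϑ`. -/
lemma setIntegral_integral_eq [IsProbabilityMeasure P] (hM : Martingale M 𝓕 P)
    (hS : IsExitTime 𝓕 S ϑ t T) (hY : ∀ u, Y u =ᵐ[P] (S u).indicator (M u))
    (K : SimplePredictable 𝓕 t T) {A : Set Ω} (hA : MeasurableSet[𝓕 t] A) :
    ∫ ω in A, K.integral Y ω ∂P =
      -∫ ω in A, K.process (ϑ ω) ω * (S t \ S T).indicator (M T) ω ∂P := by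
  have hAm := 𝓕.le _ _ hA
  have hSm : ∀ u, MeasurableSet (S u) := fun u => 𝓕.le _ _ (hS.measurableSet u)
  -- A, S u and the coefficient are all 𝓕_u-measurable once `K.left i ≤ u`, so M_u may be replaced
  -- by M_T at both end points. The increment then collapses to minus the indicator of S a \ S b.
  have hto : ∀ (i : Fin K.n) (u : ℝ≥0), K.left i ≤ u → u ≤ T →
      ∫ ω in A, K.coeff i ω * (S u).indicator (M u) ω ∂P =
      ∫ ω in A, K.coeff i ω * (S u).indicator (M T) ω ∂P := by
    intro i u hu huT
    obtain ⟨c, hc⟩ := K.bounded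
    have hmeas : StronglyMeasurable[𝓕 u] ((A ∩ S u).indicator (K.coeff i)) :=
      ((K.measurable i).mono (𝓕.mono hu)).indicator
        ((𝓕.mono ((K.le_left i).trans hu) _ hA).inter (hS.measurableSet u))
    have hbd : ∀ ω, |(A ∩ S u).indicator (K.coeff i) ω| ≤ |c| := fun ω => by
      by_cases h : ω ∈ A ∩ S u
      · simpa [h] using (hc i ω).trans (le_abs_self c)
      · simp [h]
    have h := integral_mul_martingale hM huT hmeas hbd
    rw [← integral_indicator hAm, ← integral_indicator hAm]
    convert h using 2 <;>
    · ext ω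
      by_cases h1 : ω ∈ A <;> by_cases h2 : ω ∈ S u <;> simp [h1, h2]
  rw [setIntegral_congr_ae hAm ((integral_ae_eq hY K).mono fun ω h _ => h)]
  simp_rw [K.process_exitTime hS]
  have hi := fun i u v => (integrable_coeff_mul hM K i (hSm u) v).integrableOn (s := A)
  have hi2 : ∀ i : Fin K.n, IntegrableOn
      (fun ω => K.coeff i ω * (S (K.left i) \ S (K.right i)).indicator (M T) ω) A P := fun i =>
    (integrable_coeff_mul hM K i ((hSm _).diff (hSm _)) _).integrableOn
  have hi1 : ∀ i : Fin K.n, IntegrableOn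
      (fun ω => K.coeff i ω * (S (K.right i)).indicator (M (K.right i)) ω
        - K.coeff i ω * (S (K.left i)).indicator (M (K.left i)) ω) A P := fun i =>
    (hi i _ _).sub (hi i _ _)
  rw [integral_finsetSum _ fun i _ => hi1 i, integral_finsetSum _ fun i _ => hi2 i,
    ← Finset.sum_neg_distrib]
  refine Finset.sum_congr rfl fun i _ => ?_
  rw [integral_sub (hi i _ _) (hi i _ _), hto i _ (K.left_le_right i) (K.right_le i),
    hto i _ le_rfl ((K.left_le_right i).trans (K.right_le i)), ← integral_sub (hi i _ _) (hi i _ _),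
    ← integral_neg]
  congr 1 with ω
  have hsub := hS.antitone (K.left_le_right i)
  by_cases h1 : ω ∈ S (K.right i)
  · simp [h1, hsub h1]
  · by_cases h2 : ω ∈ S (K.left i) <;> simp [h1, h2]

/-- For K ≥ 0 the value at ϑ is nonnegative, so its L¹ norm is its mean, which is -E ∫ K dY. This is
at most E|∫ K dY|, and K itself is admissible in the supremum defining `size`. -/
lemma lintegral_process_le_size [IsProbabilityMeasure P] (hM : Martingale M 𝓕 P)
    (hM0 : ∀ u ω, 0 ≤ M u ω)
    (htT : t ≤ T) (hS : IsExitTime 𝓕 S ϑ t T) (hY : ∀ u, Y u =ᵐ[P] (S u).indicator (M u))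
    (K : SimplePredictable 𝓕 t T) (hK : ∀ u ∈ Ioc t T, ∀ ω, 0 ≤ K.process u ω) :
    ∫⁻ ω, ‖K.process (ϑ ω) ω * (S t \ S T).indicator (M T) ω‖ₑ ∂P ≤ K.size P Y := by
  have h0 : ∀ ω, 0 ≤ K.process (ϑ ω) ω * (S t \ S T).indicator (M T) ω := fun ω => by
    by_cases h : ω ∈ S t \ S T
    · exact mul_nonneg (hK _ (hS.mem_Ioc htT h) ω) (indicator_nonneg (fun _ _ => hM0 _ _) ω)
    · simp [h]
  have h1 := setIntegral_integral_eq hM hS hY K (A := univ) MeasurableSet.univ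
  rw [setIntegral_univ, setIntegral_univ] at h1
  calc ∫⁻ ω, ‖K.process (ϑ ω) ω * (S t \ S T).indicator (M T) ω‖ₑ ∂P
      = ∫⁻ ω, ENNReal.ofReal (K.process (ϑ ω) ω * (S t \ S T).indicator (M T) ω) ∂P :=
        lintegral_congr fun ω => Real.enorm_of_nonneg (h0 ω)
    _ = ENNReal.ofReal (∫ ω, K.process (ϑ ω) ω * (S t \ S T).indicator (M T) ω ∂P) :=
        (ofReal_integral_eq_lintegral_ofReal (integrable_process_exitTime hM hS K)
          (ae_of_all _ h0)).symm
    _ = ‖∫ ω, K.integral Y ω ∂P‖ₑ := by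
        rw [h1, enorm_neg, Real.enorm_of_nonneg (integral_nonneg h0)]
    _ ≤ ∫⁻ ω, ‖K.integral Y ω‖ₑ ∂P := enorm_integral_le_lintegral_enorm _
    _ ≤ K.size P Y := le_iSup₂_of_le K (fun u hu ω => (abs_of_nonneg (hK u hu ω)).le) le_rfl

/-- The Daniell mean dominates the expected absolute value at the exit time. -/
lemma lintegral_exitTime_le_daniellMean [IsProbabilityMeasure P] (hM : Martingale M 𝓕 P)
    (hM0 : ∀ u ω, 0 ≤ M u ω)
    (htT : t ≤ T) (hS : IsExitTime 𝓕 S ϑ t T) (hY : ∀ u, Y u =ᵐ[P] (S u).indicator (M u)) :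
    ∫⁻ ω, ‖H (ϑ ω) ω * (S t \ S T).indicator (M T) ω‖ₑ ∂P ≤ daniellMean P 𝓕 Y H t T := by
  refine le_iInf₂ fun K hK => ?_
  have hmono : ∀ᵐ ω ∂P, Monotone fun n =>
      ‖(K n).process (ϑ ω) ω * (S t \ S T).indicator (M T) ω‖ₑ := by
    refine ae_of_all _ fun ω m n hmn => ?_
    by_cases h : ω ∈ S t \ S T
    · obtain ⟨h1, h2, -⟩ := hK _ (hS.mem_Ioc htT h) ω
      simp only [enorm_mul]
      gcongr
      rw [Real.enorm_of_nonneg (h1 m), Real.enorm_of_nonneg (h1 n)]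
      exact ENNReal.ofReal_le_ofReal (h2 hmn)
    · simp [h]
  calc ∫⁻ ω, ‖H (ϑ ω) ω * (S t \ S T).indicator (M T) ω‖ₑ ∂P
      ≤ ∫⁻ ω, ⨆ n, ‖(K n).process (ϑ ω) ω * (S t \ S T).indicator (M T) ω‖ₑ ∂P := by
        refine lintegral_mono fun ω => ?_
        by_cases h : ω ∈ S t \ S T
        · obtain ⟨h1, -, h3⟩ := hK _ (hS.mem_Ioc htT h) ω
          simp only [enorm_mul]
          rw [← ENNReal.iSup_mul]
          gcongr
          rw [Real.enorm_eq_ofReal_abs]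
          refine h3.trans (iSup_mono fun n => ?_)
          rw [Real.enorm_of_nonneg (h1 n)]
        · simp [h]
    _ = ⨆ n, ∫⁻ ω, ‖(K n).process (ϑ ω) ω * (S t \ S T).indicator (M T) ω‖ₑ ∂P :=
        lintegral_iSup' (fun n =>
          (integrable_process_exitTime hM hS (K n)).aestronglyMeasurable.enorm) hmono
    _ ≤ ⨆ n, (K n).size P Y := iSup_mono fun n =>
        lintegral_process_le_size hM hM0 htT hS hY (K n) fun u hu ω => (hK u hu ω).1 n

/-- The Daniell integral against a martingale killed at `ϑ` is, after conditioning, minus the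
evaluation at `ϑ`. -/
lemma IsDaniellIntegral.setIntegral_eq [IsProbabilityMeasure P] {I : Ω → ℝ}
    (hI : IsDaniellIntegral P 𝓕 Y H t T I)
    (hM : Martingale M 𝓕 P) (hM0 : ∀ u ω, 0 ≤ M u ω)
    (htT : t ≤ T) (hS : IsExitTime 𝓕 S ϑ t T) (hY : ∀ u, Y u =ᵐ[P] (S u).indicator (M u))
    (hH : AEStronglyMeasurable (fun ω => H (ϑ ω) ω * (S t \ S T).indicator (M T) ω) P)
    {A : Set Ω} (hA : MeasurableSet[𝓕 t] A) :
    ∫ ω in A, I ω ∂P = -∫ ω in A, H (ϑ ω) ω * (S t \ S T).indicator (M T) ω ∂P := by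
  obtain ⟨hIint, K, hK1, hK2⟩ := hI
  -- Convergence in Daniell mean forces L¹ convergence of the weighted values at ϑ, by domination.
  have hlim : Tendsto (fun n => ∫⁻ ω, ‖(K n).process (ϑ ω) ω * (S t \ S T).indicator (M T) ω
      - H (ϑ ω) ω * (S t \ S T).indicator (M T) ω‖ₑ ∂P) atTop (𝓝 0) := by
    refine tendsto_of_tendsto_of_tendsto_of_le_of_le tendsto_const_nhds hK1 (fun _ => zero_le)
      fun n => ?_
    refine le_trans (le_of_eq (lintegral_congr fun ω => ?_))
      (lintegral_exitTime_le_daniellMean hM hM0 htT hS hY)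
    rw [← enorm_neg]
    congr 1
    ring
  have hint := integrable_process_exitTime hM hS
  -- Some approximation lies within L¹ distance 1, so the limit is integrable with no separate
  -- hypothesis.
  have hHint : Integrable (fun ω => H (ϑ ω) ω * (S t \ S T).indicator (M T) ω) P := by
    obtain ⟨n, hn⟩ := (hlim.eventually (gt_mem_nhds one_pos)).exists
    have h1 : Integrable (fun ω => (K n).process (ϑ ω) ω * (S t \ S T).indicator (M T) ω
      - H (ϑ ω) ω * (S t \ S T).indicator (M T) ω) P :=
      ⟨(hint (K n)).aestronglyMeasurable.sub hH, hn.trans ENNReal.one_lt_top⟩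
    exact ((hint (K n)).sub h1).congr (ae_of_all _ fun ω => by simp)
  have h1 := tendsto_setIntegral_of_L1 _ hHint.aestronglyMeasurable
    (Eventually.of_forall fun n => hint (K n)) hlim A
  have h2 := tendsto_setIntegral_of_L1 I hIint.aestronglyMeasurable
    (Eventually.of_forall fun n => integrable_integral hM hS hY (K n)) hK2 A
  simp_rw [fun n => setIntegral_integral_eq hM hS hY (K n) hA] at h2
  exact tendsto_nhds_unique h2 h1.neg

/-- The localized integral against a martingale killed at `ϑ` is, after conditioning, minus the
evaluation at `ϑ`. -/
lemma IsStochIntegral.setIntegral_eq [IsProbabilityMeasure P] {I : Ω → ℝ}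
    (hI : IsStochIntegral P 𝓕 Y H t T I)
    (hM : Martingale M 𝓕 P) (hM0 : ∀ u ω, 0 ≤ M u ω)
    (htT : t ≤ T) (hS : IsExitTime 𝓕 S ϑ t T) (hY : ∀ u, Y u =ᵐ[P] (S u).indicator (M u))
    (hϑ : Measurable ϑ)
    (hH : Integrable (fun ω => H (ϑ ω) ω * (S t \ S T).indicator (M T) ω) P)
    {A : Set Ω} (hA : MeasurableSet[𝓕 t] A) :
    ∫ ω in A, I ω ∂P = -∫ ω in A, H (ϑ ω) ω * (S t \ S T).indicator (M T) ω ∂P := by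
  obtain ⟨hIint, σ, J, hσ, hJ, hJI⟩ := hI
  have hset : ∀ n, MeasurableSet {ω | (ϑ ω : WithTop ℝ≥0) ≤ σ n ω} := by
    intro n
    have hd := TopologicalSpace.exists_countable_dense ℝ≥0
    obtain ⟨D, hDc, hD⟩ := hd
    -- The complement is {σ n < ϑ}, detected by a countable dense set of times q with σ n ≤ q < ϑ;
    -- only the stopping time property of σ n and the measurability of ϑ enter.
    have : {ω | (ϑ ω : WithTop ℝ≥0) ≤ σ n ω} =
        (⋃ q ∈ D, {ω | σ n ω ≤ (q : WithTop ℝ≥0)} ∩ {ω | q < ϑ ω})ᶜ := by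
      ext ω
      simp only [mem_ofPred_eq, mem_compl_iff, mem_iUnion, mem_inter_iff, not_exists, not_and,
        not_lt]
      refine ⟨fun h q _ hq => WithTop.coe_le_coe.1 (h.trans hq), fun h => ?_⟩
      by_contra hlt
      rw [not_le] at hlt
      lift σ n ω to ℝ≥0 using (hlt.trans_le le_top).ne with s hs
      obtain ⟨q, hqD, hq⟩ := hD.exists_between (WithTop.coe_lt_coe.1 hlt)
      exact (h q hqD (WithTop.coe_le_coe.2 hq.1.le)).not_gt hq.2
    rw [this]
    exact (MeasurableSet.biUnion hDc fun q _ => (𝓕.le _ _ (hσ.isStoppingTime n q)).inter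
      (measurableSet_lt measurable_const hϑ)).compl
  have heq : ∀ n ω, {ω' | (ϑ ω : WithTop ℝ≥0) ≤ σ n ω'}.indicator (H (ϑ ω)) ω
      * (S t \ S T).indicator (M T) ω = {ω | (ϑ ω : WithTop ℝ≥0) ≤ σ n ω}.indicator
        (fun ω => H (ϑ ω) ω * (S t \ S T).indicator (M T) ω) ω := by
    intro n ω
    rw [indicator_apply {ω | (ϑ ω : WithTop ℝ≥0) ≤ σ n ω},
      indicator_apply {ω' | (ϑ ω : WithTop ℝ≥0) ≤ σ n ω'}]
    simp only [mem_ofPred_eq, ite_mul, zero_mul]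
  have hn : ∀ n, ∫ ω in A, J n ω ∂P = -∫ ω in A, {ω | (ϑ ω : WithTop ℝ≥0) ≤ σ n ω}.indicator
      (fun ω => H (ϑ ω) ω * (S t \ S T).indicator (M T) ω) ω ∂P := by
    intro n
    rw [(hJ n).setIntegral_eq hM hM0 htT hS hY ?_ hA]
    · simp_rw [heq]
    · simp_rw [heq]
      exact hH.aestronglyMeasurable.indicator (hset n)
  have h1 : Tendsto (fun n => ∫ ω in A, J n ω ∂P) atTop (𝓝 (∫ ω in A, I ω ∂P)) :=
    tendsto_setIntegral_of_L1 I hIint.aestronglyMeasurable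
      (Eventually.of_forall fun n => (hJ n).1) hJI A
  simp_rw [hn] at h1
  have h2 : Tendsto (fun n => ∫ ω in A, {ω | (ϑ ω : WithTop ℝ≥0) ≤ σ n ω}.indicator
      (fun ω => H (ϑ ω) ω * (S t \ S T).indicator (M T) ω) ω ∂P) atTop
      (𝓝 (∫ ω in A, H (ϑ ω) ω * (S t \ S T).indicator (M T) ω ∂P)) := by
    -- The integrability `hH` of the value at ϑ is essential here: it dominates all the truncated
    -- values, which converge since σ n eventually exceeds the finite time ϑ.
    refine tendsto_integral_of_dominated_convergence
      (fun ω => ‖H (ϑ ω) ω * (S t \ S T).indicator (M T) ω‖)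
      (fun n => (hH.aestronglyMeasurable.indicator (hset n)).restrict) hH.norm.integrableOn
      (fun n => ae_of_all _ fun ω => norm_indicator_le_norm_self _ _) ?_
    refine ae_restrict_of_ae (hσ.tendsto_top.mono fun ω hω => ?_)
    refine tendsto_const_nhds.congr' ?_
    filter_upwards [hω.eventually (lt_mem_nhds (WithTop.coe_lt_top (ϑ ω)))] with n hn
    rw [indicator_of_mem (s := {ω | (ϑ ω : WithTop ℝ≥0) ≤ σ n ω}) (mem_ofPred_eq ▸ hn.le)]
  exact tendsto_nhds_unique h1 h2.neg

end ExitTime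

/-! ### Optional projection of a martingale against an adapted random measure -/

/-- The `i`-th point of the partition of `[t, T]` into `k + 1` intervals of equal length. -/
def partPoint (t T : ℝ≥0) (k i : ℕ) : ℝ≥0 := t + (T - t) * (i / (k + 1))

lemma partPoint_mono (t T : ℝ≥0) (k : ℕ) : Monotone (partPoint t T k) := fun i j hij => by
  unfold partPoint
  gcongr

lemma partPoint_zero (t T : ℝ≥0) (k : ℕ) : partPoint t T k 0 = t := by simp [partPoint]

lemma partPoint_last {t T : ℝ≥0} (htT : t ≤ T) (k : ℕ) : partPoint t T k (k + 1) = T := by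
  have : ((k + 1 : ℕ) : ℝ≥0) / (k + 1) = 1 := by
    push_cast
    exact div_self (by positivity)
  rw [partPoint, this, mul_one, add_tsub_cancel_of_le htT]

lemma le_partPoint (t T : ℝ≥0) (k i : ℕ) : t ≤ partPoint t T k i := le_self_add

lemma partPoint_le {t T : ℝ≥0} (htT : t ≤ T) {k i : ℕ} (hi : i ≤ k + 1) :
    partPoint t T k i ≤ T :=
  (partPoint_mono t T k hi).trans_eq (partPoint_last htT k)

lemma partPoint_succ (t T : ℝ≥0) (k i : ℕ) :
    partPoint t T k (i + 1) = partPoint t T k i + (T - t) / (k + 1) := by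
  simp only [partPoint, Nat.cast_add, Nat.cast_one, add_div, mul_add, add_assoc, mul_one_div]

/-- The step function on `(t, T]` that takes on each partition interval the value of `g` at its
right end point. -/
def upperStep {E : Type*} [AddCommMonoid E] (t T : ℝ≥0) (k : ℕ) (g : ℝ≥0 → E) (u : ℝ≥0) : E :=
  ∑ i ∈ Finset.range (k + 1),
    (Ioc (partPoint t T k i) (partPoint t T k (i + 1))).indicator
      (fun _ => g (partPoint t T k (i + 1))) u

/-- The step function samples g at the right end of the interval containing u, at most one mesh
width beyond u. Hence right continuity alone yields convergence. -/
lemma exists_upperStep_eq {E : Type*} [AddCommMonoid E] {t T : ℝ≥0} (htT : t ≤ T) (k : ℕ)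
    (g : ℝ≥0 → E) {u : ℝ≥0} (hu : u ∈ Ioc t T) :
    ∃ v, u ≤ v ∧ v ≤ u + (T - t) / (k + 1) ∧ upperStep t T k g u = g v := by
  classical
  have hex : ∃ j, u ≤ partPoint t T k j := ⟨k + 1, by rw [partPoint_last htT]; exact hu.2⟩
  obtain ⟨i, hi⟩ : ∃ i, Nat.find hex = i + 1 := by
    refine Nat.exists_eq_succ_of_ne_zero fun h => ?_
    have := Nat.find_spec hex
    rw [h, partPoint_zero] at this
    exact this.not_gt hu.1
  have h1 : u ≤ partPoint t T k (i + 1) := hi ▸ Nat.find_spec hex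
  have h2 : partPoint t T k i < u := not_le.1 (Nat.find_min hex (by omega))
  have h3 : i < k + 1 := by
    have := Nat.find_min' hex (m := k + 1) (by rw [partPoint_last htT]; exact hu.2)
    omega
  refine ⟨partPoint t T k (i + 1), h1, ?_, ?_⟩
  · rw [partPoint_succ]
    gcongr
  · rw [upperStep, Finset.sum_eq_single_of_mem i (Finset.mem_range.2 h3)]
    · exact indicator_of_mem (mem_Ioc.2 ⟨h2, h1⟩) _
    · intro j _ hj
      refine indicator_of_notMem (fun h => ?_) _
      have hd : Disjoint (Ioc (partPoint t T k j) (partPoint t T k (j + 1)))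
          (Ioc (partPoint t T k i) (partPoint t T k (i + 1))) :=
        (partPoint_mono t T k).pairwise_disjoint_on_Ioc_succ hj
      exact disjoint_left.1 hd h (mem_Ioc.2 ⟨h2, h1⟩)

lemma tendsto_upperStep {E : Type*} [AddCommMonoid E] [TopologicalSpace E] {t T : ℝ≥0}
    (htT : t ≤ T) {g : ℝ≥0 → E} {u : ℝ≥0} (hu : u ∈ Ioc t T)
    (hg : ContinuousWithinAt g (Ici u) u) :
    Tendsto (fun k => upperStep t T k g u) atTop (𝓝 (g u)) := by
  choose v hv1 hv2 hv3 using fun k => exists_upperStep_eq htT k g hu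
  simp_rw [hv3]
  refine Tendsto.comp hg.tendsto (tendsto_nhdsWithin_iff.2 ⟨?_, Eventually.of_forall hv1⟩)
  have h1 : Tendsto (fun k : ℕ => u + (T - t) / ((k : ℝ≥0) + 1)) atTop (𝓝 (u + 0)) := by
    refine tendsto_const_nhds.add ?_
    have := (tendsto_one_div_add_atTop_nhds_zero_nat (𝕜 := ℝ≥0)).const_mul (T - t)
    simpa [div_eq_mul_inv] using this
  rw [add_zero] at h1
  exact tendsto_of_tendsto_of_tendsto_of_le_of_le tendsto_const_nhds h1 hv1 hv2

lemma lintegral_upperStep {t T : ℝ≥0} (κ : Measure ℝ≥0) (k : ℕ) (g : ℝ≥0 → ℝ≥0∞)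
    (htT : t ≤ T) :
    ∫⁻ u in Ioc t T, upperStep t T k g u ∂κ = ∑ i ∈ Finset.range (k + 1),
      g (partPoint t T k (i + 1)) * κ (Ioc (partPoint t T k i) (partPoint t T k (i + 1))) := by
  unfold upperStep
  rw [lintegral_finsetSum _ fun i _ => measurable_const.indicator measurableSet_Ioc]
  refine Finset.sum_congr rfl fun i hi => ?_
  rw [lintegral_indicator_const measurableSet_Ioc, Measure.restrict_apply measurableSet_Ioc,
    inter_eq_left.2]
  exact Ioc_subset_Ioc (le_partPoint _ _ _ _)
    (partPoint_le htT (by have := Finset.mem_range.1 hi; omega))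

lemma sum_measure_partPoint {t T : ℝ≥0} (κ : Measure ℝ≥0) (k j : ℕ) :
    ∑ i ∈ Finset.range j, κ (Ioc (partPoint t T k i) (partPoint t T k (i + 1))) =
      κ (Ioc t (partPoint t T k j)) := by
  induction j with
  | zero => simp [partPoint_zero]
  | succ j ih =>
    rw [Finset.sum_range_succ, ih, ← measure_union _ measurableSet_Ioc,
      Ioc_union_Ioc_eq_Ioc (le_partPoint _ _ _ _) (partPoint_mono _ _ _ j.le_succ)]
    exact disjoint_left.2 fun x hx hx' => hx.2.not_gt hx'.1

/-- Near each point the path is bounded on the right by right continuity and on the left by the left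
limit; compactness of [0, T] glues the local bounds. -/
lemma IsCadlag.exists_bound {f : ℝ≥0 → ℝ} (hf : IsCadlag f) (T : ℝ≥0) :
    ∃ C, ∀ u ≤ T, |f u| ≤ C := by
  have h := (isCompact_Icc (a := (0 : ℝ≥0)) (b := T)).induction_on
    (p := fun s => ∃ C, ∀ u ∈ s, |f u| ≤ C) ⟨0, by simp⟩
    (fun s s' hss ⟨C, hC⟩ => ⟨C, fun u hu => hC u (hss hu)⟩)
    (fun s s' ⟨C, hC⟩ ⟨C', hC'⟩ => ⟨max C C', fun u hu => hu.elim
      (fun h => (hC u h).trans (le_max_left _ _)) (fun h => (hC' u h).trans (le_max_right _ _))⟩)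
    (fun x _ => ?_)
  · obtain ⟨C, hC⟩ := h
    exact ⟨C, fun u hu => hC u ⟨zero_le, hu⟩⟩
  · obtain ⟨h1, l, h2⟩ := hf x
    have e1 := h1.tendsto.abs.eventually (gt_mem_nhds (lt_add_one |f x|))
    have e2 := h2.abs.eventually (gt_mem_nhds (lt_add_one |l|))
    refine ⟨{u | |f u| ≤ max (|f x| + 1) (|l| + 1)}, mem_nhdsWithin_of_mem_nhds ?_, _,
      fun u hu => hu⟩
    rw [← nhdsLT_sup_nhdsGE]
    exact mem_sup.2 ⟨e2.mono fun u hu => hu.le.trans (le_max_right _ _),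
      e1.mono fun u hu => hu.le.trans (le_max_left _ _)⟩

/-- A càdlàg process with measurable marginals is jointly measurable on `(t, T]`. -/
lemma measurable_indicator_of_rightCont {α : Type*} {m : MeasurableSpace α} {M : ℝ≥0 → α → ℝ}
    (hM : ∀ u, Measurable (M u)) (hc : ∀ a u, ContinuousWithinAt (fun v => M v a) (Ici u) u)
    {t T : ℝ≥0} (htT : t ≤ T) :
    Measurable fun z : α × ℝ≥0 => (Ioc t T).indicator (fun u => M u z.1) z.2 := by
  have h1 : ∀ k, Measurable fun z : α × ℝ≥0 =>
      (Ioc t T).indicator (fun u => upperStep t T k (fun v => M v z.1) u) z.2 := by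
    intro k
    have : Measurable fun z : α × ℝ≥0 => upperStep t T k (fun v => M v z.1) z.2 := by
      refine Finset.measurable_fun_sum _ fun i _ => ?_
      exact ((hM _).comp measurable_fst).indicator (measurable_snd measurableSet_Ioc)
    exact this.indicator (measurable_snd measurableSet_Ioc)
  refine measurable_of_tendsto_metrizable h1 (tendsto_pi_nhds.2 fun z => ?_)
  by_cases hz : z.2 ∈ Ioc t T
  · simp only [hz, indicator_of_mem]
    exact tendsto_upperStep htT hz (hc z.1 z.2)
  · simp [hz]

section OptionalProjection

variable {P : Measure Ω} [IsProbabilityMeasure P] {𝓕 : Filtration ℝ≥0 mΩ} {M : ℝ≥0 → Ω → ℝ}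
  {t T : ℝ≥0} {κ : Ω → Measure ℝ≥0}

lemma lintegral_sum_mul_martingale (hM : Martingale M 𝓕 P) (hM0 : ∀ u ω, 0 ≤ M u ω)
    {s : Finset ℕ} {r : ℕ → ℝ≥0} (hr : ∀ i ∈ s, r i ≤ T) {w : ℕ → Ω → ℝ≥0∞}
    (hw : ∀ i ∈ s, Measurable[𝓕 (r i)] (w i)) :
    ∫⁻ ω, ∑ i ∈ s, ENNReal.ofReal (M (r i) ω) * w i ω ∂P =
      ∫⁻ ω, ENNReal.ofReal (M T ω) * ∑ i ∈ s, w i ω ∂P := by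
  have hm : ∀ u, ∀ i ∈ s, Measurable fun ω => ENNReal.ofReal (M u ω) * w i ω := fun u i hi =>
    ((hM.1 u).mono (𝓕.le u)).measurable.ennreal_ofReal.mul ((hw i hi).mono (𝓕.le _) le_rfl)
  simp_rw [Finset.mul_sum]
  rw [lintegral_finsetSum' _ fun i hi => (hm _ i hi).aemeasurable,
    lintegral_finsetSum' _ fun i hi => (hm _ i hi).aemeasurable]
  exact Finset.sum_congr rfl fun i hi => lintegral_mul_martingale hM hM0 (hr i hi) (hw i hi)

/-- The mass of a partition interval is known at its right end point, so the sum of M(right end)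
times mass has mean exactly E[M_T κ(t, T]]. Fatou's lemma, once along the path and once under P,
gives the inequality; finiteness of κ plays no role. -/
lemma lintegral_martingale_le (hM : Martingale M 𝓕 P) (hM0 : ∀ u ω, 0 ≤ M u ω)
    (hc : ∀ ω, IsCadlag fun u => M u ω) (htT : t ≤ T)
    (hκ : ∀ a b, t ≤ a → a ≤ b → b ≤ T → Measurable[𝓕 b] fun ω => κ ω (Ioc a b)) :
    ∫⁻ ω, ∫⁻ u in Ioc t T, ENNReal.ofReal (M u ω) ∂(κ ω) ∂P ≤
      ∫⁻ ω, ENNReal.ofReal (M T ω) * κ ω (Ioc t T) ∂P := by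
  set q := partPoint t T with hq
  have hqT : ∀ k i, i ∈ Finset.range (k + 1) → q k (i + 1) ≤ T := fun k i hi =>
    partPoint_le htT (by have := Finset.mem_range.1 hi; omega)
  have hκq : ∀ k i, i ∈ Finset.range (k + 1) →
      Measurable[𝓕 (q k (i + 1))] fun ω => κ ω (Ioc (q k i) (q k (i + 1))) := fun k i hi =>
    hκ _ _ (le_partPoint _ _ _ _) (partPoint_mono _ _ _ i.le_succ) (hqT k i hi)
  have hMm : ∀ u, Measurable fun ω => ENNReal.ofReal (M u ω) := fun u =>
    ((hM.1 u).mono (𝓕.le u)).measurable.ennreal_ofReal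
  calc ∫⁻ ω, ∫⁻ u in Ioc t T, ENNReal.ofReal (M u ω) ∂(κ ω) ∂P
      ≤ ∫⁻ ω, liminf (fun k => ∑ i ∈ Finset.range (k + 1),
          ENNReal.ofReal (M (q k (i + 1)) ω) * κ ω (Ioc (q k i) (q k (i + 1)))) atTop ∂P := by
        refine lintegral_mono fun ω => ?_
        have h1 : ∫⁻ u in Ioc t T, ENNReal.ofReal (M u ω) ∂(κ ω) =
            ∫⁻ u in Ioc t T, liminf (fun k =>
              upperStep t T k (fun v => ENNReal.ofReal (M v ω)) u) atTop ∂(κ ω) := by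
          refine setLIntegral_congr_fun measurableSet_Ioc fun u hu => ?_
          exact (Tendsto.liminf_eq (tendsto_upperStep htT hu
            (ENNReal.continuous_ofReal.continuousAt.comp_continuousWithinAt (hc ω u).1))).symm
        dsimp only
        rw [h1]
        simp_rw [hq, ← lintegral_upperStep (κ ω) _ (fun v => ENNReal.ofReal (M v ω)) htT]
        refine lintegral_liminf_le fun k => ?_
        exact Finset.measurable_fun_sum _ fun i _ => measurable_const.indicator measurableSet_Ioc
    _ ≤ liminf (fun k => ∫⁻ ω, ∑ i ∈ Finset.range (k + 1),
          ENNReal.ofReal (M (q k (i + 1)) ω) * κ ω (Ioc (q k i) (q k (i + 1))) ∂P) atTop := by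
        refine lintegral_liminf_le fun k => Finset.measurable_fun_sum _ fun i hi => ?_
        exact (hMm _).mul ((hκq k i hi).mono (𝓕.le _) le_rfl)
    _ = liminf (fun _ : ℕ => ∫⁻ ω, ENNReal.ofReal (M T ω) * κ ω (Ioc t T) ∂P) atTop := by
        refine congrArg (liminf · atTop) (funext fun k => ?_)
        rw [lintegral_sum_mul_martingale hM hM0 (hqT k) (hκq k)]
        refine lintegral_congr fun ω => ?_
        rw [sum_measure_partPoint, partPoint_last htT]
    _ = _ := liminf_const _

/-- Terms stop contributing once the accumulated mass exceeds c. The induction carries the stronger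
bound by the minimum of c and the mass so far. -/
lemma sum_indicator_measure_le (μ : Measure ℝ≥0) (c : ℝ≥0∞) (k j : ℕ) :
    ∑ i ∈ Finset.range j, (if μ (Ioc t (partPoint t T k (i + 1))) ≤ c then
      μ (Ioc (partPoint t T k i) (partPoint t T k (i + 1))) else 0) ≤ c := by
  classical
  suffices h : ∑ i ∈ Finset.range j, (if μ (Ioc t (partPoint t T k (i + 1))) ≤ c then
      μ (Ioc (partPoint t T k i) (partPoint t T k (i + 1))) else 0) ≤
      min c (μ (Ioc t (partPoint t T k j))) from h.trans (min_le_left _ _)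
  induction j with
  | zero => simp
  | succ j ih =>
    have hle : ∑ i ∈ Finset.range (j + 1), (if μ (Ioc t (partPoint t T k (i + 1))) ≤ c then
      μ (Ioc (partPoint t T k i) (partPoint t T k (i + 1))) else 0) ≤
      μ (Ioc t (partPoint t T k (j + 1))) := by
      rw [← sum_measure_partPoint μ k (j + 1)]
      exact Finset.sum_le_sum fun i _ => by split_ifs <;> simp
    refine le_min ?_ hle
    by_cases h : μ (Ioc t (partPoint t T k (j + 1))) ≤ c
    · exact hle.trans h
    · rw [Finset.sum_range_succ, if_neg h, add_zero]
      exact ih.trans (min_le_left _ _)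

/-- Reverse Fatou needs a dominating constant, so the partition sums are cut off when M or the
accumulated mass exceeds n, which bounds them by n². The cut-off is inactive on `G n`, and the sets
`G n` exhaust Ω because càdlàg paths are bounded on [0, T] and κ(t, T] is finite. -/
lemma le_lintegral_martingale (hM : Martingale M 𝓕 P) (hM0 : ∀ u ω, 0 ≤ M u ω)
    (hc : ∀ ω, IsCadlag fun u => M u ω) (htT : t ≤ T)
    (hκ : ∀ a b, t ≤ a → a ≤ b → b ≤ T → Measurable[𝓕 b] fun ω => κ ω (Ioc a b))
    (hfin : ∀ ω, κ ω (Ioc t T) ≠ ∞) :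
    ∫⁻ ω, ENNReal.ofReal (M T ω) * κ ω (Ioc t T) ∂P ≤
      ∫⁻ ω, ∫⁻ u in Ioc t T, ENNReal.ofReal (M u ω) ∂(κ ω) ∂P := by
  classical
  set q := partPoint t T with hq
  have hqT : ∀ k i, i ∈ Finset.range (k + 1) → q k (i + 1) ≤ T := fun k i hi =>
    partPoint_le htT (by have := Finset.mem_range.1 hi; omega)
  have hκq : ∀ k i, i ∈ Finset.range (k + 1) →
      Measurable[𝓕 (q k (i + 1))] fun ω => κ ω (Ioc (q k i) (q k (i + 1))) := fun k i hi =>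
    hκ _ _ (le_partPoint _ _ _ _) (partPoint_mono _ _ _ i.le_succ) (hqT k i hi)
  have hMm : ∀ u, Measurable fun ω => ENNReal.ofReal (M u ω) := fun u =>
    ((hM.1 u).mono (𝓕.le u)).measurable.ennreal_ofReal
  have hκT : Measurable fun ω => κ ω (Ioc t T) := (hκ t T le_rfl htT le_rfl).mono (𝓕.le _) le_rfl
  let G : ℕ → Set Ω := fun n =>
    {ω | (∀ k, ∀ i ∈ Finset.range (k + 1), M (q k (i + 1)) ω ≤ n) ∧ κ ω (Ioc t T) ≤ n}
  have hGm : ∀ n, MeasurableSet (G n) := fun n => by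
    have : {ω | ∀ k, ∀ i ∈ Finset.range (k + 1), M (q k (i + 1)) ω ≤ n} =
        ⋂ k, ⋂ i ∈ Finset.range (k + 1), {ω | M (q k (i + 1)) ω ≤ n} := by
      ext; simp
    refine MeasurableSet.inter (?_ : MeasurableSet
      {ω | ∀ k, ∀ i ∈ Finset.range (k + 1), M (q k (i + 1)) ω ≤ n}) (hκT measurableSet_Iic)
    rw [this]
    exact MeasurableSet.iInter fun k => Finset.measurableSet_biInter _ fun i _ =>
      ((hM.1 _).mono (𝓕.le _)).measurable measurableSet_Iic
  have hGmono : Monotone G := fun n n' hn ω hω =>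
    ⟨fun k i hi => (hω.1 k i hi).trans (by exact_mod_cast hn),
      hω.2.trans (by exact_mod_cast hn)⟩
  have hGall : ∀ ω, ∃ n, ω ∈ G n := fun ω => by
    obtain ⟨C, hC⟩ := (hc ω).exists_bound T
    obtain ⟨n1, hn1⟩ := exists_nat_ge C
    obtain ⟨n2, hn2⟩ := ENNReal.exists_nat_gt (hfin ω)
    refine ⟨max n1 n2, fun k i hi => ?_, hn2.le.trans (by exact_mod_cast le_max_right _ _)⟩
    exact ((le_abs_self _).trans (hC _ (hqT k i hi))).trans
      (hn1.trans (by exact_mod_cast le_max_left _ _))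
  have hn : ∀ n : ℕ, ∫⁻ ω, (G n).indicator (fun ω => ENNReal.ofReal (M T ω) * κ ω (Ioc t T)) ω ∂P ≤
      ∫⁻ ω, ∫⁻ u in Ioc t T, ENNReal.ofReal (M u ω) ∂(κ ω) ∂P := by
    intro n
    -- The cut-off looks only at the right end point of the current interval, so the weight is
    -- adapted and M may still be replaced by M_T. The indicator of `G n` itself would not be
    -- adapted.
    let w : ℕ → ℕ → Ω → ℝ≥0∞ := fun k i ω =>
      if M (q k (i + 1)) ω ≤ n ∧ κ ω (Ioc t (q k (i + 1))) ≤ n then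
        κ ω (Ioc (q k i) (q k (i + 1))) else 0
    have hw : ∀ k, ∀ i ∈ Finset.range (k + 1), Measurable[𝓕 (q k (i + 1))] (w k i) := by
      intro k i hi
      refine Measurable.ite ?_ (hκq k i hi) measurable_const
      exact ((hM.1 _).measurable measurableSet_Iic).inter
        ((hκ t _ le_rfl (le_partPoint _ _ _ _) (hqT k i hi)) measurableSet_Iic)
    let X : ℕ → Ω → ℝ≥0∞ := fun k ω => ∑ i ∈ Finset.range (k + 1),
      ENNReal.ofReal (M (q k (i + 1)) ω) * w k i ω
    have hXm : ∀ k, Measurable (X k) := fun k => Finset.measurable_fun_sum _ fun i hi =>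
      (hMm _).mul ((hw k i hi).mono (𝓕.le _) le_rfl)
    have hle1 : ∀ k, ∫⁻ ω, (G n).indicator
        (fun ω => ENNReal.ofReal (M T ω) * κ ω (Ioc t T)) ω ∂P ≤ ∫⁻ ω, X k ω ∂P := by
      intro k
      have e1 : ∫⁻ ω, X k ω ∂P = ∫⁻ ω, ENNReal.ofReal (M T ω) *
          ∑ i ∈ Finset.range (k + 1), w k i ω ∂P :=
        lintegral_sum_mul_martingale hM hM0 (hqT k) (hw k)
      rw [e1]
      refine lintegral_mono fun ω => ?_
      by_cases hω : ω ∈ G n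
      swap
      · simp [hω]
      rw [indicator_of_mem hω]
      nth_rw 2 [← partPoint_last htT k]
      rw [← sum_measure_partPoint]
      refine mul_le_mul_right (Finset.sum_le_sum fun i hi => ?_) _
      have h2 : κ ω (Ioc t (q k (i + 1))) ≤ n :=
        (measure_mono (Ioc_subset_Ioc_right (hqT k i hi))).trans hω.2
      simp only [w]
      rw [if_pos ⟨hω.1 k i hi, h2⟩]
    have hbound : ∀ k ω, X k ω ≤ (n : ℝ≥0∞) * n := by
      intro k ω
      calc X k ω ≤ ∑ i ∈ Finset.range (k + 1), (n : ℝ≥0∞) *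
            (if κ ω (Ioc t (q k (i + 1))) ≤ n then κ ω (Ioc (q k i) (q k (i + 1))) else 0) := by
            refine Finset.sum_le_sum fun i _ => ?_
            simp only [w]
            by_cases h1 : M (q k (i + 1)) ω ≤ n ∧ κ ω (Ioc t (q k (i + 1))) ≤ n
            · rw [if_pos h1, if_pos h1.2]
              gcongr
              exact ENNReal.ofReal_le_of_le_toReal (by simpa using h1.1)
            · rw [if_neg h1]
              simp
        _ ≤ n * n := by
            rw [← Finset.mul_sum]
            gcongr
            exact sum_indicator_measure_le (κ ω) n k (k + 1)
    calc ∫⁻ ω, (G n).indicator (fun ω => ENNReal.ofReal (M T ω) * κ ω (Ioc t T)) ω ∂P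
        ≤ limsup (fun k => ∫⁻ ω, X k ω ∂P) atTop := by
          rw [← limsup_const (f := (atTop : Filter ℕ)) (∫⁻ ω, (G n).indicator
            (fun ω => ENNReal.ofReal (M T ω) * κ ω (Ioc t T)) ω ∂P)]
          exact limsup_le_limsup (Eventually.of_forall hle1)
      _ ≤ ∫⁻ ω, limsup (fun k => X k ω) atTop ∂P :=
          limsup_lintegral_le (fun _ => (n : ℝ≥0∞) * n) hXm (fun k => ae_of_all _ (hbound k))
            (by simp [ENNReal.mul_eq_top])
      _ ≤ ∫⁻ ω, ∫⁻ u in Ioc t T, ENNReal.ofReal (M u ω) ∂(κ ω) ∂P := by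
          refine lintegral_mono fun ω => ?_
          have h1 : ∀ k, X k ω ≤ ∫⁻ u in Ioc t T,
              upperStep t T k (fun v => min (ENNReal.ofReal (M v ω)) n) u ∂(κ ω) := by
            intro k
            rw [lintegral_upperStep _ _ _ htT]
            refine Finset.sum_le_sum fun i _ => ?_
            simp only [w]
            split_ifs with h
            · gcongr
              exact le_min le_rfl (ENNReal.ofReal_le_of_le_toReal (by simpa using h.1))
            · simp
          have h2 : Tendsto (fun k => ∫⁻ u in Ioc t T,
              upperStep t T k (fun v => min (ENNReal.ofReal (M v ω)) n) u ∂(κ ω)) atTop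
              (𝓝 (∫⁻ u in Ioc t T, min (ENNReal.ofReal (M u ω)) n ∂(κ ω))) := by
            refine tendsto_lintegral_of_dominated_convergence (fun _ => (n : ℝ≥0∞))
              (fun k => Finset.measurable_fun_sum _ fun i _ =>
                measurable_const.indicator measurableSet_Ioc) (fun k => ?_) ?_ ?_
            · refine (ae_restrict_iff' measurableSet_Ioc).2 (ae_of_all _ fun u hu => ?_)
              obtain ⟨v, -, -, hv⟩ := exists_upperStep_eq htT k
                (fun v => min (ENNReal.ofReal (M v ω)) (n : ℝ≥0∞)) hu
              rw [hv]
              exact min_le_right _ _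
            · simp only [lintegral_const, MeasurableSet.univ, Measure.restrict_apply, univ_inter]
              exact ENNReal.mul_ne_top (by simp) (hfin ω)
            · refine (ae_restrict_iff' measurableSet_Ioc).2 (ae_of_all _ fun u hu => ?_)
              have hmin : Continuous fun r : ℝ => min (ENNReal.ofReal r) (n : ℝ≥0∞) :=
                ENNReal.continuous_ofReal.min continuous_const
              exact tendsto_upperStep htT hu
                (hmin.continuousAt.comp_continuousWithinAt (f := fun u => M u ω) (hc ω u).1)
          calc limsup (fun k => X k ω) atTop
              ≤ limsup (fun k => ∫⁻ u in Ioc t T,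
                upperStep t T k (fun v => min (ENNReal.ofReal (M v ω)) n) u ∂(κ ω)) atTop :=
                limsup_le_limsup (Eventually.of_forall h1)
            _ = ∫⁻ u in Ioc t T, min (ENNReal.ofReal (M u ω)) n ∂(κ ω) := h2.limsup_eq
            _ ≤ _ := lintegral_mono fun u => min_le_left _ _
  calc ∫⁻ ω, ENNReal.ofReal (M T ω) * κ ω (Ioc t T) ∂P
      ≤ ∫⁻ ω, ⨆ n, (G n).indicator (fun ω => ENNReal.ofReal (M T ω) * κ ω (Ioc t T)) ω ∂P := by
        refine lintegral_mono fun ω => ?_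
        obtain ⟨n, hn⟩ := hGall ω
        exact le_iSup_of_le n (by rw [indicator_of_mem hn])
    _ = ⨆ n, ∫⁻ ω, (G n).indicator (fun ω => ENNReal.ofReal (M T ω) * κ ω (Ioc t T)) ω ∂P :=
        lintegral_iSup (fun n => ((hMm T).mul hκT).indicator (hGm n)) fun n n' h ω =>
          indicator_le_indicator_of_subset (hGmono h) (fun _ => zero_le) ω
    _ ≤ _ := iSup_le hn

end OptionalProjection

/-! ### Random measures on the time axis -/

lemma nnreal_generateFrom_Ioc :
    (inferInstance : MeasurableSpace ℝ≥0) =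
      MeasurableSpace.generateFrom {s : Set ℝ≥0 | ∃ l u, l < u ∧ Ioc l u = s} := by
  rw [← borel_eq_generateFrom_Ioc]
  exact BorelSpace.measurable_eq

lemma nnreal_isPiSystem_Ioc : IsPiSystem {s : Set ℝ≥0 | ∃ l u, l < u ∧ Ioc l u = s} := by
  simpa only [exists_prop, mem_univ, true_and] using
    isPiSystem_Ioc_mem (univ : Set ℝ≥0) (univ : Set ℝ≥0)

lemma Ioc_inter_Ioc_eq {t b l u : ℝ≥0} (htb : t ≤ b) :
    ∃ c d, t ≤ c ∧ c ≤ d ∧ d ≤ b ∧ Ioc l u ∩ Ioc t b = Ioc c d := by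
  by_cases h : max l t ≤ min u b
  · exact ⟨max l t, min u b, le_max_right _ _, h, min_le_right _ _, Ioc_inter_Ioc⟩
  · refine ⟨t, t, le_rfl, le_rfl, htb, ?_⟩
    rw [Ioc_inter_Ioc, Ioc_eq_empty (fun h' => h h'.le), Ioc_self]

/-- The integral of a jointly measurable function against a random measure is measurable. -/
lemma measurable_setLIntegral_Ioc {α : Type*} {m : MeasurableSpace α} {κ : α → Measure ℝ≥0}
    {t b : ℝ≥0} (htb : t ≤ b) (hfin : ∀ a, κ a (Ioc t b) ≠ ∞)
    (hκ : ∀ c d, t ≤ c → c ≤ d → d ≤ b → Measurable fun a => κ a (Ioc c d))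
    {ψ : α × ℝ≥0 → ℝ≥0∞} (hψ : Measurable ψ) :
    Measurable fun a => ∫⁻ u in Ioc t b, ψ (a, u) ∂(κ a) := by
  have hmass : Measurable fun a => κ a (Ioc t b) := hκ t b le_rfl htb le_rfl
  have : ∀ a, IsFiniteMeasure ((κ a).restrict (Ioc t b)) := fun a =>
    ⟨by simpa using (hfin a).lt_top⟩
  have hμ : Measurable fun a => (κ a).restrict (Ioc t b) := by
    refine Measurable.measure_of_isPiSystem nnreal_generateFrom_Ioc nnreal_isPiSystem_Ioc ?_
      (by simpa using hmass)
    rintro _ ⟨l, u, -, rfl⟩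
    obtain ⟨c, d, h1, h2, h3, h4⟩ := Ioc_inter_Ioc_eq (l := l) (u := u) htb
    simp_rw [Measure.restrict_apply measurableSet_Ioc, h4]
    exact hκ c d h1 h2 h3
  -- A finite kernel needs a uniform bound on masses, and κ a (Ioc t b) may be unbounded in a. The
  -- measures are therefore normalized and the mass is multiplied back afterwards; where it
  -- vanishes, both sides are 0.
  have hη : Measurable fun a => (κ a (Ioc t b))⁻¹ • (κ a).restrict (Ioc t b) :=
    Measure.measurable_of_measurable_coe _ fun s hs =>
      hmass.inv.mul ((Measure.measurable_coe hs).comp hμ)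
  let η : Kernel α ℝ≥0 := ⟨_, hη⟩
  have hηa : ∀ a, η a = (κ a (Ioc t b))⁻¹ • (κ a).restrict (Ioc t b) := fun a => rfl
  have : IsFiniteKernel η := ⟨⟨1, ENNReal.one_lt_top, fun a => by
    simp [hηa, ENNReal.inv_mul_le_one]⟩⟩
  have h := hmass.mul (hψ.lintegral_kernel_prod_right' (κ := η))
  convert h using 2 with a
  simp only [Pi.mul_apply, hηa, lintegral_smul_measure, smul_eq_mul, ← mul_assoc]
  by_cases h0 : κ a (Ioc t b) = 0
  · simp [Measure.restrict_eq_zero.2 h0]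
  · rw [ENNReal.mul_inv_cancel h0 (hfin a), one_mul]

lemma measurable_signedMeasure_inter {α : Type*} {m : MeasurableSpace α}
    {ν : α → SignedMeasure ℝ≥0} {t b : ℝ≥0} (htb : t ≤ b)
    (hν : ∀ c d, t ≤ c → c ≤ d → d ≤ b → Measurable fun a => ν a (Ioc c d))
    {E : Set ℝ≥0} (hE : MeasurableSet E) : Measurable fun a => ν a (E ∩ Ioc t b) := by
  induction E, hE using MeasurableSpace.induction_on_inter nnreal_generateFrom_Ioc
    nnreal_isPiSystem_Ioc with
  | empty => simp
  | basic E hE =>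
    obtain ⟨l, u, -, rfl⟩ := hE
    obtain ⟨c, d, h1, h2, h3, h4⟩ := Ioc_inter_Ioc_eq (l := l) (u := u) htb
    rw [h4]
    exact hν c d h1 h2 h3
  | compl E hE ih =>
    have : ∀ a, ν a (Eᶜ ∩ Ioc t b) = ν a (Ioc t b) - ν a (E ∩ Ioc t b) := fun a => by
      rw [← VectorMeasure.of_sdiff (hE.inter measurableSet_Ioc) measurableSet_Ioc
        inter_subset_right]
      congr 1
      ext x
      simp only [mem_inter_iff, mem_compl_iff, Set.mem_sdiff]
      tauto
    simp_rw [this]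
    exact (hν t b le_rfl htb le_rfl).sub ih
  | iUnion E hd hE ih =>
    have hs : ∀ a, HasSum (fun n => ν a (E n ∩ Ioc t b)) (ν a ((⋃ n, E n) ∩ Ioc t b)) := fun a => by
      rw [iUnion_inter]
      exact (ν a).m_iUnion (fun n => (hE n).inter measurableSet_Ioc)
        fun i j hij => (hd hij).mono inter_subset_left inter_subset_left
    exact measurable_of_tendsto_metrizable
      (fun n => Finset.measurable_fun_sum (Finset.range n) fun i _ => ih i)
      (tendsto_pi_nhds.2 fun a => (hs a).tendsto_sum_nat)

/-- The positive part of a signed measure as a supremum over a generating algebra. -/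
lemma posPart_eq_iSup (ν : SignedMeasure ℝ≥0) {𝒜 : Set (Set ℝ≥0)} (h𝒜 : IsSetAlgebra 𝒜)
    (hgen : (inferInstance : MeasurableSpace ℝ≥0) = MeasurableSpace.generateFrom 𝒜)
    {s : Set ℝ≥0} (hs : MeasurableSet s) :
    ν.toJordanDecomposition.posPart s = ⨆ A ∈ 𝒜, ENNReal.ofReal (ν (A ∩ s)) := by
  set J := ν.toJordanDecomposition
  have hval : ∀ {E}, MeasurableSet E → ν E = J.posPart.real E - J.negPart.real E := fun hE =>
    ν.apply_eq_posPart_real_sub_negPart_real hE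
  have hdense := Measure.MeasureDense.of_generateFrom_isSetAlgebra_finite ν.totalVariation h𝒜 hgen
  refine le_antisymm ?_ (iSup₂_le fun A hA => ?_)
  -- Qᶜ carries the positive part and Q the negative part. A set of the algebra close to Qᶜ in total
  -- variation nearly attains the supremum.
  · obtain ⟨Q, hQ, hQ1, hQ2⟩ := J.mutuallySingular
    refine ENNReal.le_of_forall_pos_le_add fun ε hε _ => ?_
    obtain ⟨A, hA, hAε⟩ := hdense.approx Qᶜ hQ.compl (measure_ne_top _ _) ε hε
    have hAm := hdense.measurable A hA
    have h1 : J.posPart s ≤ J.posPart (A ∩ s) + J.posPart (symmDiff Qᶜ A) := by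
      calc J.posPart s ≤ J.posPart ((A ∩ s) ∪ symmDiff Qᶜ A ∪ Q) := measure_mono fun x hx => by
            by_cases h1 : x ∈ A <;> by_cases h2 : x ∈ Q <;> simp [h1, h2, hx, mem_symmDiff]
        _ ≤ J.posPart (A ∩ s) + J.posPart (symmDiff Qᶜ A) + J.posPart Q :=
            (measure_union_le _ _).trans (by gcongr; exact measure_union_le _ _)
        _ = _ := by rw [hQ1, add_zero]
    have h2 : J.negPart (A ∩ s) ≤ J.negPart (symmDiff Qᶜ A) := by
      calc J.negPart (A ∩ s) ≤ J.negPart (symmDiff Qᶜ A ∪ Qᶜ) := measure_mono fun x hx => by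
            by_cases h2 : x ∈ Q <;> simp [h2, hx.1, mem_symmDiff]
        _ ≤ J.negPart (symmDiff Qᶜ A) + J.negPart Qᶜ := measure_union_le _ _
        _ = _ := by rw [hQ2, add_zero]
    have h3 : J.posPart (A ∩ s) ≤ ENNReal.ofReal (ν (A ∩ s)) + J.negPart (A ∩ s) := by
      rw [← ofReal_measureReal (μ := J.posPart), ← ofReal_measureReal (μ := J.negPart),
        hval (hAm.inter hs)]
      refine le_trans (ENNReal.ofReal_le_ofReal ?_) ENNReal.ofReal_add_le
      linarith
    have h4 : J.posPart (symmDiff Qᶜ A) + J.negPart (symmDiff Qᶜ A) ≤ ε := by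
      have : ν.totalVariation (symmDiff Qᶜ A) ≤ ε := by simpa using hAε.le
      simpa [SignedMeasure.totalVariation] using this
    calc J.posPart s ≤ ENNReal.ofReal (ν (A ∩ s)) + J.negPart (symmDiff Qᶜ A)
          + J.posPart (symmDiff Qᶜ A) := h1.trans (by gcongr; exact h3.trans (by gcongr))
      _ ≤ ENNReal.ofReal (ν (A ∩ s)) + ε := by
          rw [add_assoc, add_comm (J.negPart _)]
          gcongr
      _ ≤ _ := by
          gcongr
          exact le_iSup₂_of_le A hA le_rfl
  · have hAm := hdense.measurable A hA
    refine ENNReal.ofReal_le_of_le_toReal ?_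
    rw [hval (hAm.inter hs)]
    calc J.posPart.real (A ∩ s) - J.negPart.real (A ∩ s) ≤ J.posPart.real (A ∩ s) :=
          sub_le_self _ measureReal_nonneg
      _ ≤ J.posPart.real s := measureReal_mono inter_subset_right

/-- The Borel sets are generated by a countable algebra, so `posPart_eq_iSup` is a countable
supremum. Only masses of intervals inside (t, b] enter, which is what makes the Jordan parts of an
adapted path adapted. -/
lemma measurable_posPart_Ioc {α : Type*} {m : MeasurableSpace α}
    {ν : α → SignedMeasure ℝ≥0} {t b : ℝ≥0} (htb : t ≤ b)
    (hν : ∀ c d, t ≤ c → c ≤ d → d ≤ b → Measurable fun a => ν a (Ioc c d)) :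
    Measurable fun a => (ν a).toJordanDecomposition.posPart (Ioc t b) := by
  obtain ⟨𝒮, h𝒮c, h𝒮⟩ : ∃ 𝒮 : Set (Set ℝ≥0), 𝒮.Countable ∧
      (inferInstance : MeasurableSpace ℝ≥0) = MeasurableSpace.generateFrom 𝒮 :=
    ⟨_, MeasurableSpace.countable_countableGeneratingSet,
      MeasurableSpace.generateFrom_countableGeneratingSet.symm⟩
  have hgen : (inferInstance : MeasurableSpace ℝ≥0) =
      MeasurableSpace.generateFrom (generateSetAlgebra 𝒮) := by
    rw [generateFrom_generateSetAlgebra_eq, h𝒮]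
  simp_rw [fun a => posPart_eq_iSup (ν a) isSetAlgebra_generateSetAlgebra hgen
    (measurableSet_Ioc (a := t) (b := b))]
  refine Measurable.biSup _ (countable_generateSetAlgebra h𝒮c) fun A hA => ?_
  refine (measurable_signedMeasure_inter htb hν ?_).ennreal_ofReal
  have h := MeasurableSpace.measurableSet_generateFrom hA
  rwa [← hgen] at h

/-! ### Increasing and decreasing parts of a path -/

open scoped Classical in
/-- The signed measure of the path `g` stopped at `T`. -/
def pathMeasure (g : ℝ≥0 → ℝ) (T : ℝ≥0) : SignedMeasure ℝ≥0 :=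
  if h : BoundedVariationOn (fun u => g (min u T)) univ then h.vectorMeasure else 0

/-- The measure of the increasing part of a path. -/
def pathPos (g : ℝ≥0 → ℝ) (T : ℝ≥0) : Measure ℝ≥0 :=
  (pathMeasure g T).toJordanDecomposition.posPart

/-- The measure of the decreasing part of a path. -/
def pathNeg (g : ℝ≥0 → ℝ) (T : ℝ≥0) : Measure ℝ≥0 :=
  (pathMeasure g T).toJordanDecomposition.negPart

instance (g : ℝ≥0 → ℝ) (T : ℝ≥0) : IsFiniteMeasure (pathPos g T) := by
  unfold pathPos; infer_instance

instance (g : ℝ≥0 → ℝ) (T : ℝ≥0) : IsFiniteMeasure (pathNeg g T) := by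
  unfold pathNeg; infer_instance

lemma pathMeasure_variation (g : ℝ≥0 → ℝ) (T : ℝ≥0) :
    (pathMeasure g T).variation = pathVariation g T := by
  unfold pathMeasure pathVariation
  split_ifs with h
  · rfl
  · simp

lemma pathVariation_eq_add (g : ℝ≥0 → ℝ) (T : ℝ≥0) :
    pathVariation g T = pathPos g T + pathNeg g T := by
  rw [← pathMeasure_variation, ← SignedMeasure.totalVariation_eq_variation]
  rfl

/-- The Lebesgue-Stieltjes integral as a difference of integrals against measures. -/
lemma pathIntegral_eq {g φ : ℝ≥0 → ℝ} {t T : ℝ≥0}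
    (hφ : IntegrableOn φ (Ioc t T) (pathVariation g T)) :
    pathIntegral g φ t T =
      ∫ u in Ioc t T, φ u ∂(pathPos g T) - ∫ u in Ioc t T, φ u ∂(pathNeg g T) := by
  have h1 : pathIntegral g φ t T =
      VectorMeasure.integral ((pathMeasure g T).restrict (Ioc t T)) φ
        (ContinuousLinearMap.lsmul ℝ ℝ) := by
    unfold pathIntegral pathMeasure
    split_ifs with h
    · rfl
    · simp
  have hflip : (ContinuousLinearMap.lsmul ℝ ℝ : ℝ →L[ℝ] ℝ →L[ℝ] ℝ) =
      (ContinuousLinearMap.lsmul ℝ ℝ : ℝ →L[ℝ] ℝ →L[ℝ] ℝ).flip := by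
    ext
    simp
  have hdecomp : (pathMeasure g T).restrict (Ioc t T) =
      ((pathPos g T).restrict (Ioc t T)).toSignedMeasure -
      ((pathNeg g T).restrict (Ioc t T)).toSignedMeasure := by
    conv_lhs => rw [← SignedMeasure.toSignedMeasure_toJordanDecomposition (pathMeasure g T)]
    rw [JordanDecomposition.toSignedMeasure,
      ← VectorMeasure.restrict_toSignedMeasure measurableSet_Ioc,
      ← VectorMeasure.restrict_toSignedMeasure measurableSet_Ioc]
    exact VectorMeasure.restrict_sub _ _ _
  rw [pathVariation_eq_add, IntegrableOn, Measure.restrict_add, integrable_add_measure] at hφ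
  rw [h1, hdecomp, hflip, VectorMeasure.integral_sub_vectorMeasure,
    VectorMeasure.integral_toSignedMeasure, VectorMeasure.integral_toSignedMeasure]
  · rw [VectorMeasure.Integrable, Measure.variation_toSignedMeasure]
    exact hφ.1
  · rw [VectorMeasure.Integrable, Measure.variation_toSignedMeasure]
    exact hφ.2

/-- Interval masses are differences of right limits. Continuity turns these into values of g, so the
mass of (c, d] is known at time d. -/
lemma pathMeasure_Ioc {g : ℝ≥0 → ℝ} {T c d : ℝ≥0} (hg : Continuous g)
    (hbv : LocallyBoundedVariationOn g univ) (hcd : c ≤ d) (hd : d ≤ T) :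
    pathMeasure g T (Ioc c d) = g d - g c := by
  have hbd : BoundedVariationOn (fun u => g (min u T)) univ := by
    have h1 : BoundedVariationOn g (univ ∩ Icc 0 T) := hbv 0 T (mem_univ _) (mem_univ _)
    have h2 : eVariationOn (g ∘ fun u => min u T) univ ≤ eVariationOn g (univ ∩ Icc 0 T) :=
      eVariationOn.comp_le_of_monotoneOn g (fun u => min u T)
        (fun x _ y _ hxy => min_le_min_right T hxy) fun u _ =>
          ⟨mem_univ _, zero_le, min_le_right _ _⟩
    exact (h2.trans_lt (lt_top_iff_ne_top.2 h1)).ne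
  have hc : Continuous fun u => g (min u T) := hg.comp (continuous_id.min continuous_const)
  rw [pathMeasure, dif_pos hbd, BoundedVariationOn.vectorMeasure_Ioc _ hcd,
    (hc.continuousAt.continuousWithinAt).rightLim_eq,
    (hc.continuousAt.continuousWithinAt).rightLim_eq,
    min_eq_left hd, min_eq_left (hcd.trans hd)]

lemma measurable_pathPos {α : Type*} {m : MeasurableSpace α} {g : ℝ≥0 → α → ℝ} {T a b : ℝ≥0}
    (hg : ∀ ω, Continuous fun u => g u ω)
    (hbv : ∀ ω, LocallyBoundedVariationOn (fun u => g u ω) univ) (hab : a ≤ b) (hb : b ≤ T)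
    (hm : ∀ u ≤ b, Measurable (g u)) :
    Measurable fun ω => pathPos (fun u => g u ω) T (Ioc a b) := by
  refine measurable_posPart_Ioc hab fun c d _ hcd hd => ?_
  simp_rw [fun ω => pathMeasure_Ioc (hg ω) (hbv ω) hcd (hd.trans hb)]
  exact (hm d hd).sub (hm c (hcd.trans hd))

lemma measurable_pathNeg {α : Type*} {m : MeasurableSpace α} {g : ℝ≥0 → α → ℝ} {T a b : ℝ≥0}
    (hg : ∀ ω, Continuous fun u => g u ω)
    (hbv : ∀ ω, LocallyBoundedVariationOn (fun u => g u ω) univ) (hab : a ≤ b) (hb : b ≤ T)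
    (hm : ∀ u ≤ b, Measurable (g u)) :
    Measurable fun ω => pathNeg (fun u => g u ω) T (Ioc a b) := by
  have : ∀ ω, pathNeg (fun u => g u ω) T =
      (-pathMeasure (fun u => g u ω) T).toJordanDecomposition.posPart := fun ω => by
    rw [SignedMeasure.toJordanDecomposition_neg]
    rfl
  simp_rw [this]
  refine measurable_posPart_Ioc hab fun c d _ hcd hd => ?_
  simp_rw [neg_apply, fun ω => pathMeasure_Ioc (hg ω) (hbv ω) hcd (hd.trans hb)]
  exact ((hm d hd).sub (hm c (hcd.trans hd))).neg

/-! ### Modification on a null set -/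

open scoped Classical in
/-- The process `V`, set to `0` on `N`. -/
def zeroOn (N : Set Ω) (V : ℝ≥0 → Ω → ℝ) (u : ℝ≥0) (ω : Ω) : ℝ := if ω ∈ N then 0 else V u ω

lemma zeroOn_of_mem {N : Set Ω} {ω : Ω} (h : ω ∈ N) (V : ℝ≥0 → Ω → ℝ) (u : ℝ≥0) :
    zeroOn N V u ω = 0 := if_pos h

lemma zeroOn_of_notMem {N : Set Ω} {ω : Ω} (h : ω ∉ N) (V : ℝ≥0 → Ω → ℝ) (u : ℝ≥0) :
    zeroOn N V u ω = V u ω := if_neg h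

lemma measurable_zeroOn {𝓕 : Filtration ℝ≥0 mΩ} {N : Set Ω} (hN : MeasurableSet[𝓕 0] N)
    {V : ℝ≥0 → Ω → ℝ} {u : ℝ≥0} (hV : Measurable[𝓕 u] (V u)) : Measurable[𝓕 u] (zeroOn N V u) := by
  classical
  exact Measurable.ite (𝓕.mono (zero_le) _ hN) measurable_const hV

lemma zeroOn_ae_eq {P : Measure Ω} {N : Set Ω} (hN : P N = 0) (V : ℝ≥0 → Ω → ℝ) (u : ℝ≥0) :
    zeroOn N V u =ᵐ[P] V u := by
  filter_upwards [measure_eq_zero_iff_ae_notMem.1 hN] with ω hω using zeroOn_of_notMem hω V u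

lemma martingale_zeroOn {P : Measure Ω} {𝓕 : Filtration ℝ≥0 mΩ} {N : Set Ω}
    (hN : MeasurableSet[𝓕 0] N) (hN0 : P N = 0) {V : ℝ≥0 → Ω → ℝ} (hV : Martingale V 𝓕 P) :
    Martingale (zeroOn N V) 𝓕 P :=
  ⟨fun u => (measurable_zeroOn hN (hV.1 u).measurable).stronglyMeasurable, fun i j hij =>
    (condExp_congr_ae (zeroOn_ae_eq hN0 V j)).trans
      ((hV.2 i j hij).trans (zeroOn_ae_eq hN0 V i).symm)⟩

/-! ### The infimum process and the exit times from its level sets -/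

lemma firstTime_le {S : Set ℝ≥0} {s : ℝ≥0} (hs : s ∈ S) : firstTime S ≤ s := iInf₂_le s hs

lemma measurable_real_of_Iio {α : Type*} {m : MeasurableSpace α} {f : α → ℝ}
    (h : ∀ c, MeasurableSet (f ⁻¹' Iio c)) : Measurable f := measurable_of_Iio h

lemma measurable_nnreal_of_Ioi {α : Type*} {m : MeasurableSpace α} {f : α → ℝ≥0}
    (h : ∀ c, MeasurableSet (f ⁻¹' Ioi c)) : Measurable f := measurable_of_Ioi h

lemma measurableSet_lt_real {α : Type*} {m : MeasurableSpace α} {f g : α → ℝ}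
    (hf : Measurable f) (hg : Measurable g) : MeasurableSet {a | f a < g a} :=
  measurableSet_lt hf hg

lemma IsCadlag.bddBelow {f : ℝ≥0 → ℝ} (hf : IsCadlag f) (s : ℝ≥0) :
    BddBelow (range fun u : Iic s => f u) := by
  obtain ⟨C, hC⟩ := hf.exists_bound s
  exact ⟨-C, by rintro _ ⟨u, rfl⟩; exact (abs_le.1 (hC u u.2)).1⟩

/-- Càdlàg paths are bounded below on [0, s]; without this the real infimum would take its default
value and the equivalence could fail. -/
lemma runningInf_lt_iff {X : ℝ≥0 → Ω → ℝ} {ω : Ω} (hX : IsCadlag fun u => X u ω) {s : ℝ≥0}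
    {c : ℝ} : runningInf X s ω < c ↔ ∃ u ≤ s, X u ω < c := by
  have : Nonempty (Iic s) := ⟨⟨s, self_mem_Iic⟩⟩
  rw [runningInf, ciInf_lt_iff (hX.bddBelow s)]
  simp

lemma le_runningInf_iff {X : ℝ≥0 → Ω → ℝ} {ω : Ω} (hX : IsCadlag fun u => X u ω) {s : ℝ≥0}
    {c : ℝ} : c ≤ runningInf X s ω ↔ ∀ u ≤ s, c ≤ X u ω := by
  rw [← not_lt, runningInf_lt_iff hX]
  push Not
  rfl

lemma runningInf_antitone {X : ℝ≥0 → Ω → ℝ} {ω : Ω} (hX : IsCadlag fun u => X u ω) :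
    Antitone fun s => runningInf X s ω := fun _ _ h =>
  (le_runningInf_iff hX).2 fun u hu => (le_runningInf_iff hX).1 le_rfl u (hu.trans h)

/-- By right continuity X stays above an intermediate level c > x shortly after s. The intermediate
level is needed because strictness is lost on passing to the infimum. -/
lemma exists_gt_of_lt_runningInf {X : ℝ≥0 → Ω → ℝ} {ω : Ω} (hX : IsCadlag fun u => X u ω)
    {s : ℝ≥0} {x : ℝ} (h : x < runningInf X s ω) : ∃ s', s < s' ∧ x < runningInf X s' ω := by
  obtain ⟨c, hxc, hc⟩ := exists_between h
  have h1 : ∀ᶠ u in 𝓝[≥] s, c < X u ω :=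
    (hX s).1.tendsto.eventually
      (lt_mem_nhds (hc.trans_le ((le_runningInf_iff hX).1 le_rfl s le_rfl)))
  obtain ⟨s', hs', hs⟩ := (mem_nhdsGE_iff_exists_Icc_subset).1 h1
  refine ⟨s', hs', hxc.trans_le ((le_runningInf_iff hX).2 fun u hu => ?_)⟩
  rcases le_total u s with hus | hus
  · exact hc.le.trans ((le_runningInf_iff hX).1 le_rfl u hus)
  · exact (hs ⟨hus, hu⟩ : c < X u ω).le

/-- Right continuity reduces the infimum over [0, s] to a countable dense set of times. The end
point s is added separately, since times after s are not available in 𝓕_s. -/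
lemma measurable_zeroOn_runningInf {𝓕 : Filtration ℝ≥0 mΩ} {X : ℝ≥0 → Ω → ℝ}
    (hX : StronglyAdapted 𝓕 X) {N : Set Ω} (hN : MeasurableSet[𝓕 0] N)
    (hc : ∀ ω ∉ N, IsCadlag fun u => X u ω) (s : ℝ≥0) :
    Measurable[𝓕 s] (zeroOn N (runningInf X) s) := by
  obtain ⟨D, hDc, hD⟩ := TopologicalSpace.exists_countable_dense ℝ≥0
  have hNs : MeasurableSet[𝓕 s] N := 𝓕.mono zero_le _ hN
  refine measurable_real_of_Iio (m := 𝓕 s) fun c => ?_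
  have : zeroOn N (runningInf X) s ⁻¹' Iio c =
      (N ∩ {_ω | 0 < c}) ∪ (Nᶜ ∩ ⋃ q ∈ insert s (D ∩ Iic s), X q ⁻¹' Iio c) := by
    ext ω
    by_cases hω : ω ∈ N
    · simp [zeroOn_of_mem hω, hω]
    · simp only [mem_preimage, zeroOn_of_notMem hω, mem_Iio, runningInf_lt_iff (hc ω hω), mem_union,
        mem_inter_iff, hω, false_and, mem_compl_iff, not_false_eq_true, true_and, false_or,
        mem_iUnion, exists_prop]
      constructor
      · rintro ⟨u, hu, huc⟩
        rcases hu.eq_or_lt with rfl | hus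
        · exact ⟨u, mem_insert _ _, huc⟩
        · have h1 : ∀ᶠ v in 𝓝[≥] u, X v ω < c :=
            (hc ω hω u).1.tendsto.eventually (gt_mem_nhds huc)
          obtain ⟨s', hs', hs⟩ := (mem_nhdsGE_iff_exists_Ico_subset).1 h1
          obtain ⟨q, hqD, hq⟩ := hD.exists_between (lt_min hus hs')
          exact ⟨q, mem_insert_of_mem _ ⟨hqD, (hq.2.trans_le (min_le_left _ _)).le⟩,
            hs ⟨hq.1.le, hq.2.trans_le (min_le_right _ _)⟩⟩
      · rintro ⟨q, hq, hqc⟩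
        refine ⟨q, ?_, hqc⟩
        rcases hq with rfl | hq
        · exact le_rfl
        · exact hq.2
  rw [this]
  refine (hNs.inter (MeasurableSet.const _)).union (hNs.compl.inter
    (MeasurableSet.biUnion ((hDc.mono inter_subset_left).insert s) fun q hq => ?_))
  have hqs : q ≤ s := by
    rcases hq with rfl | hq
    · exact le_rfl
    · exact hq.2
  exact 𝓕.mono hqs _ ((hX q).measurable measurableSet_Iio)

/-- Adapted processes with decreasing paths whose superlevel sets are open on the right. -/
structure IsDecreasing (𝓕 : Filtration ℝ≥0 mΩ) (Y : ℝ≥0 → Ω → ℝ) : Prop where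
  measurable : ∀ u, Measurable[𝓕 u] (Y u)
  antitone : ∀ ω, Antitone fun u => Y u ω
  exists_gt : ∀ ω u x, x < Y u ω → ∃ v, u < v ∧ x < Y v ω

lemma isDecreasing_zeroOn_runningInf {𝓕 : Filtration ℝ≥0 mΩ} {X : ℝ≥0 → Ω → ℝ}
    (hX : StronglyAdapted 𝓕 X) {N : Set Ω} (hN : MeasurableSet[𝓕 0] N)
    (hc : ∀ ω ∉ N, IsCadlag fun u => X u ω) : IsDecreasing 𝓕 (zeroOn N (runningInf X)) where
  measurable := measurable_zeroOn_runningInf hX hN hc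
  antitone ω := by
    by_cases hω : ω ∈ N
    · simp only [zeroOn_of_mem hω]
      exact antitone_const
    · simp only [zeroOn_of_notMem hω]
      exact runningInf_antitone (hc ω hω)
  exists_gt ω u x h := by
    by_cases hω : ω ∈ N
    · simp only [zeroOn_of_mem hω] at h ⊢
      exact ⟨u + 1, lt_add_one u, h⟩
    · simp only [zeroOn_of_notMem hω] at h ⊢
      exact exists_gt_of_lt_runningInf (hc ω hω) h

/-- The first time, truncated at `T`, at which `Y` is at most `x`. -/
def exitTime (Y : ℝ≥0 → Ω → ℝ) (T : ℝ≥0) (x : ℝ) (ω : Ω) : ℝ≥0 :=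
  (min (firstTime {u | Y u ω ≤ x}) T).toNNReal

section Decreasing

variable {𝓕 : Filtration ℝ≥0 mΩ} {Y : ℝ≥0 → Ω → ℝ} {T : ℝ≥0}

/-- If x < Y_u, the process stays above x up to some v > u, so the first time is at least v; this is
the source of the strict inequality. -/
lemma IsDecreasing.lt_firstTime_iff (hY : IsDecreasing 𝓕 Y) {u : ℝ≥0} {x : ℝ} {ω : Ω} :
    (u : ℝ≥0∞) < firstTime {v | Y v ω ≤ x} ↔ x < Y u ω := by
  constructor
  · intro h
    by_contra hx
    exact h.not_ge (firstTime_le (not_lt.1 hx))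
  · intro h
    obtain ⟨v, huv, hv⟩ := hY.exists_gt ω u x h
    refine (ENNReal.coe_lt_coe.2 huv).trans_le (le_iInf₂ fun w hw => ENNReal.coe_le_coe.2 ?_)
    by_contra hwv
    exact (hv.trans_le (hY.antitone ω (not_le.1 hwv).le)).not_ge hw

lemma coe_exitTime (x : ℝ) (ω : Ω) :
    (exitTime Y T x ω : ℝ≥0∞) = min (firstTime {u | Y u ω ≤ x}) T :=
  ENNReal.coe_toNNReal ((min_le_right _ _).trans_lt ENNReal.coe_lt_top).ne

lemma exitTime_le (x : ℝ) (ω : Ω) : exitTime Y T x ω ≤ T := by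
  rw [← ENNReal.coe_le_coe, coe_exitTime]
  exact min_le_right _ _

lemma IsDecreasing.lt_exitTime_iff (hY : IsDecreasing 𝓕 Y) {u : ℝ≥0} (hu : u < T) {x : ℝ} {ω : Ω} :
    u < exitTime Y T x ω ↔ x < Y u ω := by
  rw [← ENNReal.coe_lt_coe, coe_exitTime, lt_min_iff, hY.lt_firstTime_iff]
  simp [hu]

lemma IsDecreasing.measurableSet_lt (hY : IsDecreasing 𝓕 Y) {u : ℝ≥0} (hu : u ≤ T) :
    MeasurableSet[(𝓕 T).prod inferInstance] {z : Ω × ℝ | z.2 < Y u z.1} :=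
  measurableSet_lt_real (m := (𝓕 T).prod inferInstance)
    (@measurable_snd Ω ℝ (𝓕 T) _)
    (((hY.measurable u).mono (𝓕.mono hu) le_rfl).comp (@measurable_fst Ω ℝ (𝓕 T) _))

lemma IsDecreasing.measurable_exitTime (hY : IsDecreasing 𝓕 Y) :
    Measurable[(𝓕 T).prod inferInstance] fun z : Ω × ℝ => exitTime Y T z.2 z.1 := by
  refine measurable_nnreal_of_Ioi (m := (𝓕 T).prod inferInstance) fun u => ?_
  by_cases hu : u < T
  · convert hY.measurableSet_lt hu.le using 1
    ext z
    exact hY.lt_exitTime_iff hu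
  · convert @MeasurableSet.empty _ ((𝓕 T).prod inferInstance)
    ext z
    simpa using (exitTime_le _ _).trans (not_lt.1 hu)

lemma IsDecreasing.isExitTime (hY : IsDecreasing 𝓕 Y) (t : ℝ≥0) (x : ℝ) :
    IsExitTime 𝓕 (fun u => {ω | x < Y u ω}) (exitTime Y T x) t T where
  antitone u v huv ω hω := lt_of_lt_of_le hω (hY.antitone ω huv)
  measurableSet u := (hY.measurable u) measurableSet_Ioi
  lt_iff ω hω u _ hu := by
    rcases hu.eq_or_lt with rfl | hu
    · exact iff_of_false (exitTime_le _ _).not_gt hω.2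
    · exact hY.lt_exitTime_iff hu

end Decreasing

/-- If the two expressions for the default time agree, they agree with the first time at which the
infimum process is at most `L`. -/
lemma defaultTime_eq_firstTime_runningInf {X : ℝ≥0 → Ω → ℝ} {L : Ω → ℝ} {ω : Ω}
    (hX : IsCadlag fun u => X u ω)
    (h : defaultTime X L ω = firstTime {u | runningInf X u ω = L ω}) :
    defaultTime X L ω = firstTime {u | runningInf X u ω ≤ L ω} := by
  refine le_antisymm (le_iInf₂ fun s hs => ?_) (le_iInf₂ fun s hs => firstTime_le ?_)
  · by_contra hlt
    rw [not_le] at hlt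
    -- Before τ the path stays at or above L, hence so does its infimum. If the infimum at s is also
    -- at most L, it equals L there, and the second expression for τ is at most s.
    have h1 : ∀ u ≤ s, L ω ≤ X u ω := fun u hu => by
      by_contra hXu
      exact ((ENNReal.coe_le_coe.2 hu).trans_lt hlt).not_ge (firstTime_le (not_le.1 hXu).le)
    have h2 : runningInf X s ω = L ω := le_antisymm hs ((le_runningInf_iff hX).2 h1)
    rw [h] at hlt
    exact hlt.not_ge (firstTime_le h2)
  · exact ((le_runningInf_iff hX).1 le_rfl s le_rfl).trans hs

/-! ### Real-valued disintegration -/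

lemma prod_le_prod {Ω : Type*} {m mΩ : MeasurableSpace Ω} (hm : m ≤ mΩ) :
    m.prod (inferInstance : MeasurableSpace ℝ) ≤ mΩ.prod inferInstance :=
  sup_le_sup_right (MeasurableSpace.comap_mono hm) _

section Barrier

variable {P : Measure Ω} [IsProbabilityMeasure P] {𝓕 : Filtration ℝ≥0 mΩ}
    {L : Ω → ℝ} {p : ℝ≥0 → ℝ → Ω → ℝ}

lemma IsCondDensity.measurable_joint (hp : IsCondDensity P 𝓕 L p) (s : ℝ≥0) :
    Measurable fun z : Ω × ℝ => p s z.2 z.1 :=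
  (hp.measurable s).mono (prod_le_prod (𝓕.le s)) le_rfl

lemma lintegral_comp_barrier_prod (hL : Measurable L) (hp : IsCondDensity P 𝓕 L p) (s : ℝ≥0)
    {f : Ω × ℝ → ℝ≥0∞} (hf : Measurable[(𝓕 s).prod inferInstance] f) :
    ∫⁻ ω, f (ω, L ω) ∂P = ∫⁻ z, f z * ENNReal.ofReal (p s z.2 z.1) ∂(P.prod (P.map L)) := by
  have := Measure.isProbabilityMeasure_map (μ := P) hL.aemeasurable
  have hf' : Measurable f := hf.mono (prod_le_prod (𝓕.le s)) le_rfl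
  rw [lintegral_comp_barrier hL hp s hf, lintegral_prod_symm]
  exact (hf'.mul (hp.measurable_joint s).ennreal_ofReal).aemeasurable

lemma integrable_comp_barrier_iff (hL : Measurable L) (hp : IsCondDensity P 𝓕 L p) (s : ℝ≥0)
    {f : Ω × ℝ → ℝ} (hf : Measurable[(𝓕 s).prod inferInstance] f) :
    Integrable (fun ω => f (ω, L ω)) P ↔
      Integrable (fun z => f z * p s z.2 z.1) (P.prod (P.map L)) := by
  have hf' : Measurable f := hf.mono (prod_le_prod (𝓕.le s)) le_rfl
  have h1 : AEStronglyMeasurable (fun ω => f (ω, L ω)) P :=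
    (hf'.comp (measurable_id.prodMk hL)).aestronglyMeasurable
  have h2 : AEStronglyMeasurable (fun z => f z * p s z.2 z.1) (P.prod (P.map L)) :=
    (hf'.mul (hp.measurable_joint s)).aestronglyMeasurable
  have h3 := lintegral_comp_barrier_prod hL hp s (f := fun z => ‖f z‖ₑ)
    (measurable_enorm.comp hf)
  have h4 : ∀ z : Ω × ℝ, ‖f z‖ₑ * ENNReal.ofReal (p s z.2 z.1) = ‖f z * p s z.2 z.1‖ₑ := fun z => by
    rw [enorm_mul, Real.enorm_of_nonneg (hp.nonneg s z.2 z.1)]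
  simp_rw [h4] at h3
  simp only [Integrable, h1, h2, true_and, HasFiniteIntegral, h3]

lemma integral_comp_barrier (hL : Measurable L) (hp : IsCondDensity P 𝓕 L p) (s : ℝ≥0)
    {f : Ω × ℝ → ℝ} (hf : Measurable[(𝓕 s).prod inferInstance] f)
    (hint : Integrable (fun ω => f (ω, L ω)) P) :
    ∫ ω, f (ω, L ω) ∂P = ∫ z, f z * p s z.2 z.1 ∂(P.prod (P.map L)) := by
  rw [integral_eq_lintegral_pos_part_sub_lintegral_neg_part hint,
    integral_eq_lintegral_pos_part_sub_lintegral_neg_part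
      ((integrable_comp_barrier_iff hL hp s hf).1 hint),
    lintegral_comp_barrier_prod hL hp s (f := fun z => ENNReal.ofReal (f z))
      (ENNReal.measurable_ofReal.comp hf),
    lintegral_comp_barrier_prod hL hp s (f := fun z => ENNReal.ofReal (-f z))
      (ENNReal.measurable_ofReal.comp hf.neg)]
  simp_rw [← neg_mul, ENNReal.ofReal_mul' (hp.nonneg s _ _)]

/-- The zero set of p_s is null for the conditional law; the half of Jacod's equivalence saying that
P^L is absolutely continuous with respect to that law makes it P^L-null. This permits division by
p_t. -/
lemma ae_density_ne_zero (hL : Measurable L) (hJ : JacodHypothesis P 𝓕 L)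
    (hp : IsCondDensity P 𝓕 L p) (s : ℝ≥0) :
    ∀ᵐ z ∂(P.prod (P.map L)), p s z.2 z.1 ≠ 0 := by
  have := Measure.isProbabilityMeasure_map (μ := P) hL.aemeasurable
  have hm := hp.measurable_joint s
  have hset : MeasurableSet {z : Ω × ℝ | p s z.2 z.1 ≠ 0} := hm (measurableSet_singleton 0).compl
  refine (Measure.ae_prod_mem_iff_ae_ae_mem hset).2 ?_
  filter_upwards [hJ s, hp.density s] with ω h1 h2
  have hω : Measurable fun x => p s x ω := hm.comp measurable_prodMk_left
  have h3 : (condLaw P 𝓕 L s ω) {x | p s x ω = 0} = 0 := by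
    have hz : MeasurableSet {x | p s x ω = 0} := hω (measurableSet_singleton 0)
    rw [h2, withDensity_apply _ hz, setLIntegral_congr_fun (g := 0) hz]
    · simp
    · intro x hx
      have hx : p s x ω = 0 := hx
      simp [hx]
  have h4 := measure_eq_zero_iff_ae_notMem.1 (h1.2 h3)
  filter_upwards [h4] with x hx using hx

end Barrier

/-- Real-valued jointly measurable version of the conditional expectations of the sections. -/
lemma exists_joint_condExp {Ω : Type*} {m mΩ : MeasurableSpace Ω} {P : Measure Ω}
    [IsProbabilityMeasure P] (hm : m ≤ mΩ) {f : Ω × ℝ → ℝ} (hf : Measurable f)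
    {ν : Measure ℝ} [SFinite ν] (hint : Integrable f (P.prod ν)) :
    ∃ W : Ω × ℝ → ℝ, Measurable[m.prod inferInstance] W ∧ Integrable W (P.prod ν) ∧
      ∀ x, Integrable (fun ω => f (ω, x)) P → Integrable (fun ω => W (ω, x)) P ∧
        ∀ A, MeasurableSet[m] A → ∫ ω in A, W (ω, x) ∂P = ∫ ω in A, f (ω, x) ∂P := by
  obtain ⟨V₁, hV₁, hV₁A⟩ := exists_joint_condLExp (P := P) hm hf.ennreal_ofReal
  obtain ⟨V₂, hV₂, hV₂A⟩ := exists_joint_condLExp (P := P) hm hf.neg.ennreal_ofReal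
  have hle := prod_le_prod hm
  have hfin : ∀ {V : Ω × ℝ → ℝ≥0∞} {g : Ω × ℝ → ℝ}, Measurable[m.prod inferInstance] V →
      Measurable g → Integrable g (P.prod ν) →
      (∀ x A, MeasurableSet[m] A →
        ∫⁻ ω in A, V (ω, x) ∂P = ∫⁻ ω in A, ENNReal.ofReal (g (ω, x)) ∂P) →
      Integrable (fun z => (V z).toReal) (P.prod ν) ∧
      ∀ x, Integrable (fun ω => g (ω, x)) P → Integrable (fun ω => (V (ω, x)).toReal) P ∧
        ∀ A, MeasurableSet[m] A → ∫ ω in A, (V (ω, x)).toReal ∂P =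
          (∫⁻ ω in A, ENNReal.ofReal (g (ω, x)) ∂P).toReal := by
    intro V g hV hgm hg hVA
    refine ⟨integrable_toReal_of_lintegral_ne_top (hV.mono hle le_rfl).aemeasurable ?_, ?_⟩
    · rw [lintegral_prod_symm _ (hV.mono hle le_rfl).aemeasurable]
      have h : ∀ x, ∫⁻ ω, V (ω, x) ∂P = ∫⁻ ω, ENNReal.ofReal (g (ω, x)) ∂P := fun x => by
        simpa using hVA x univ MeasurableSet.univ
      simp_rw [h]
      rw [← lintegral_prod_symm _ hgm.ennreal_ofReal.aemeasurable]
      exact ne_top_of_le_ne_top hg.2.ne (lintegral_mono fun z => Real.ofReal_le_enorm _)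
    · intro x hx
      have hVx := measurable_section hm hV x
      have hne : ∫⁻ ω, V (ω, x) ∂P ≠ ∞ := by
        have h : ∫⁻ ω, V (ω, x) ∂P = ∫⁻ ω, ENNReal.ofReal (g (ω, x)) ∂P := by
          simpa using hVA x univ MeasurableSet.univ
        rw [h]
        exact ne_top_of_le_ne_top hx.2.ne (lintegral_mono fun z => Real.ofReal_le_enorm _)
      refine ⟨integrable_toReal_of_lintegral_ne_top hVx.aemeasurable hne, fun A hA => ?_⟩
      rw [integral_toReal hVx.aemeasurable
        (ae_restrict_of_ae (ae_lt_top hVx hne)), hVA x A hA]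
  obtain ⟨h1, h1'⟩ := hfin hV₁ hf hint hV₁A
  obtain ⟨h2, h2'⟩ := hfin hV₂ hf.neg hint.neg hV₂A
  refine ⟨fun z => (V₁ z).toReal - (V₂ z).toReal, hV₁.ennreal_toReal.sub hV₂.ennreal_toReal,
    h1.sub h2, fun x hx => ?_⟩
  obtain ⟨h3, h4⟩ := h1' x hx
  obtain ⟨h5, h6⟩ := h2' x hx.neg
  refine ⟨h3.sub h5, fun A hA => ?_⟩
  rw [integral_sub h3.integrableOn h5.integrableOn, h4 A hA, h6 A hA,
    integral_eq_lintegral_pos_part_sub_lintegral_neg_part hx.integrableOn]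
  rfl

/-! ### Discounted survival as a function of the barrier level -/

lemma measurable_prodMk_of {α β γ : Type*} {mα : MeasurableSpace α} {mβ : MeasurableSpace β}
    {mγ : MeasurableSpace γ} {f : α → β} {g : α → γ} (hf : Measurable f) (hg : Measurable g) :
    Measurable fun a => (f a, g a) :=
  hf.prodMk hg

lemma measurableSet_lt_nnreal {α : Type*} {mα : MeasurableSpace α} {f g : α → ℝ≥0}
    (hf : Measurable f) (hg : Measurable g) : MeasurableSet {a | f a < g a} :=
  measurableSet_lt hf hg

/-- `1_{Y_u > x} R_u⁻¹`. -/
def survWeight (Y R : ℝ≥0 → Ω → ℝ) (u : ℝ≥0) (x : ℝ) (ω : Ω) : ℝ :=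
  {ω' | x < Y u ω'}.indicator (fun ω' => (R u ω')⁻¹) ω

lemma survWeight_nonneg {Y R : ℝ≥0 → Ω → ℝ} (hR : ∀ u ω, 0 < R u ω) (u : ℝ≥0) (x : ℝ) (ω : Ω) :
    0 ≤ survWeight Y R u x ω :=
  indicator_nonneg (fun _ _ => (inv_pos.2 (hR _ _)).le) ω

/-- Predictable processes are progressive. Stopping the time argument at b expresses this on all of
ℝ≥0 rather than on the subtype of times up to b. -/
lemma measurable_predictable_min {𝓕 : Filtration ℝ≥0 mΩ} {R : ℝ≥0 → Ω → ℝ}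
    (hR : IsStronglyPredictable 𝓕 R) (b : ℝ≥0) :
    Measurable[(𝓕 b).prod inferInstance] fun z : Ω × ℝ≥0 => R (min z.2 b) z.1 := by
  have h := (hR.isStronglyProgressive b).measurable
  have h2 : @Measurable (Ω × ℝ≥0) (Iic b × Ω) ((𝓕 b).prod inferInstance)
      (Subtype.instMeasurableSpace.prod (𝓕 b))
      fun z => ((⟨min z.2 b, mem_Iic.2 (min_le_right _ _)⟩ : Iic b), z.1) := by
    let m : MeasurableSpace Ω := 𝓕 b
    exact
    Measurable.prodMk
      (Measurable.subtype_mk (((@measurable_snd Ω ℝ≥0 (𝓕 b) _)).min measurable_const))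
      (@measurable_fst Ω ℝ≥0 (𝓕 b) _)
  exact h.comp h2

lemma measurable_survWeight {𝓕 : Filtration ℝ≥0 mΩ} {Y R : ℝ≥0 → Ω → ℝ}
    (hY : IsDecreasing 𝓕 Y) (hR : IsStronglyPredictable 𝓕 R) (b : ℝ≥0) :
    Measurable[((𝓕 b).prod inferInstance).prod inferInstance]
      fun z : (Ω × ℝ) × ℝ≥0 => survWeight Y R (min z.2 b) z.1.2 z.1.1 := by
  let m : MeasurableSpace ((Ω × ℝ) × ℝ≥0) := ((𝓕 b).prod inferInstance).prod inferInstance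
  have hfst : @Measurable _ _ m ((𝓕 b).prod inferInstance) (Prod.fst : (Ω × ℝ) × ℝ≥0 → Ω × ℝ) :=
    @measurable_fst (Ω × ℝ) ℝ≥0 ((𝓕 b).prod inferInstance) _
  have hsnd : Measurable[m] (Prod.snd : (Ω × ℝ) × ℝ≥0 → ℝ≥0) :=
    @measurable_snd (Ω × ℝ) ℝ≥0 ((𝓕 b).prod inferInstance) _
  have hset : MeasurableSet[m] {z : (Ω × ℝ) × ℝ≥0 | z.1.2 < Y (min z.2 b) z.1.1} := by
    -- Before b the event is u < exit time, and the exit time is jointly measurable in (ω, x). At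
    -- and after b the truncated exit time carries no information, so the condition is read off Y_b.
    have : {z : (Ω × ℝ) × ℝ≥0 | z.1.2 < Y (min z.2 b) z.1.1} =
        {z | min z.2 b < exitTime Y b z.1.2 z.1.1} ∪
          ((Prod.snd ⁻¹' Ici b) ∩ Prod.fst ⁻¹' {z : Ω × ℝ | z.2 < Y b z.1}) := by
      ext z
      simp only [mem_ofPred_eq, mem_union, mem_inter_iff, mem_preimage, mem_Ici]
      rcases lt_or_ge z.2 b with h | h
      · rw [min_eq_left h.le, hY.lt_exitTime_iff h]
        simp [h]
      · rw [min_eq_right h]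
        simp [h, exitTime_le]
    rw [this]
    refine MeasurableSet.union ?_ ((hsnd measurableSet_Ici).inter (hfst (
      hY.measurableSet_lt le_rfl)))
    exact measurableSet_lt_nnreal (hsnd.min measurable_const)
      (hY.measurable_exitTime.comp hfst)
  have hRm : Measurable[m] fun z : (Ω × ℝ) × ℝ≥0 => (R (min z.2 b) z.1.1)⁻¹ := by
    have h1 : @Measurable _ _ m ((𝓕 b).prod inferInstance)
        fun z : (Ω × ℝ) × ℝ≥0 => (z.1.1, z.2) :=
       measurable_prodMk_of (mβ := 𝓕 b)
        ((@measurable_fst Ω ℝ (𝓕 b) _).comp hfst) hsnd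
    exact ((measurable_predictable_min hR b).comp h1).inv
  exact hRm.indicator hset

/-! ### Optional projection with a weight -/

section Projection

variable {P : Measure Ω} [IsProbabilityMeasure P] {𝓕 : Filtration ℝ≥0 mΩ} {M : ℝ≥0 → Ω → ℝ}
    {t T : ℝ≥0} {κ : Ω → Measure ℝ≥0} {w : ℝ≥0 → Ω → ℝ≥0∞}

lemma measurable_section_right {α : Type*} {m : MeasurableSpace α} {ψ : α × ℝ≥0 → ℝ≥0∞}
    (hψ : Measurable ψ) (a : α) : Measurable fun u => ψ (a, u) :=
  hψ.comp measurable_prodMk_left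

lemma setLIntegral_Ioc_congr {a b : ℝ≥0} (hb : b ≤ T) (μ : Measure ℝ≥0) (f : ℝ≥0 → ℝ≥0∞) :
    ∫⁻ u in Ioc a b, f (min u T) ∂μ = ∫⁻ u in Ioc a b, f u ∂μ :=
  setLIntegral_congr_fun measurableSet_Ioc fun u hu => by
    rw [min_eq_left (hu.2.trans hb)]

/-- The measure w dκ is again adapted, and finite because w is bounded, so the two one-sided
inequalities apply to it in place of κ. -/
lemma lintegral_martingale_bounded (hM : Martingale M 𝓕 P) (hM0 : ∀ u ω, 0 ≤ M u ω)
    (hc : ∀ ω, IsCadlag fun u => M u ω) (htT : t ≤ T)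
    (hfin : ∀ ω, κ ω (Ioc t T) ≠ ∞)
    (hκ : ∀ a b, t ≤ a → a ≤ b → b ≤ T → Measurable[𝓕 b] fun ω => κ ω (Ioc a b))
    (hw : ∀ b, t ≤ b → Measurable[(𝓕 b).prod inferInstance] fun z : Ω × ℝ≥0 => w (min z.2 b) z.1)
    {c : ℝ≥0∞} (hcf : c ≠ ∞) (hwc : ∀ u ω, w u ω ≤ c) :
    ∫⁻ ω, ENNReal.ofReal (M T ω) * ∫⁻ u in Ioc t T, w u ω ∂κ ω ∂P =
      ∫⁻ ω, ∫⁻ u in Ioc t T, w u ω * ENNReal.ofReal (M u ω) ∂κ ω ∂P := by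
  have hwT : ∀ ω, Measurable fun u => w (min u T) ω := fun ω =>
    measurable_section_right (m := 𝓕 T) (hw T htT) ω
  let κ' : Ω → Measure ℝ≥0 := fun ω => (κ ω).withDensity fun u => w (min u T) ω
  have hκ'eq : ∀ ω a b, b ≤ T → κ' ω (Ioc a b) = ∫⁻ u in Ioc a b, w u ω ∂κ ω := fun ω a b hb => by
    rw [withDensity_apply _ measurableSet_Ioc]
    exact setLIntegral_Ioc_congr hb (κ ω) fun u => w u ω
  have hκ' : ∀ a b, t ≤ a → a ≤ b → b ≤ T → Measurable[𝓕 b] fun ω => κ' ω (Ioc a b) := by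
    intro a b ha hab hb
    have h := measurable_setLIntegral_Ioc (m := 𝓕 b) (κ := κ) hab
      (fun ω => ne_top_of_le_ne_top (hfin ω) (measure_mono (Ioc_subset_Ioc ha hb)))
      (fun c d hc hcd hd => (hκ c d (ha.trans hc) hcd (hd.trans hb)).mono (𝓕.mono hd) le_rfl)
      (hw b (ha.trans hab))
    convert h using 2 with ω
    rw [hκ'eq ω a b hb]
    exact (setLIntegral_Ioc_congr le_rfl (κ ω) fun u => w u ω).symm
  have hfin' : ∀ ω, κ' ω (Ioc t T) ≠ ∞ := fun ω => by
    rw [hκ'eq ω t T le_rfl]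
    refine ne_top_of_le_ne_top (b := c * κ ω (Ioc t T)) (ENNReal.mul_ne_top hcf (hfin ω)) ?_
    calc ∫⁻ u in Ioc t T, w u ω ∂κ ω ≤ ∫⁻ _ in Ioc t T, c ∂κ ω := lintegral_mono fun u => hwc u ω
      _ = c * κ ω (Ioc t T) := by simp
  have h := (le_lintegral_martingale hM hM0 hc htT hκ' hfin').antisymm'
    (lintegral_martingale_le hM hM0 hc htT hκ')
  calc _ = ∫⁻ ω, ENNReal.ofReal (M T ω) * κ' ω (Ioc t T) ∂P := by
        simp_rw [hκ'eq _ t T le_rfl]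
    _ = ∫⁻ ω, ∫⁻ u in Ioc t T, ENNReal.ofReal (M u ω) ∂κ' ω ∂P := h.symm
    _ = _ := by
        refine lintegral_congr fun ω => ?_
        have hMm : Measurable fun u => (Ioc t T).indicator (fun v => M v ω) u :=
          (measurable_indicator_of_rightCont (m := mΩ)
            (fun u => ((hM.stronglyMeasurable u).mono (𝓕.le u)).measurable)
            (fun ω u => (hc ω u).1) htT).comp measurable_prodMk_left
        calc ∫⁻ u in Ioc t T, ENNReal.ofReal (M u ω) ∂κ' ω
            = ∫⁻ u in Ioc t T, ENNReal.ofReal ((Ioc t T).indicator (fun v => M v ω) u) ∂κ' ω :=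
              setLIntegral_congr_fun measurableSet_Ioc fun u hu => by
                simp only [indicator_of_mem hu]
          _ = ∫⁻ u in Ioc t T, w (min u T) ω *
                ENNReal.ofReal ((Ioc t T).indicator (fun v => M v ω) u) ∂κ ω :=
              setLIntegral_withDensity_eq_setLIntegral_mul _ (hwT ω) hMm.ennreal_ofReal
                measurableSet_Ioc
          _ = _ := setLIntegral_congr_fun measurableSet_Ioc fun u hu => by
                simp only [indicator_of_mem hu, min_eq_left hu.2]

lemma measurable_lintegral_martingale {μ : Measure Ω} (hM : Martingale M 𝓕 μ)
    (hc : ∀ ω, IsCadlag fun u => M u ω) (htT : t ≤ T) (hfin : ∀ ω, κ ω (Ioc t T) ≠ ∞)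
    (hκ : ∀ a b, t ≤ a → a ≤ b → b ≤ T → Measurable fun ω => κ ω (Ioc a b))
    (hw : Measurable fun z : Ω × ℝ≥0 => w (min z.2 T) z.1) :
    Measurable fun ω => ∫⁻ u in Ioc t T, w u ω * ENNReal.ofReal (M u ω) ∂κ ω := by
  have hMm := measurable_indicator_of_rightCont (m := mΩ)
    (fun u => ((hM.stronglyMeasurable u).mono (𝓕.le u)).measurable) (fun ω u => (hc ω u).1) htT
  convert measurable_setLIntegral_Ioc htT hfin hκ (hw.mul hMm.ennreal_ofReal) using 2 with ω
  exact setLIntegral_congr_fun measurableSet_Ioc fun u hu => by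
    simp only [Pi.mul_apply, indicator_of_mem hu, min_eq_left hu.2]

/-- The bound on w is removed by monotone convergence along min(w, n). -/
lemma lintegral_martingale_weight (hM : Martingale M 𝓕 P) (hM0 : ∀ u ω, 0 ≤ M u ω)
    (hc : ∀ ω, IsCadlag fun u => M u ω) (htT : t ≤ T)
    (hfin : ∀ ω, κ ω (Ioc t T) ≠ ∞)
    (hκ : ∀ a b, t ≤ a → a ≤ b → b ≤ T → Measurable[𝓕 b] fun ω => κ ω (Ioc a b))
    (hw : ∀ b, t ≤ b →
      Measurable[(𝓕 b).prod inferInstance] fun z : Ω × ℝ≥0 => w (min z.2 b) z.1) :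
    ∫⁻ ω, ENNReal.ofReal (M T ω) * ∫⁻ u in Ioc t T, w u ω ∂κ ω ∂P =
      ∫⁻ ω, ∫⁻ u in Ioc t T, w u ω * ENNReal.ofReal (M u ω) ∂κ ω ∂P := by
  have hle : (𝓕 T).prod (inferInstance : MeasurableSpace ℝ≥0) ≤ mΩ.prod inferInstance :=
    sup_le_sup_right (MeasurableSpace.comap_mono (𝓕.le T)) _
  have hκm : ∀ a b, t ≤ a → a ≤ b → b ≤ T → Measurable fun ω => κ ω (Ioc a b) :=
    fun a b h1 h2 h3 => (hκ a b h1 h2 h3).mono (𝓕.le b) le_rfl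
  have hwT : Measurable fun z : Ω × ℝ≥0 => w (min z.2 T) z.1 := (hw T htT).mono hle le_rfl
  let wn : ℕ → ℝ≥0 → Ω → ℝ≥0∞ := fun n u ω => min (w u ω) n
  have hwn : ∀ n b, t ≤ b →
      Measurable[(𝓕 b).prod inferInstance] fun z : Ω × ℝ≥0 => wn n (min z.2 b) z.1 :=
    fun n b hb => (hw b hb).min measurable_const
  have hmono : ∀ u ω, Monotone fun n => wn n u ω := fun u ω n k hnk =>
    min_le_min_left _ (Nat.cast_le.2 hnk)
  have hsup : ∀ u ω, ⨆ n, wn n u ω = w u ω := fun u ω => by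
    refine le_antisymm (iSup_le fun n => min_le_left _ _) ?_
    calc w u ω = w u ω ⊓ ⨆ n : ℕ, (n : ℝ≥0∞) := by rw [ENNReal.iSup_natCast, inf_top_eq]
      _ = ⨆ n : ℕ, w u ω ⊓ n := inf_iSup_eq _ _
      _ ≤ _ := le_rfl
  have hwnm : ∀ n ω, AEMeasurable (fun u => wn n u ω) ((κ ω).restrict (Ioc t T)) := fun n ω =>
    ⟨fun u => wn n (min u T) ω, measurable_section_right (m := 𝓕 T) (hwn n T htT) ω,
      (ae_restrict_mem measurableSet_Ioc).mono fun u hu => by simp only [min_eq_left hu.2]⟩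
  have hMa : ∀ ω, AEMeasurable (fun u => ENNReal.ofReal (M u ω)) ((κ ω).restrict (Ioc t T)) :=
    fun ω => by
      have hMm := (measurable_indicator_of_rightCont (m := mΩ)
        (fun u => ((hM.stronglyMeasurable u).mono (𝓕.le u)).measurable)
        (fun ω u => (hc ω u).1) htT).comp (measurable_prodMk_left (x := ω))
      exact ⟨_, hMm.ennreal_ofReal, (ae_restrict_mem measurableSet_Ioc).mono fun u hu => by
        simp only [Function.comp_apply, indicator_of_mem hu]⟩
  calc ∫⁻ ω, ENNReal.ofReal (M T ω) * ∫⁻ u in Ioc t T, w u ω ∂κ ω ∂P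
      = ∫⁻ ω, ⨆ n, ENNReal.ofReal (M T ω) * ∫⁻ u in Ioc t T, wn n u ω ∂κ ω ∂P := by
        refine lintegral_congr fun ω => ?_
        simp_rw [← ENNReal.mul_iSup, ← hsup]
        rw [lintegral_iSup' (fun n => hwnm n ω) (ae_of_all _ fun u => hmono u ω)]
    _ = ⨆ n, ∫⁻ ω, ENNReal.ofReal (M T ω) * ∫⁻ u in Ioc t T, wn n u ω ∂κ ω ∂P := by
        refine lintegral_iSup (fun n => ?_) fun n k hnk ω => ?_
        · refine ((hM.stronglyMeasurable T).mono (𝓕.le T)).measurable.ennreal_ofReal.mul ?_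
          convert measurable_setLIntegral_Ioc htT hfin hκm ((hwn n T htT).mono hle le_rfl)
            using 2 with ω
          exact (setLIntegral_Ioc_congr le_rfl (κ ω) fun u => wn n u ω).symm
        · exact mul_le_mul_right (lintegral_mono fun u => hmono u ω hnk) _
    _ = ⨆ n, ∫⁻ ω, ∫⁻ u in Ioc t T, wn n u ω * ENNReal.ofReal (M u ω) ∂κ ω ∂P :=
        iSup_congr fun n => lintegral_martingale_bounded hM hM0 hc htT hfin hκ (hwn n)
          (ENNReal.natCast_ne_top n) fun u ω => min_le_right _ _
    _ = ∫⁻ ω, ⨆ n, ∫⁻ u in Ioc t T, wn n u ω * ENNReal.ofReal (M u ω) ∂κ ω ∂P := by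
        refine (lintegral_iSup (fun n => ?_) fun n k hnk ω => ?_).symm
        · exact measurable_lintegral_martingale hM hc htT hfin hκm ((hwn n T htT).mono hle le_rfl)
        · exact lintegral_mono fun u => mul_le_mul_left (hmono u ω hnk) _
    _ = _ := by
        refine lintegral_congr fun ω => ?_
        simp_rw [← hsup, ENNReal.iSup_mul]
        exact (lintegral_iSup' (fun n => (hwnm n ω).mul (hMa ω))
          (ae_of_all _ fun u n k hnk => mul_le_mul_left (hmono u ω hnk) _)).symm

/-- The set A is known from time t on, so its indicator can be absorbed into the weight. -/
lemma setLIntegral_martingale_weight (hM : Martingale M 𝓕 P) (hM0 : ∀ u ω, 0 ≤ M u ω)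
    (hc : ∀ ω, IsCadlag fun u => M u ω) (htT : t ≤ T)
    (hfin : ∀ ω, κ ω (Ioc t T) ≠ ∞)
    (hκ : ∀ a b, t ≤ a → a ≤ b → b ≤ T → Measurable[𝓕 b] fun ω => κ ω (Ioc a b))
    (hw : ∀ b, t ≤ b →
      Measurable[(𝓕 b).prod inferInstance] fun z : Ω × ℝ≥0 => w (min z.2 b) z.1)
    {A : Set Ω} (hA : MeasurableSet[𝓕 t] A) :
    ∫⁻ ω in A, ENNReal.ofReal (M T ω) * ∫⁻ u in Ioc t T, w u ω ∂κ ω ∂P =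
      ∫⁻ ω in A, ∫⁻ u in Ioc t T, w u ω * ENNReal.ofReal (M u ω) ∂κ ω ∂P := by
  have h := lintegral_martingale_weight (w := fun u => A.indicator (w u)) hM hM0 hc htT hfin hκ
    fun b hb => ?_
  · rw [← lintegral_indicator (𝓕.le t A hA), ← lintegral_indicator (𝓕.le t A hA)]
    convert h using 3 with ω ω
    all_goals by_cases hω : ω ∈ A <;> simp [hω]
  · have hpre : MeasurableSet[(𝓕 b).prod inferInstance] (Prod.fst ⁻¹' A : Set (Ω × ℝ≥0)) :=
      measurableSet_preimage (@measurable_fst Ω ℝ≥0 (𝓕 b) _) (𝓕.mono hb A hA)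
    exact (hw b hb).indicator hpre

/-! ### Discounted survival mass of a random measure -/

/-- `∫_(t,T] 1_{Y_u > x} R_u⁻¹ κ(du)`. -/
def survMass (κ : Ω → Measure ℝ≥0) (Y R : ℝ≥0 → Ω → ℝ) (t T : ℝ≥0) (z : Ω × ℝ) : ℝ≥0∞ :=
  ∫⁻ u in Ioc t T, ENNReal.ofReal (survWeight Y R u z.2 z.1) ∂κ z.1

variable {Y R : ℝ≥0 → Ω → ℝ}

lemma measurable_survMass (hY : IsDecreasing 𝓕 Y) (hR : IsStronglyPredictable 𝓕 R) (htT : t ≤ T)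
    (hfin : ∀ ω, κ ω (Ioc t T) ≠ ∞)
    (hκ : ∀ a b, t ≤ a → a ≤ b → b ≤ T → Measurable[𝓕 b] fun ω => κ ω (Ioc a b)) :
    Measurable[(𝓕 T).prod inferInstance] (survMass κ Y R t T) := by
  have h := measurable_setLIntegral_Ioc (m := (𝓕 T).prod inferInstance)
    (κ := fun z : Ω × ℝ => κ z.1) htT (fun z => hfin z.1)
    (fun c d hc hcd hd => ((hκ c d hc hcd hd).mono (𝓕.mono hd) le_rfl).comp
      (@measurable_fst Ω ℝ (𝓕 T) _)) (measurable_survWeight hY hR T).ennreal_ofReal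
  convert h using 2 with z
  exact (setLIntegral_Ioc_congr le_rfl (κ z.1)
    fun u => ENNReal.ofReal (survWeight Y R u z.2 z.1)).symm

lemma measurable_survWeight_section (hY : IsDecreasing 𝓕 Y) (hR : IsStronglyPredictable 𝓕 R)
    (x : ℝ) (b : ℝ≥0) : Measurable[(𝓕 b).prod inferInstance]
      fun z : Ω × ℝ≥0 => survWeight Y R (min z.2 b) x z.1 := by
  have h : Measurable[(𝓕 b).prod inferInstance, ((𝓕 b).prod inferInstance).prod inferInstance]
      fun z : Ω × ℝ≥0 => ((z.1, x), z.2) :=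
    measurable_prodMk_of (mβ := (𝓕 b).prod inferInstance)
      (measurable_prodMk_of (mβ := 𝓕 b) (@measurable_fst Ω ℝ≥0 (𝓕 b) _) measurable_const)
      (@measurable_snd Ω ℝ≥0 (𝓕 b) _)
  exact (measurable_survWeight hY hR b).comp h

variable {L : Ω → ℝ} {p : ℝ≥0 → ℝ → Ω → ℝ}

lemma isCadlag_zero : IsCadlag fun _ => 0 := fun _ =>
  ⟨continuousWithinAt_const, 0, tendsto_const_nhds⟩

/-- For fixed x the bad paths form a null set, which the usual conditions place in 𝓕_0; setting p to
zero there keeps the martingale property and makes every path càdlàg. -/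
lemma IsCondDensity.exists_cadlag (hp : IsCondDensity P 𝓕 L p) (h𝓕 : UsualConditions P 𝓕) (x : ℝ) :
    ∃ M : ℝ≥0 → Ω → ℝ, Martingale M 𝓕 P ∧ (∀ u ω, 0 ≤ M u ω) ∧
      (∀ ω, IsCadlag fun u => M u ω) ∧ ∀ᵐ ω ∂P, ∀ u, M u ω = p u x ω := by
  let N : Set Ω := {ω | ¬ IsCadlag fun u => p u x ω}
  have hN : P N = 0 := hp.cadlag x
  refine ⟨zeroOn N fun u => p u x, martingale_zeroOn (h𝓕.complete N hN) hN (hp.martingale x),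
    fun u ω => ?_, fun ω => ?_, ?_⟩
  · by_cases h : ω ∈ N
    · rw [zeroOn_of_mem h]
    · rw [zeroOn_of_notMem h]
      exact hp.nonneg u x ω
  · by_cases h : ω ∈ N
    · simpa only [zeroOn_of_mem h] using isCadlag_zero
    · simpa only [zeroOn_of_notMem h] using not_not.1 h
  · filter_upwards [hp.cadlag x] with ω hω u
    exact zeroOn_of_notMem (not_not.2 hω) _ u

lemma IsCondDensity.setLIntegral_survMass (hp : IsCondDensity P 𝓕 L p) (h𝓕 : UsualConditions P 𝓕)
    (hY : IsDecreasing 𝓕 Y) (hR : IsStronglyPredictable 𝓕 R) (htT : t ≤ T)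
    (hfin : ∀ ω, κ ω (Ioc t T) ≠ ∞)
    (hκ : ∀ a b, t ≤ a → a ≤ b → b ≤ T → Measurable[𝓕 b] fun ω => κ ω (Ioc a b)) (x : ℝ) :
    AEMeasurable (fun ω => ∫⁻ u in Ioc t T,
        ENNReal.ofReal (survWeight Y R u x ω) * ENNReal.ofReal (p u x ω) ∂κ ω) P ∧
      ∀ A, MeasurableSet[𝓕 t] A →
        ∫⁻ ω in A, ENNReal.ofReal (p T x ω) * survMass κ Y R t T (ω, x) ∂P =
          ∫⁻ ω in A, ∫⁻ u in Ioc t T,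
            ENNReal.ofReal (survWeight Y R u x ω) * ENNReal.ofReal (p u x ω) ∂κ ω ∂P := by
  obtain ⟨M, hM, hM0, hMc, hMp⟩ := hp.exists_cadlag h𝓕 x
  have hle : (𝓕 T).prod (inferInstance : MeasurableSpace ℝ≥0) ≤ mΩ.prod inferInstance :=
    sup_le_sup_right (MeasurableSpace.comap_mono (𝓕.le T)) _
  have hw : ∀ b, Measurable[(𝓕 b).prod inferInstance]
      fun z : Ω × ℝ≥0 => ENNReal.ofReal (survWeight Y R (min z.2 b) x z.1) := fun b =>
    (measurable_survWeight_section hY hR x b).ennreal_ofReal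
  refine ⟨⟨_, measurable_lintegral_martingale
    (w := fun u ω => ENNReal.ofReal (survWeight Y R u x ω)) hM hMc htT hfin
    (fun a b h1 h2 h3 => (hκ a b h1 h2 h3).mono (𝓕.le b) le_rfl)
    ((hw T).mono hle le_rfl), ?_⟩, fun A hA => ?_⟩
  · filter_upwards [hMp] with ω hω
    simp only [hω]
  · have h := setLIntegral_martingale_weight
      (w := fun u ω => ENNReal.ofReal (survWeight Y R u x ω)) hM hM0 hMc htT hfin hκ
      (fun b _ => hw b) hA
    convert h using 1
    all_goals
      refine lintegral_congr_ae (ae_restrict_of_ae ?_)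
      filter_upwards [hMp] with ω hω
      simp only [hω, survMass]

end Projection

/-! ### The dividend term at a fixed barrier level -/

section Dividend

variable {P : Measure Ω} [IsProbabilityMeasure P] {𝓕 : Filtration ℝ≥0 mΩ} {t T : ℝ≥0}
    {κ : Ω → Measure ℝ≥0} {Y R : ℝ≥0 → Ω → ℝ} {L : Ω → ℝ} {p : ℝ≥0 → ℝ → Ω → ℝ}

lemma integrableOn_and_integral_of_ofReal {φ : ℝ≥0 → ℝ} {μ : Measure ℝ≥0} {s : Set ℝ≥0}
    (hφ : AEMeasurable φ (μ.restrict s)) (h0 : ∀ u, 0 ≤ φ u)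
    (hfin : ∫⁻ u in s, ENNReal.ofReal (φ u) ∂μ ≠ ∞) :
    IntegrableOn φ s μ ∧ ∫ u in s, φ u ∂μ = (∫⁻ u in s, ENNReal.ofReal (φ u) ∂μ).toReal :=
  ⟨(lintegral_ofReal_ne_top_iff_integrable hφ.aestronglyMeasurable (ae_of_all _ h0)).1 hfin,
    integral_eq_lintegral_of_nonneg_ae (ae_of_all _ h0) hφ.aestronglyMeasurable⟩

/-- The projection identity carries finiteness of the p_T-weighted mass over to the pathwise
integral against p_u. A finite mean then gives almost sure absolute convergence and allows
real-valued integrals. -/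
lemma IsCondDensity.setIntegral_survMass (hp : IsCondDensity P 𝓕 L p) (h𝓕 : UsualConditions P 𝓕)
    (hY : IsDecreasing 𝓕 Y) (hR : IsStronglyPredictable 𝓕 R) (hRpos : ∀ u ω, 0 < R u ω)
    (htT : t ≤ T) (hfin : ∀ ω, κ ω (Ioc t T) ≠ ∞)
    (hκ : ∀ a b, t ≤ a → a ≤ b → b ≤ T → Measurable[𝓕 b] fun ω => κ ω (Ioc a b)) {x : ℝ}
    (hx : ∫⁻ ω, survMass κ Y R t T (ω, x) * ENNReal.ofReal (p T x ω) ∂P ≠ ∞) :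
    (∀ᵐ ω ∂P, IntegrableOn (fun u => survWeight Y R u x ω * p u x ω) (Ioc t T) (κ ω)) ∧
      Integrable (fun ω => ∫ u in Ioc t T, survWeight Y R u x ω * p u x ω ∂κ ω) P ∧
      Integrable (fun ω => (survMass κ Y R t T (ω, x)).toReal * p T x ω) P ∧
      ∀ A, MeasurableSet[𝓕 t] A →
        ∫ ω in A, ∫ u in Ioc t T, survWeight Y R u x ω * p u x ω ∂κ ω ∂P =
          ∫ ω in A, (survMass κ Y R t T (ω, x)).toReal * p T x ω ∂P := by
  obtain ⟨hm, hA⟩ := hp.setLIntegral_survMass h𝓕 hY hR htT hfin hκ x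
  have hsm : Measurable fun ω => survMass κ Y R t T (ω, x) :=
    measurable_section (𝓕.le T) (measurable_survMass hY hR htT hfin hκ) x
  have hpm : Measurable fun ω => p T x ω := (hp.measurable_joint T).comp measurable_prodMk_right
  set e : Ω → ℝ≥0∞ := fun ω => ∫⁻ u in Ioc t T,
    ENNReal.ofReal (survWeight Y R u x ω) * ENNReal.ofReal (p u x ω) ∂κ ω with he
  have hmul : Measurable fun ω => survMass κ Y R t T (ω, x) * ENNReal.ofReal (p T x ω) :=
    hsm.mul hpm.ennreal_ofReal
  have hA' : ∀ A, MeasurableSet[𝓕 t] A →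
      ∫⁻ ω in A, survMass κ Y R t T (ω, x) * ENNReal.ofReal (p T x ω) ∂P =
        ∫⁻ ω in A, e ω ∂P := fun A h => by
    rw [← hA A h]
    exact lintegral_congr fun ω => mul_comm _ _
  have he1 : ∫⁻ ω, e ω ∂P ≠ ∞ := by
    have h := hA' univ MeasurableSet.univ
    rw [setLIntegral_univ, setLIntegral_univ] at h
    rwa [← h]
  have h0 : ∀ u ω, 0 ≤ survWeight Y R u x ω * p u x ω := fun u ω =>
    mul_nonneg (survWeight_nonneg hRpos u x ω) (hp.nonneg u x ω)
  have hae : ∀ᵐ ω ∂P, IntegrableOn (fun u => survWeight Y R u x ω * p u x ω) (Ioc t T) (κ ω) ∧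
      ∫ u in Ioc t T, survWeight Y R u x ω * p u x ω ∂κ ω = (e ω).toReal := by
    obtain ⟨M, hM, hM0, hMc, hMp⟩ := hp.exists_cadlag h𝓕 x
    have hMm := measurable_indicator_of_rightCont (m := mΩ)
      (fun u => ((hM.stronglyMeasurable u).mono (𝓕.le u)).measurable) (fun ω u => (hMc ω u).1) htT
    filter_upwards [hMp, ae_lt_top' hm he1] with ω h1 h2
    have hmeas : AEMeasurable (fun u => survWeight Y R u x ω * p u x ω)
        ((κ ω).restrict (Ioc t T)) := by
      refine ⟨fun u => survWeight Y R (min u T) x ω * (Ioc t T).indicator (fun v => M v ω) u,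
        Measurable.mul ?_ (hMm.comp measurable_prodMk_left),
        (ae_restrict_mem measurableSet_Ioc).mono fun u hu => ?_⟩
      · exact (measurable_survWeight_section hY hR x T).comp
          (@measurable_prodMk_left _ _ (𝓕 T) _ ω)
      · simp only [indicator_of_mem hu, min_eq_left hu.2, h1]
    have heq : ∫⁻ u in Ioc t T, ENNReal.ofReal (survWeight Y R u x ω * p u x ω) ∂κ ω = e ω :=
      lintegral_congr fun u => ENNReal.ofReal_mul (survWeight_nonneg hRpos u x ω)
    have h3 := integrableOn_and_integral_of_ofReal hmeas (fun u => h0 u ω)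
      (by rw [heq]; exact h2.ne)
    exact ⟨h3.1, h3.2.trans (by rw [heq])⟩
  have hint : (fun ω => ∫ u in Ioc t T, survWeight Y R u x ω * p u x ω ∂κ ω) =ᵐ[P]
      fun ω => (e ω).toReal := hae.mono fun ω h => h.2
  have hprod : ∀ ω, (survMass κ Y R t T (ω, x)).toReal * p T x ω =
      (survMass κ Y R t T (ω, x) * ENNReal.ofReal (p T x ω)).toReal := fun ω => by
    rw [ENNReal.toReal_mul, ENNReal.toReal_ofReal (hp.nonneg T x ω)]
  refine ⟨hae.mono fun ω h => h.1, (integrable_toReal_of_lintegral_ne_top hm he1).congr hint.symm,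
    ?_, fun A h => ?_⟩
  · simp_rw [hprod]
    exact integrable_toReal_of_lintegral_ne_top hmul.aemeasurable hx
  · rw [integral_congr_ae (ae_restrict_of_ae hint)]
    simp_rw [hprod]
    rw [integral_toReal hm.restrict (ae_restrict_of_ae (ae_lt_top' hm he1)),
      integral_toReal hmul.aemeasurable (ae_restrict_of_ae (ae_lt_top hmul hx)), hA' A h]

end Dividend

/-! ### The cash flow as a function of the barrier level -/

/-- Adapted processes all of whose paths are continuous and of locally bounded variation. -/
structure IsContBV (𝓕 : Filtration ℝ≥0 mΩ) (g : ℝ≥0 → Ω → ℝ) : Prop where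
  measurable : ∀ u, Measurable[𝓕 u] (g u)
  continuous : ∀ ω, Continuous fun u => g u ω
  variation : ∀ ω, LocallyBoundedVariationOn (fun u => g u ω) univ

section Payoff

variable {P : Measure Ω} [IsProbabilityMeasure P] {𝓕 : Filtration ℝ≥0 mΩ} {t T : ℝ≥0}
    {Y R g H : ℝ≥0 → Ω → ℝ} {C L : Ω → ℝ} {p : ℝ≥0 → ℝ → Ω → ℝ}

lemma IsContBV.measurable_pos (hg : IsContBV 𝓕 g) (a b : ℝ≥0) (hab : a ≤ b) (hb : b ≤ T) :
    Measurable[𝓕 b] fun ω => pathPos (fun u => g u ω) T (Ioc a b) :=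
  measurable_pathPos (m := 𝓕 b) hg.continuous hg.variation hab hb
    fun u hu => (hg.measurable u).mono (𝓕.mono hu) le_rfl

lemma IsContBV.measurable_neg (hg : IsContBV 𝓕 g) (a b : ℝ≥0) (hab : a ≤ b) (hb : b ≤ T) :
    Measurable[𝓕 b] fun ω => pathNeg (fun u => g u ω) T (Ioc a b) :=
  measurable_pathNeg (m := 𝓕 b) hg.continuous hg.variation hab hb
    fun u hu => (hg.measurable u).mono (𝓕.mono hu) le_rfl

/-- `∫_(t,T] 1_{Y_u > x} R_u⁻¹ (dg_u)⁺`. -/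
def dividendPos (g Y R : ℝ≥0 → Ω → ℝ) (t T : ℝ≥0) : Ω × ℝ → ℝ≥0∞ :=
  survMass (fun ω => pathPos (fun u => g u ω) T) Y R t T

/-- `∫_(t,T] 1_{Y_u > x} R_u⁻¹ (dg_u)⁻`. -/
def dividendNeg (g Y R : ℝ≥0 → Ω → ℝ) (t T : ℝ≥0) : Ω × ℝ → ℝ≥0∞ :=
  survMass (fun ω => pathNeg (fun u => g u ω) T) Y R t T

/-- The value of `H` at the time when `Y` reaches the level `x`, if this happens in `(t, T]`. -/
def exitRecovery (Y H : ℝ≥0 → Ω → ℝ) (t T : ℝ≥0) (z : Ω × ℝ) : ℝ :=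
  {z : Ω × ℝ | z.2 < Y t z.1 ∧ ¬ z.2 < Y T z.1}.indicator
    (fun z => H (exitTime Y T z.2 z.1) z.1) z

lemma exitRecovery_mul (q : Ω → ℝ) (x : ℝ) (ω : Ω) :
    H (exitTime Y T x ω) ω * ({ω | x < Y t ω} \ {ω | x < Y T ω}).indicator q ω =
      exitRecovery Y H t T (ω, x) * q ω := by
  by_cases h1 : x < Y t ω <;> by_cases h2 : x < Y T ω <;> simp [exitRecovery, indicator, h1, h2]

lemma setIntegral_add_sub_sub {μ : Measure Ω} {A : Set Ω} {a b c d b' c' d' : Ω → ℝ}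
    (ha : IntegrableOn a A μ)
    (hb : IntegrableOn b A μ) (hc : IntegrableOn c A μ) (hd : IntegrableOn d A μ)
    (hb' : IntegrableOn b' A μ) (hc' : IntegrableOn c' A μ) (hd' : IntegrableOn d' A μ)
    (hbb : ∫ ω in A, b ω ∂μ = ∫ ω in A, b' ω ∂μ) (hcc : ∫ ω in A, c ω ∂μ = ∫ ω in A, c' ω ∂μ)
    (hdd : ∫ ω in A, d ω ∂μ = -∫ ω in A, d' ω ∂μ) :
    ∫ ω in A, (a ω + (b ω - c ω) - d ω) ∂μ = ∫ ω in A, (a ω + (b' ω - c' ω) + d' ω) ∂μ := by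
  rw [integral_sub (f := fun ω => a ω + (b ω - c ω)) (ha.add (hb.sub hc)) hd,
    integral_add (g := fun ω => b ω - c ω) ha (hb.sub hc), integral_sub hb hc,
    integral_add (f := fun ω => a ω + (b' ω - c' ω)) (ha.add (hb'.sub hc')) hd',
    integral_add (g := fun ω => b' ω - c' ω) ha (hb'.sub hc'), integral_sub hb' hc', hbb, hcc, hdd,
    sub_neg_eq_add]

/-- The discounted cash flow after `t` if the barrier is at `x`. -/
def barrierPayoff (C : Ω → ℝ) (Y R g H : ℝ≥0 → Ω → ℝ) (t T : ℝ≥0) (z : Ω × ℝ) : ℝ :=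
  C z.1 * survWeight Y R T z.2 z.1
    + ((dividendPos g Y R t T z).toReal - (dividendNeg g Y R t T z).toReal)
    + exitRecovery Y H t T z

/-- The assumptions on the cash flow, after modification of the paths on a null set. -/
structure BarrierModel (P : Measure Ω) [IsProbabilityMeasure P] (𝓕 : Filtration ℝ≥0 mΩ) (L : Ω → ℝ)
    (p : ℝ≥0 → ℝ → Ω → ℝ) (C : Ω → ℝ) (Y R g H : ℝ≥0 → Ω → ℝ) (t T : ℝ≥0) : Prop where
  le : t ≤ T
  usual : UsualConditions P 𝓕
  barrier : Measurable L
  jacod : JacodHypothesis P 𝓕 L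
  density : IsCondDensity P 𝓕 L p
  decreasing : IsDecreasing 𝓕 Y
  discount : IsStronglyPredictable 𝓕 R
  discount_pos : ∀ u ω, 0 < R u ω
  dividend : IsContBV 𝓕 g
  terminal : Measurable[𝓕 T] C
  recovery : IsStronglyPredictable 𝓕 H
  integrable_terminal : Integrable (fun ω => C ω * survWeight Y R T (L ω) ω) P
  lintegral_pos : ∫⁻ ω, dividendPos g Y R t T (ω, L ω) ∂P ≠ ∞
  lintegral_neg : ∫⁻ ω, dividendNeg g Y R t T (ω, L ω) ∂P ≠ ∞
  integrable_recovery : Integrable (fun ω => exitRecovery Y H t T (ω, L ω)) P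

namespace BarrierModel

lemma measurable_dividendPos (hB : BarrierModel P 𝓕 L p C Y R g H t T) :
    Measurable[(𝓕 T).prod inferInstance] (dividendPos g Y R t T) :=
  measurable_survMass hB.decreasing hB.discount hB.le (fun _ => measure_ne_top _ _)
    fun a b _ hab hb => hB.dividend.measurable_pos a b hab hb

lemma measurable_dividendNeg (hB : BarrierModel P 𝓕 L p C Y R g H t T) :
    Measurable[(𝓕 T).prod inferInstance] (dividendNeg g Y R t T) :=
  measurable_survMass hB.decreasing hB.discount hB.le (fun _ => measure_ne_top _ _)
    fun a b _ hab hb => hB.dividend.measurable_neg a b hab hb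

lemma measurable_terminal (hB : BarrierModel P 𝓕 L p C Y R g H t T) :
    Measurable[(𝓕 T).prod inferInstance]
      fun z : Ω × ℝ => C z.1 * survWeight Y R T z.2 z.1 := by
  refine (hB.terminal.comp (@measurable_fst Ω ℝ (𝓕 T) _)).mul ?_
  have h : Measurable[(𝓕 T).prod inferInstance, ((𝓕 T).prod inferInstance).prod inferInstance]
      fun z : Ω × ℝ => (z, T) :=
    measurable_prodMk_of (mα := (𝓕 T).prod inferInstance) (mβ := (𝓕 T).prod inferInstance)
      measurable_id measurable_const
  simpa only [Function.comp_def, min_self] using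
    (measurable_survWeight hB.decreasing hB.discount T).comp h

lemma measurable_exitRecovery (hB : BarrierModel P 𝓕 L p C Y R g H t T) :
    Measurable[(𝓕 T).prod inferInstance] (exitRecovery Y H t T) := by
  have hset : MeasurableSet[(𝓕 T).prod inferInstance]
      {z : Ω × ℝ | z.2 < Y t z.1 ∧ ¬ z.2 < Y T z.1} :=
    (hB.decreasing.measurableSet_lt hB.le).inter (hB.decreasing.measurableSet_lt le_rfl).compl
  have h : Measurable[(𝓕 T).prod inferInstance, (𝓕 T).prod inferInstance]
      fun z : Ω × ℝ => (z.1, exitTime Y T z.2 z.1) :=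
    measurable_prodMk_of (mα := (𝓕 T).prod inferInstance) (mβ := 𝓕 T)
      (@measurable_fst Ω ℝ (𝓕 T) _) hB.decreasing.measurable_exitTime
  have h2 := (measurable_predictable_min hB.recovery T).comp h
  simp only [Function.comp_def, min_eq_left (exitTime_le _ _)] at h2
  exact h2.indicator hset

lemma measurable_payoff (hB : BarrierModel P 𝓕 L p C Y R g H t T) :
    Measurable[(𝓕 T).prod inferInstance] (barrierPayoff C Y R g H t T) :=
  (hB.measurable_terminal.add (hB.measurable_dividendPos.ennreal_toReal.sub
    hB.measurable_dividendNeg.ennreal_toReal)).add hB.measurable_exitRecovery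

lemma aemeasurable_comp {f : Ω × ℝ → ℝ≥0∞} (hB : BarrierModel P 𝓕 L p C Y R g H t T)
    (hf : Measurable[(𝓕 T).prod inferInstance] f) : AEMeasurable (fun ω => f (ω, L ω)) P :=
  ((hf.mono (prod_le_prod (𝓕.le T)) le_rfl).comp
    (measurable_id.prodMk hB.barrier)).aemeasurable

lemma integrable_dividend (hB : BarrierModel P 𝓕 L p C Y R g H t T) :
    Integrable (fun ω => (dividendPos g Y R t T (ω, L ω)).toReal -
      (dividendNeg g Y R t T (ω, L ω)).toReal) P :=
  (integrable_toReal_of_lintegral_ne_top (hB.aemeasurable_comp hB.measurable_dividendPos)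
    hB.lintegral_pos).sub
  (integrable_toReal_of_lintegral_ne_top (hB.aemeasurable_comp hB.measurable_dividendNeg)
    hB.lintegral_neg)

lemma integrable_payoff (hB : BarrierModel P 𝓕 L p C Y R g H t T) :
    Integrable (fun ω => barrierPayoff C Y R g H t T (ω, L ω)) P :=
  (hB.integrable_terminal.add hB.integrable_dividend).add hB.integrable_recovery

/-- Integrability at the random level L becomes integrability for P ⊗ P^L with density p_T, and
Fubini passes to almost every fixed level. -/
lemma ae_integrable_section (hB : BarrierModel P 𝓕 L p C Y R g H t T) {f : Ω × ℝ → ℝ}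
    (hf : Measurable[(𝓕 T).prod inferInstance] f) (hint : Integrable (fun ω => f (ω, L ω)) P) :
    ∀ᵐ x ∂(P.map L), Integrable (fun ω => f (ω, x) * p T x ω) P := by
  have := Measure.isProbabilityMeasure_map (μ := P) hB.barrier.aemeasurable
  exact ((integrable_comp_barrier_iff hB.barrier hB.density T hf).1 hint).prod_left_ae

lemma ae_lintegral_section_ne_top (hB : BarrierModel P 𝓕 L p C Y R g H t T) {f : Ω × ℝ → ℝ≥0∞}
    (hf : Measurable[(𝓕 T).prod inferInstance] f) (hfin : ∫⁻ ω, f (ω, L ω) ∂P ≠ ∞) :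
    ∀ᵐ x ∂(P.map L), ∫⁻ ω, f (ω, x) * ENNReal.ofReal (p T x ω) ∂P ≠ ∞ := by
  have := Measure.isProbabilityMeasure_map (μ := P) hB.barrier.aemeasurable
  rw [lintegral_comp_barrier hB.barrier hB.density T hf] at hfin
  refine (ae_lt_top ?_ hfin).mono fun x hx => hx.ne
  exact (((hf.mono (prod_le_prod (𝓕.le T)) le_rfl).mul
    (hB.density.measurable_joint T).ennreal_ofReal).comp measurable_swap).lintegral_prod_right'

/-- F is the martingale p(x) killed when Y leaves the decreasing sets {x < Y_u}, so the general
statement on killed martingales applies with ϑ the exit time. -/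
lemma setIntegral_stochIntegral (hB : BarrierModel P 𝓕 L p C Y R g H t T) {F : ℝ≥0 → Ω → ℝ} {x : ℝ}
    (hF : ∀ᵐ ω ∂P, ∀ u, F u ω = {ω | x < Y u ω}.indicator (fun ω => p u x ω) ω)
    (hint : Integrable (fun ω => exitRecovery Y H t T (ω, x) * p T x ω) P) {I : Ω → ℝ}
    (hI : IsStochIntegral P 𝓕 F H t T I) {A : Set Ω} (hA : MeasurableSet[𝓕 t] A) :
    ∫ ω in A, I ω ∂P = -∫ ω in A, exitRecovery Y H t T (ω, x) * p T x ω ∂P := by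
  have hjoint : Measurable fun z : Ω × ℝ => exitTime Y T z.2 z.1 :=
    (hB.decreasing.measurable_exitTime (T := T)).mono (prod_le_prod (𝓕.le T)) le_rfl
  have hϑ : Measurable fun ω => exitTime Y T x ω := by
    have h := hjoint.comp (measurable_prodMk_right (y := x))
    simpa only [Function.comp_def] using h
  have hrec : (fun ω => exitRecovery Y H t T (ω, x) * p T x ω) = fun ω =>
      H (exitTime Y T x ω) ω *
        ({ω | x < Y t ω} \ {ω | x < Y T ω}).indicator (fun ω => p T x ω) ω :=
    funext fun ω => (exitRecovery_mul (fun ω => p T x ω) x ω).symm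
  rw [hrec] at hint ⊢
  exact hI.setIntegral_eq (hB.density.martingale x) (fun u => hB.density.nonneg u x) hB.le
    (hB.decreasing.isExitTime t x) (fun u => hF.mono fun ω h => h u) hϑ hint hA

/-- At almost every level, the full information payoff and the cash flow weighted with the terminal
density have the same conditional expectation. -/
lemma ae_setIntegral_payoff (hB : BarrierModel P 𝓕 L p C Y R g H t T)
    {X G Z : ℝ≥0 → Ω → ℝ} (hXY : ∀ᵐ ω ∂P, ∀ u, runningInf X u ω = Y u ω)
    (hGg : ∀ᵐ ω ∂P, ∀ u, G u ω = g u ω) (hH : H = fun u ω => Z u ω * (R u ω)⁻¹)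
    (hZF : ∀ᵐ x ∂(P.map L), StochIntegrable P 𝓕 (fun u => survivalDensity X p u x) H t T) :
    ∀ᵐ x ∂(P.map L),
      (∀ᵐ ω ∂P, IntegrableOn (fun u => survivalDensity X p u x ω * (R u ω)⁻¹)
        (Ioc t T) (pathVariation (fun u => G u ω) T)) ∧
      Integrable (fullInfoPayoff P 𝓕 R (survivalDensity X p) C G Z t T x) P ∧
      ∀ A, MeasurableSet[𝓕 t] A →
        ∫ ω in A, fullInfoPayoff P 𝓕 R (survivalDensity X p) C G Z t T x ω ∂P =
          ∫ ω in A, barrierPayoff C Y R g H t T (ω, x) * p T x ω ∂P := by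
  filter_upwards [hB.ae_integrable_section hB.measurable_terminal hB.integrable_terminal,
    hB.ae_integrable_section hB.measurable_exitRecovery hB.integrable_recovery,
    hB.ae_lintegral_section_ne_top hB.measurable_dividendPos hB.lintegral_pos,
    hB.ae_lintegral_section_ne_top hB.measurable_dividendNeg hB.lintegral_neg, hZF]
    with x h1 h2 h3 h4 h5
  -- The projection identity concerns positive measures, so it is used separately for the increasing
  -- and the decreasing part of the dividend path.
  obtain ⟨p1, p2, p3, p4⟩ := hB.density.setIntegral_survMass hB.usual hB.decreasing hB.discount
    hB.discount_pos hB.le (fun _ => measure_ne_top _ _)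
    (fun a b _ hab hb => hB.dividend.measurable_pos a b hab hb) h3
  obtain ⟨n1, n2, n3, n4⟩ := hB.density.setIntegral_survMass hB.usual hB.decreasing hB.discount
    hB.discount_pos hB.le (fun _ => measure_ne_top _ _)
    (fun a b _ hab hb => hB.dividend.measurable_neg a b hab hb) h4
  have hI : IsStochIntegral P 𝓕 (fun u => survivalDensity X p u x) H t T
      (stochIntegral P 𝓕 (fun u => survivalDensity X p u x) H t T) := by
    rw [stochIntegral, dif_pos h5]
    exact h5.choose_spec
  have hF : ∀ᵐ ω ∂P, ∀ u, survivalDensity X p u x ω =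
      {ω | x < Y u ω}.indicator (fun ω => p u x ω) ω := by
    filter_upwards [hXY] with ω h u
    by_cases hx : x < Y u ω <;> simp [survivalDensity, h, hx]
  have hFR : ∀ᵐ ω ∂P, ∀ u, survivalDensity X p u x ω * (R u ω)⁻¹ =
      survWeight Y R u x ω * p u x ω := by
    filter_upwards [hF] with ω h u
    rw [h u]
    by_cases hx : x < Y u ω <;> simp [survWeight, hx, mul_comm]
  have hG : ∀ᵐ ω ∂P, (fun u => G u ω) = fun u => g u ω := hGg.mono fun ω h => funext h
  have hvar : ∀ᵐ ω ∂P, IntegrableOn (fun u => survivalDensity X p u x ω * (R u ω)⁻¹)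
      (Ioc t T) (pathVariation (fun u => G u ω) T) := by
    filter_upwards [hFR, hG, p1, n1] with ω e1 e2 e3 e4
    simp_rw [e1, e2, pathVariation_eq_add]
    exact integrableOn_add_measure.2 ⟨e3, e4⟩
  have hstoch := fun A hA => hB.setIntegral_stochIntegral hF h2 hI (A := A) hA
  have hfull : fullInfoPayoff P 𝓕 R (survivalDensity X p) C G Z t T x =ᵐ[P] fun ω =>
      C ω * survWeight Y R T x ω * p T x ω
        + (∫ u in Ioc t T, survWeight Y R u x ω * p u x ω ∂pathPos (fun u => g u ω) T
          - ∫ u in Ioc t T, survWeight Y R u x ω * p u x ω ∂pathNeg (fun u => g u ω) T)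
        - stochIntegral P 𝓕 (fun u => survivalDensity X p u x) H t T ω := by
    filter_upwards [hFR, hG, hvar] with ω e1 e2 e3
    rw [fullInfoPayoff, pathIntegral_eq e3, hH, mul_assoc, mul_comm (R T ω)⁻¹, e1 T, mul_assoc]
    simp_rw [e1, e2]
  refine ⟨hvar, (((h1.add (p2.sub n2)).sub hI.1).congr hfull.symm), fun A hA => ?_⟩
  rw [integral_congr_ae (ae_restrict_of_ae hfull), setIntegral_add_sub_sub h1.integrableOn
    p2.integrableOn n2.integrableOn hI.1.integrableOn p3.integrableOn n3.integrableOn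
    h2.integrableOn (p4 A hA) (n4 A hA) (hstoch A hA)]
  congr 1 with ω
  simp only [barrierPayoff, dividendPos, dividendNeg]
  ring

end BarrierModel

end Payoff

/-! ### Conditional expectations with respect to the manager's filtration -/

section Manager

variable {P : Measure Ω} [IsProbabilityMeasure P] {𝓕 : Filtration ℝ≥0 mΩ} {t T : ℝ≥0}
    {Y R g H : ℝ≥0 → Ω → ℝ} {C L : Ω → ℝ} {p : ℝ≥0 → ℝ → Ω → ℝ}

/-- The manager's events are thereby the sets {ω | (ω, L ω) ∈ S} with S in 𝓕_t ⊗ 𝓑(ℝ), the form to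
which the disintegration applies. -/
lemma managerFiltration_eq_comap (hL : Measurable L) (t : ℝ≥0) :
    managerFiltration 𝓕 L hL t =
      ((𝓕 t).prod inferInstance).comap fun ω => (ω, L ω) := by
  change 𝓕 t ⊔ MeasurableSpace.comap L inferInstance =
    ((𝓕 t).comap Prod.fst ⊔ MeasurableSpace.comap Prod.snd inferInstance).comap _
  rw [MeasurableSpace.comap_sup, MeasurableSpace.comap_comp, MeasurableSpace.comap_comp]
  congr 1
  exact MeasurableSpace.comap_id.symm

lemma measurable_comp_barrier {β : Type*} [MeasurableSpace β] (hL : Measurable L)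
    {f : Ω × ℝ → β} (hf : Measurable[(𝓕 t).prod inferInstance] f) :
    Measurable[managerFiltration 𝓕 L hL t] fun ω => f (ω, L ω) := by
  rw [managerFiltration_eq_comap]
  exact hf.comp (comap_measurable _)

/-- On 𝓕_t ⊗ 𝓑(ℝ) the law of (ω, L ω) is absolutely continuous with respect to P ⊗ P^L. This
justifies substituting x = L in a statement known only for almost every fixed x. -/
lemma ae_comp_barrier (hL : Measurable L) (hp : IsCondDensity P 𝓕 L p) {S : Set (Ω × ℝ)}
    (hS : MeasurableSet[(𝓕 t).prod inferInstance] S)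
    (h : ∀ᵐ x ∂(P.map L), ∀ᵐ ω ∂P, (ω, x) ∈ S) : ∀ᵐ ω ∂P, (ω, L ω) ∈ S := by
  have hSm : MeasurableSet S := prod_le_prod (𝓕.le t) S hS
  have hf : Measurable[(𝓕 t).prod inferInstance] (Sᶜ.indicator fun _ => (1 : ℝ≥0∞)) :=
    measurable_const.indicator hS.compl
  have h1 : ∫⁻ ω, Sᶜ.indicator (fun _ => (1 : ℝ≥0∞)) (ω, L ω) ∂P = 0 := by
    rw [lintegral_comp_barrier hL hp t hf]
    refine (lintegral_congr_ae (g := 0) ?_).trans lintegral_zero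
    filter_upwards [h] with x hx
    refine (lintegral_congr_ae (g := 0) ?_).trans lintegral_zero
    filter_upwards [hx] with ω hω
    simp [hω]
  have h2 := (lintegral_eq_zero_iff ((measurable_const.indicator hSm.compl).comp
    (measurable_id.prodMk hL))).1 h1
  filter_upwards [h2] with ω hω
  by_contra hn
  simp [hn] at hω

namespace BarrierModel

lemma integrable_weighted (hB : BarrierModel P 𝓕 L p C Y R g H t T) :
    Integrable (fun z => barrierPayoff C Y R g H t T z * p T z.2 z.1) (P.prod (P.map L)) :=
  (integrable_comp_barrier_iff hB.barrier hB.density T hB.measurable_payoff).1 hB.integrable_payoff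

/-- `W` is a jointly measurable version of the conditional expectations given `𝓕_t` of the cash
flows weighted with the terminal density. -/
structure IsVersion (P : Measure Ω) (𝓕 : Filtration ℝ≥0 mΩ) (ν : Measure ℝ) (t : ℝ≥0)
    (Ψ W : Ω × ℝ → ℝ) : Prop where
  measurable : Measurable[(𝓕 t).prod inferInstance] W
  integrable : Integrable W (P.prod ν)
  section_eq : ∀ x, Integrable (fun ω => Ψ (ω, x)) P → Integrable (fun ω => W (ω, x)) P ∧
    ∀ A, MeasurableSet[𝓕 t] A → ∫ ω in A, W (ω, x) ∂P = ∫ ω in A, Ψ (ω, x) ∂P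

lemma exists_isVersion (hB : BarrierModel P 𝓕 L p C Y R g H t T) :
    ∃ W, IsVersion P 𝓕 (P.map L) t
      (fun z => barrierPayoff C Y R g H t T z * p T z.2 z.1) W := by
  have := Measure.isProbabilityMeasure_map (μ := P) hB.barrier.aemeasurable
  obtain ⟨W, h1, h2, h3⟩ := exists_joint_condExp (P := P) (𝓕.le t)
    ((hB.measurable_payoff.mono (prod_le_prod (𝓕.le T)) le_rfl).mul
      (hB.density.measurable_joint T)) hB.integrable_weighted
  exact ⟨W, h1, h2, h3⟩

/-- Each section of S at fixed x lies in 𝓕_t, where W and the weighted cash flow have equal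
integrals; Fubini assembles the sections. -/
lemma integral_indicator_eq (hB : BarrierModel P 𝓕 L p C Y R g H t T) {W : Ω × ℝ → ℝ}
    (hW : IsVersion P 𝓕 (P.map L) t (fun z => barrierPayoff C Y R g H t T z * p T z.2 z.1) W)
    {S : Set (Ω × ℝ)} (hS : MeasurableSet[(𝓕 t).prod inferInstance] S) :
    ∫ z, S.indicator (fun z => barrierPayoff C Y R g H t T z * p T z.2 z.1) z
      ∂(P.prod (P.map L)) = ∫ z, S.indicator W z ∂(P.prod (P.map L)) := by
  have := Measure.isProbabilityMeasure_map (μ := P) hB.barrier.aemeasurable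
  have hSm : MeasurableSet S := prod_le_prod (𝓕.le t) S hS
  rw [integral_prod_symm _ (hB.integrable_weighted.indicator hSm),
    integral_prod_symm _ (hW.integrable.indicator hSm)]
  refine integral_congr_ae ?_
  filter_upwards [hB.integrable_weighted.prod_left_ae] with x hx
  have hSx : MeasurableSet[𝓕 t] {ω | (ω, x) ∈ S} :=
    measurableSet_preimage (@measurable_prodMk_right Ω ℝ (𝓕 t) _ x) hS
  have h := (hW.section_eq x hx).2 _ hSx
  rw [← integral_indicator (𝓕.le t _ hSx), ← integral_indicator (𝓕.le t _ hSx)] at h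
  exact h.symm

/-- This is Bayes' rule. Over a manager's event, the payoff is disintegrated with p_T and the
quotient with p_t; p_t cancels, and both become the same integral for P ⊗ P^L. -/
lemma condExp_payoff (hB : BarrierModel P 𝓕 L p C Y R g H t T) {W : Ω × ℝ → ℝ}
    (hW : IsVersion P 𝓕 (P.map L) t (fun z => barrierPayoff C Y R g H t T z * p T z.2 z.1) W) :
    P[fun ω => barrierPayoff C Y R g H t T (ω, L ω) | managerFiltration 𝓕 L hB.barrier t]
      =ᵐ[P] fun ω => W (ω, L ω) / p t (L ω) ω := by
  set 𝓖 := managerFiltration 𝓕 L hB.barrier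
  have hq : Measurable[(𝓕 t).prod inferInstance] fun z : Ω × ℝ => W z / p t z.2 z.1 :=
    hW.measurable.div (hB.density.measurable t)
  have hqp : (fun z => W z / p t z.2 z.1 * p t z.2 z.1) =ᵐ[P.prod (P.map L)] W := by
    filter_upwards [ae_density_ne_zero hB.barrier hB.jacod hB.density t] with z hz
    exact div_mul_cancel₀ _ hz
  have hint : Integrable (fun ω => W (ω, L ω) / p t (L ω) ω) P :=
    (integrable_comp_barrier_iff hB.barrier hB.density t hq).2 (hW.integrable.congr hqp.symm)
  refine (ae_eq_condExp_of_forall_setIntegral_eq (𝓖.le t) hB.integrable_payoff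
    (fun s _ _ => hint.integrableOn) (fun s hs _ => ?_) ?_).symm
  · have hs' := hs
    rw [managerFiltration_eq_comap] at hs'
    obtain ⟨S, hS, rfl⟩ := hs'
    have hST : MeasurableSet[(𝓕 T).prod inferInstance] S :=
      sup_le_sup_right (MeasurableSpace.comap_mono (𝓕.mono hB.le)) _ S hS
    have hm := 𝓖.le t _ hs
    rw [← integral_indicator hm, ← integral_indicator hm]
    have e1 := integral_comp_barrier hB.barrier hB.density t (hq.indicator hS)
      (hint.indicator hm)
    have e2 := integral_comp_barrier hB.barrier hB.density T (hB.measurable_payoff.indicator hST)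
      (hB.integrable_payoff.indicator hm)
    have e3 := hB.integral_indicator_eq hW hS
    refine e1.trans (Eq.trans ?_ e2.symm)
    have hmul : ∀ (q f : Ω × ℝ → ℝ) z, S.indicator f z * q z = S.indicator (fun z => f z * q z) z :=
      fun q f z => (indicator_mul_left S f q).symm
    simp_rw [hmul fun z => p T z.2 z.1, hmul fun z => p t z.2 z.1]
    rw [e3]
    refine integral_congr_ae ?_
    filter_upwards [hqp] with z hz
    by_cases h : z ∈ S
    · simpa [h] using hz
    · simp [h]
  · exact (measurable_comp_barrier hB.barrier hq).stronglyMeasurable.aestronglyMeasurable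

end BarrierModel

end Manager

/-! ### Versions of the full information value -/

section Value

variable {P : Measure Ω} [IsProbabilityMeasure P] {𝓕 : Filtration ℝ≥0 mΩ} {t T : ℝ≥0}
    {Y R g H : ℝ≥0 → Ω → ℝ} {C L : Ω → ℝ} {p : ℝ≥0 → ℝ → Ω → ℝ}

namespace BarrierModel

variable {W₀ : Ω × ℝ → ℝ} {F G Z : ℝ≥0 → Ω → ℝ}

lemma measurable_discount (hB : BarrierModel P 𝓕 L p C Y R g H t T) :
    Measurable[(𝓕 t).prod inferInstance] fun z : Ω × ℝ => R t z.1 :=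
  (hB.discount.stronglyAdapted t).measurable.comp (@measurable_fst Ω ℝ (𝓕 t) _)

lemma ae_eq_condExp_of_isVersion (hB : BarrierModel P 𝓕 L p C Y R g H t T)
    (hW : IsVersion P 𝓕 (P.map L) t (fun z => barrierPayoff C Y R g H t T z * p T z.2 z.1) W₀)
    {Φ : ℝ → Ω → ℝ} (hΦ : ∀ᵐ x ∂(P.map L), Integrable (Φ x) P ∧ ∀ A, MeasurableSet[𝓕 t] A →
        ∫ ω in A, Φ x ω ∂P = ∫ ω in A, barrierPayoff C Y R g H t T (ω, x) * p T x ω ∂P) :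
    ∀ᵐ x ∂(P.map L), (fun ω => W₀ (ω, x)) =ᵐ[P] P[Φ x | 𝓕 t] := by
  filter_upwards [hΦ, hB.ae_integrable_section hB.measurable_payoff hB.integrable_payoff]
    with x h1 h2
  obtain ⟨h3, h4⟩ := hW.section_eq x h2
  refine ae_eq_condExp_of_forall_setIntegral_eq (𝓕.le t) h1.1 (fun s _ _ => h3.integrableOn)
    (fun s hs _ => (h4 s hs).trans (h1.2 s hs).symm) ?_
  exact (hW.measurable.comp (@measurable_prodMk_right Ω ℝ (𝓕 t) _
    x)).stronglyMeasurable.aestronglyMeasurable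

/-- This makes the value at x = L independent of the chosen version, although versions agree only
for almost every x. -/
lemma ae_comp_eq_of_version (hB : BarrierModel P 𝓕 L p C Y R g H t T)
    (hW : IsVersion P 𝓕 (P.map L) t (fun z => barrierPayoff C Y R g H t T z * p T z.2 z.1) W₀)
    {V : ℝ → Ω → ℝ} (hV : Measurable[(𝓕 t).prod inferInstance] fun z : Ω × ℝ => V z.2 z.1)
    (h : ∀ᵐ x ∂(P.map L), V x =ᵐ[P] fun ω => R t ω * W₀ (ω, x)) :
    ∀ᵐ ω ∂P, V (L ω) ω = R t ω * W₀ (ω, L ω) := by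
  have hd : Measurable[(𝓕 t).prod inferInstance]
      fun z : Ω × ℝ => V z.2 z.1 - R t z.1 * W₀ z :=
    hV.sub (hB.measurable_discount.mul hW.measurable)
  have hS : MeasurableSet[(𝓕 t).prod inferInstance]
      {z : Ω × ℝ | V z.2 z.1 - R t z.1 * W₀ z = 0} := hd (measurableSet_singleton 0)
  filter_upwards [ae_comp_barrier hB.barrier hB.density hS
    (h.mono fun x hx => hx.mono fun ω hω => sub_eq_zero.2 hω)] with ω hω
  exact sub_eq_zero.1 hω

lemma pathIntegral_survWeight (hY : IsDecreasing 𝓕 Y) (hR : IsStronglyPredictable 𝓕 R)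
    (hRpos : ∀ u ω, 0 < R u ω) {x : ℝ} {ω : Ω} (hpos : dividendPos g Y R t T (ω, x) ≠ ∞)
    (hneg : dividendNeg g Y R t T (ω, x) ≠ ∞) :
    pathIntegral (fun u => g u ω) (fun u => survWeight Y R u x ω) t T =
      (dividendPos g Y R t T (ω, x)).toReal - (dividendNeg g Y R t T (ω, x)).toReal := by
  have hm : ∀ μ : Measure ℝ≥0, AEMeasurable (fun u => survWeight Y R u x ω)
      (μ.restrict (Ioc t T)) := fun μ =>
    ⟨fun u => survWeight Y R (min u T) x ω,
      (measurable_survWeight_section hY hR x T).comp (@measurable_prodMk_left _ _ (𝓕 T) _ ω),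
      (ae_restrict_mem measurableSet_Ioc).mono fun u hu => by simp only [min_eq_left hu.2]⟩
  have h1 := integrableOn_and_integral_of_ofReal (hm (pathPos (fun u => g u ω) T))
    (fun u => survWeight_nonneg hRpos u x ω) hpos
  have h2 := integrableOn_and_integral_of_ofReal (hm (pathNeg (fun u => g u ω) T))
    (fun u => survWeight_nonneg hRpos u x ω) hneg
  rw [pathIntegral_eq, h1.2, h2.2]
  · rfl
  · rw [pathVariation_eq_add]
    exact integrableOn_add_measure.2 ⟨h1.1, h2.1⟩

end BarrierModel

end Value

/-! ### The cash flow in terms of the infimum process -/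

section Identification

variable {P : Measure Ω} [IsProbabilityMeasure P] {𝓕 : Filtration ℝ≥0 mΩ} {t T : ℝ≥0}
    {Y R g H Z : ℝ≥0 → Ω → ℝ} {C L : Ω → ℝ} {p : ℝ≥0 → ℝ → Ω → ℝ} {τ : Ω → ℝ≥0∞}

lemma discountedSurvival_eq (hY : IsDecreasing 𝓕 Y) {ω : Ω}
    (hτ : τ ω = firstTime {u | Y u ω ≤ L ω}) (u : ℝ≥0) :
    discountedSurvival R τ u ω = survWeight Y R u (L ω) ω := by
  have h : (u : ℝ≥0∞) < τ ω ↔ L ω < Y u ω := by rw [hτ, hY.lt_firstTime_iff]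
  by_cases hx : L ω < Y u ω <;> simp [discountedSurvival, survWeight, h, hx]

/-- `discountedRecovery` also counts defaults up to time t; the indicator of {L < Y_t} removes them.
Between t and T the truncation in the exit time has no effect. -/
lemma exitRecovery_eq (hY : IsDecreasing 𝓕 Y) {ω : Ω}
    (hτ : τ ω = firstTime {u | Y u ω ≤ L ω}) :
    exitRecovery Y (fun u ω => Z u ω * (R u ω)⁻¹) t T (ω, L ω) =
      {ω | L ω < Y t ω}.indicator (discountedRecovery R Z τ T) ω := by
  have h : (T : ℝ≥0∞) < τ ω ↔ L ω < Y T ω := by rw [hτ, hY.lt_firstTime_iff]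
  by_cases h1 : L ω < Y t ω
  · by_cases h2 : L ω < Y T ω
    · simp [exitRecovery, discountedRecovery, h1, h2, h.2 h2]
    · have h3 : τ ω ≤ T := not_lt.1 fun h' => h2 (h.1 h')
      have h4 : exitTime Y T (L ω) ω = (τ ω).toNNReal := by
        rw [exitTime, ← hτ, min_eq_left h3]
      have h5 : (ω, L ω) ∈ {z : Ω × ℝ | z.2 < Y t z.1 ∧ ¬ z.2 < Y T z.1} := ⟨h1, h2⟩
      rw [exitRecovery, indicator_of_mem h5]
      simp [discountedRecovery, h1, h3, h4]
  · simp [exitRecovery, h1]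

/-- All exceptional paths lie in one null set, which belongs to 𝓕_0. Setting both processes to zero
there preserves adaptedness, and the zero path has every regularity required. -/
lemma exists_null_modification {μ : Measure Ω} (h𝓕 : UsualConditions μ 𝓕) {X G : ℝ≥0 → Ω → ℝ}
    (hX : StronglyAdapted 𝓕 X) (hXpath : ∀ᵐ ω ∂μ, IsCadlag (fun t => X t ω))
    (hτ : ∀ᵐ ω ∂μ, defaultTime X L ω = firstTime {t | runningInf X t ω = L ω})
    (hG : StronglyAdapted 𝓕 G) (hGc : ∀ᵐ ω ∂μ, Continuous fun u => G u ω)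
    (hGv : ∀ᵐ ω ∂μ, LocallyBoundedVariationOn (fun u => G u ω) univ) :
    ∃ Y g : ℝ≥0 → Ω → ℝ, IsDecreasing 𝓕 Y ∧ IsContBV 𝓕 g ∧
      (∀ᵐ ω ∂μ, ∀ u, runningInf X u ω = Y u ω) ∧ (∀ᵐ ω ∂μ, ∀ u, G u ω = g u ω) ∧
      ∀ᵐ ω ∂μ, defaultTime X L ω = firstTime {u | Y u ω ≤ L ω} := by
  set N : Set Ω := {ω | ¬ (IsCadlag (fun t => X t ω) ∧ Continuous (fun u => G u ω) ∧
    LocallyBoundedVariationOn (fun u => G u ω) univ)} with hN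
  have hN0 : μ N = 0 := hXpath.and (hGc.and hGv)
  have hNF := h𝓕.complete N hN0
  have hgood : ∀ ω ∉ N, IsCadlag (fun t => X t ω) ∧ Continuous (fun u => G u ω) ∧
    LocallyBoundedVariationOn (fun u => G u ω) univ := fun ω h => not_not.1 h
  refine ⟨zeroOn N (runningInf X), zeroOn N G,
    isDecreasing_zeroOn_runningInf hX hNF fun ω h => (hgood ω h).1,
    ⟨fun u => measurable_zeroOn hNF (hG u).measurable, fun ω => ?_, fun ω => ?_⟩, ?_, ?_, ?_⟩
  · by_cases h : ω ∈ N
    · simp only [zeroOn_of_mem h, continuous_const]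
    · simpa only [zeroOn_of_notMem h] using (hgood ω h).2.1
  · by_cases h : ω ∈ N
    · simp only [zeroOn_of_mem h]
      exact (monotoneOn_const (c := (0 : ℝ))).locallyBoundedVariationOn
    · simpa only [zeroOn_of_notMem h] using (hgood ω h).2.2
  · filter_upwards [measure_eq_zero_iff_ae_notMem.1 hN0] with ω h u
      using (zeroOn_of_notMem h _ u).symm
  · filter_upwards [measure_eq_zero_iff_ae_notMem.1 hN0] with ω h u
      using (zeroOn_of_notMem h _ u).symm
  · filter_upwards [measure_eq_zero_iff_ae_notMem.1 hN0, hτ] with ω h h2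
    simp only [zeroOn_of_notMem h]
    exact defaultTime_eq_firstTime_runningInf (hgood ω h).1 h2

/-- The standing assumptions, formulated with the default time `τ`. -/
lemma BarrierModel.of_defaultTime (htT : t ≤ T) (h𝓕 : UsualConditions P 𝓕) (hL : Measurable L)
    (hJ : JacodHypothesis P 𝓕 L) (hp : IsCondDensity P 𝓕 L p) (hY : IsDecreasing 𝓕 Y)
    (hR : IsStronglyPredictable 𝓕 R) (hRpos : ∀ u ω, 0 < R u ω) (hg : IsContBV 𝓕 g)
    (hC : StronglyMeasurable[𝓕 T] C) (hZ : IsStronglyPredictable 𝓕 Z) {G : ℝ≥0 → Ω → ℝ}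
    (hGg : ∀ᵐ ω ∂P, ∀ u, G u ω = g u ω)
    (hτ : ∀ᵐ ω ∂P, τ ω = firstTime {u | Y u ω ≤ L ω})
    (hCint : Integrable (fun ω => C ω * discountedSurvival R τ T ω) P)
    (hGint : ∫⁻ ω, ∫⁻ u in Ioc t T, ‖discountedSurvival R τ u ω‖ₑ
      ∂(pathVariation (fun u => G u ω) T) ∂P < ∞)
    (hZint : Integrable (discountedRecovery R Z τ T) P) :
    BarrierModel P 𝓕 L p C Y R g (fun u ω => Z u ω * (R u ω)⁻¹) t T := by
  have hsum : ∀ᵐ ω ∂P, ∫⁻ u in Ioc t T, ‖discountedSurvival R τ u ω‖ₑ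
      ∂(pathVariation (fun u => G u ω) T) =
        dividendPos g Y R t T (ω, L ω) + dividendNeg g Y R t T (ω, L ω) := by
    filter_upwards [hGg, hτ] with ω h1 h2
    simp_rw [h1, pathVariation_eq_add, discountedSurvival_eq hY h2,
      Real.enorm_of_nonneg (survWeight_nonneg hRpos _ _ _)]
    rw [Measure.restrict_add, lintegral_add_measure]
    rfl
  have hfin := (lintegral_congr_ae hsum).symm.trans_lt hGint
  have hset : MeasurableSet {ω | L ω < Y t ω} :=
    measurableSet_lt hL ((hY.measurable t).mono (𝓕.le t) le_rfl)
  refine ⟨htT, h𝓕, hL, hJ, hp, hY, hR, hRpos, hg, hC.measurable, ?_, ?_, ?_, ?_, ?_⟩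
  · exact hZ.mul hR.measurable.inv.stronglyMeasurable
  · refine hCint.congr ?_
    filter_upwards [hτ] with ω h
    rw [discountedSurvival_eq hY h]
  · exact ((lintegral_mono fun ω => le_self_add).trans_lt hfin).ne
  · exact ((lintegral_mono fun ω => le_add_self).trans_lt hfin).ne
  · refine (hZint.indicator hset).congr ?_
    filter_upwards [hτ] with ω h
    exact (exitRecovery_eq hY h).symm

namespace BarrierModel

lemma ae_dividend_ne_top (hB : BarrierModel P 𝓕 L p C Y R g H t T) :
    ∀ᵐ ω ∂P, dividendPos g Y R t T (ω, L ω) ≠ ∞ ∧ dividendNeg g Y R t T (ω, L ω) ≠ ∞ := by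
  filter_upwards [ae_lt_top' (hB.aemeasurable_comp hB.measurable_dividendPos) hB.lintegral_pos,
    ae_lt_top' (hB.aemeasurable_comp hB.measurable_dividendNeg) hB.lintegral_neg] with ω h1 h2
  exact ⟨h1.ne, h2.ne⟩

lemma discountedPayoff_ae_eq
    (hB : BarrierModel P 𝓕 L p C Y R g (fun u ω => Z u ω * (R u ω)⁻¹) t T) {G : ℝ≥0 → Ω → ℝ}
    (hGg : ∀ᵐ ω ∂P, ∀ u, G u ω = g u ω)
    (hτ : ∀ᵐ ω ∂P, τ ω = firstTime {u | Y u ω ≤ L ω}) :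
    discountedPayoff R τ C G Z t T =ᵐ[P] fun ω => C ω * survWeight Y R T (L ω) ω
      + ((dividendPos g Y R t T (ω, L ω)).toReal - (dividendNeg g Y R t T (ω, L ω)).toReal)
      + discountedRecovery R Z τ T ω := by
  filter_upwards [hB.ae_dividend_ne_top, hGg, hτ] with ω h1 h2 h3
  simp_rw [discountedPayoff, discountedSurvival_eq hB.decreasing h3, h2]
  rw [pathIntegral_survWeight hB.decreasing hB.discount hB.discount_pos h1.1 h1.2]

lemma survMass_eq_zero {κ : Ω → Measure ℝ≥0} (hY : IsDecreasing 𝓕 Y) {x : ℝ} {ω : Ω}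
    (h : ¬ x < Y t ω) : survMass κ Y R t T (ω, x) = 0 := by
  rw [survMass, setLIntegral_congr_fun (g := 0) measurableSet_Ioc]
  · simp
  · intro u hu
    have hu' : ¬ x < Y u ω := fun h' => h (h'.trans_le (hY.antitone ω hu.1.le))
    simp [survWeight, hu']

/-- After default by time t, every term of `barrierPayoff` vanishes, whereas the discounted payoff
may retain its recovery payment. Hence the two agree only after restriction to survival at t. -/
lemma barrierPayoff_ae_eq
    (hB : BarrierModel P 𝓕 L p C Y R g (fun u ω => Z u ω * (R u ω)⁻¹) t T) {G : ℝ≥0 → Ω → ℝ}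
    (hGg : ∀ᵐ ω ∂P, ∀ u, G u ω = g u ω)
    (hτ : ∀ᵐ ω ∂P, τ ω = firstTime {u | Y u ω ≤ L ω}) :
    (fun ω => barrierPayoff C Y R g (fun u ω => Z u ω * (R u ω)⁻¹) t T (ω, L ω)) =ᵐ[P]
      {ω | L ω < Y t ω}.indicator (discountedPayoff R τ C G Z t T) := by
  filter_upwards [hB.discountedPayoff_ae_eq hGg hτ, hτ] with ω h1 h2
  rw [barrierPayoff, exitRecovery_eq hB.decreasing h2]
  by_cases h : L ω < Y t ω
  · have h' : ω ∈ {ω | L ω < Y t ω} := h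
    rw [indicator_of_mem h', indicator_of_mem h', h1]
  · have h' : ω ∉ {ω | L ω < Y t ω} := h
    have hT : ¬ L ω < Y T ω := fun hh => h (hh.trans_le (hB.decreasing.antitone ω hB.le))
    rw [indicator_of_notMem h', indicator_of_notMem h', dividendPos, dividendNeg,
      survMass_eq_zero hB.decreasing h, survMass_eq_zero hB.decreasing h]
    simp [survWeight, hT]

lemma valueProcess_ae_eq
    (hB : BarrierModel P 𝓕 L p C Y R g (fun u ω => Z u ω * (R u ω)⁻¹) t T) {G : ℝ≥0 → Ω → ℝ}
    (hGg : ∀ᵐ ω ∂P, ∀ u, G u ω = g u ω)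
    (hτ : ∀ᵐ ω ∂P, τ ω = firstTime {u | Y u ω ≤ L ω})
    (hint : Integrable (discountedPayoff R τ C G Z t T) P) {W : Ω × ℝ → ℝ}
    (hW : IsVersion P 𝓕 (P.map L) t (fun z =>
      barrierPayoff C Y R g (fun u ω => Z u ω * (R u ω)⁻¹) t T z * p T z.2 z.1) W) :
    valueProcess P (managerFiltration 𝓕 L hB.barrier) R τ C G Z t T =ᵐ[P]
      fun ω => {ω | (t : ℝ≥0∞) < τ ω}.indicator
        (fun ω => R t ω * W (ω, L ω) / p t (L ω) ω) ω := by
  -- This set is almost surely {τ > t}. As the manager observes it, its indicator passes through the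
  -- conditional expectation.
  have hset : MeasurableSet[managerFiltration 𝓕 L hB.barrier t] {ω | L ω < Y t ω} := by
    rw [managerFiltration_eq_comap]
    exact ⟨_, hB.decreasing.measurableSet_lt le_rfl, rfl⟩
  have h1 := condExp_indicator (m := managerFiltration 𝓕 L hB.barrier t) hint hset
  have h2 := condExp_congr_ae (m := managerFiltration 𝓕 L hB.barrier t)
    (hB.barrierPayoff_ae_eq hGg hτ)
  filter_upwards [h1, h2, hB.condExp_payoff hW, hτ] with ω e1 e2 e3 e4
  by_cases h : (t : ℝ≥0∞) < τ ω
  · have h' : ω ∈ {ω | L ω < Y t ω} := by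
      rw [e4, hB.decreasing.lt_firstTime_iff] at h
      exact h
    rw [indicator_of_mem h'] at e1
    simp only [valueProcess, indicator, mem_ofPred_eq, h, if_true]
    rw [← e1, ← e2, e3, mul_div_assoc]
  · simp [valueProcess, h]

end BarrierModel

end Identification

end CreditRisk

end

/-! ### The valuation formula -/

theorem mainTheorem2 {Ω : Type*} {mΩ : MeasurableSpace Ω} (P : Measure Ω) [IsProbabilityMeasure P]
    (𝓕 : Filtration ℝ≥0 mΩ) (h𝓕 : CreditRisk.UsualConditions P 𝓕)
    -- the fundamental process, the barrier and the default time
    (X : ℝ≥0 → Ω → ℝ) (hX : StronglyAdapted 𝓕 X)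
    (hXpath : ∀ᵐ ω ∂P, CreditRisk.IsCadlag (fun t => X t ω))
    (L : Ω → ℝ) (hL : Measurable L)
    (hτ : ∀ᵐ ω ∂P, CreditRisk.defaultTime X L ω =
      CreditRisk.firstTime {t | CreditRisk.runningInf X t ω = L ω})
    -- the density hypothesis and the conditional density
    (hJ : CreditRisk.JacodHypothesis P 𝓕 L)
    (p : ℝ≥0 → ℝ → Ω → ℝ) (hp : CreditRisk.IsCondDensity P 𝓕 L p)
    -- the discount factor and the claim
    (R : ℝ≥0 → Ω → ℝ) (hR : IsStronglyPredictable 𝓕 R) (hRpos : ∀ t ω, 0 < R t ω)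
    (t T : ℝ≥0) (htT : t ≤ T)
    (C : Ω → ℝ) (G Z : ℝ≥0 → Ω → ℝ) (hclaim : CreditRisk.IsClaim P 𝓕 T C G Z)
    -- integrability of the three cash flows
    (hCint : Integrable
      (fun ω => C ω * CreditRisk.discountedSurvival R (CreditRisk.defaultTime X L) T ω) P)
    (hGint : ∫⁻ ω, ∫⁻ u in Ioc t T,
      ‖CreditRisk.discountedSurvival R (CreditRisk.defaultTime X L) u ω‖ₑ
        ∂(CreditRisk.pathVariation (fun u => G u ω) T) ∂P < ∞)
    (hZint : Integrable (CreditRisk.discountedRecovery R Z (CreditRisk.defaultTime X L) T) P)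
    -- the stochastic integral of `Z R⁻¹` against `Fᴹ(x)` over `(t, T]` exists
    (hZF : ∀ᵐ x ∂(P.map L), CreditRisk.StochIntegrable P 𝓕
      (fun u => CreditRisk.survivalDensity X p u x) (fun u ω => Z u ω * (R u ω)⁻¹) t T) :
    -- all terms are well defined and integrable
    Integrable (CreditRisk.discountedPayoff R (CreditRisk.defaultTime X L) C G Z t T) P ∧
    (∀ᵐ x ∂(P.map L),
      (∀ᵐ ω ∂P, IntegrableOn (fun u => CreditRisk.survivalDensity X p u x ω * (R u ω)⁻¹)
        (Ioc t T) (CreditRisk.pathVariation (fun u => G u ω) T)) ∧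
      Integrable
        (CreditRisk.fullInfoPayoff P 𝓕 R (CreditRisk.survivalDensity X p) C G Z t T x) P) ∧
    -- a jointly measurable version of `Ṽᴹ_t(x)` exists
    (∃ W, CreditRisk.IsFullInfoValue P 𝓕 L R (CreditRisk.survivalDensity X p) C G Z t T W) ∧
    -- and for every such version, `Vᴹ_t = 1_{τ > t} Ṽᴹ_t(L) / p_t(L)`
    (∀ W, CreditRisk.IsFullInfoValue P 𝓕 L R (CreditRisk.survivalDensity X p) C G Z t T W →
      CreditRisk.valueProcess P (CreditRisk.managerFiltration 𝓕 L hL) R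
          (CreditRisk.defaultTime X L) C G Z t T
        =ᵐ[P] fun ω => {ω' | (t : ℝ≥0∞) < CreditRisk.defaultTime X L ω'}.indicator
          (fun ω' => W (L ω') ω' / p t (L ω') ω') ω) := by
  obtain ⟨Y, g, hY, hg, hXY, hGg, hτY⟩ := CreditRisk.exists_null_modification h𝓕 hX hXpath hτ
    hclaim.dividend_adapted hclaim.dividend_continuous hclaim.dividend_variation
  have hB := CreditRisk.BarrierModel.of_defaultTime htT h𝓕 hL hJ hp hY hR hRpos hg hclaim.terminal
    hclaim.recovery hGg hτY hCint hGint hZint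
  have hpay := hB.ae_setIntegral_payoff hXY hGg rfl hZF
  have hint : Integrable
      (CreditRisk.discountedPayoff R (CreditRisk.defaultTime X L) C G Z t T) P :=
    ((hB.integrable_terminal.add hB.integrable_dividend).add hZint).congr
      (hB.discountedPayoff_ae_eq hGg hτY).symm
  obtain ⟨W₀, hW₀⟩ := hB.exists_isVersion
  have hver := hB.ae_eq_condExp_of_isVersion hW₀ (hpay.mono fun x h => ⟨h.2.1, h.2.2⟩)
  refine ⟨hint, hpay.mono fun x h => ⟨h.1, h.2.1⟩,
    ⟨fun x ω => R t ω * W₀ (ω, x), hB.measurable_discount.mul hW₀.measurable, ?_⟩,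
    fun W hW => ?_⟩
  · filter_upwards [hver] with x hx
    filter_upwards [hx] with ω hω
    rw [hω]
  -- The given version agrees with R_t W₀(·, x) for almost every x, so the two also agree at x = L.
  · have hcomp := hB.ae_comp_eq_of_version hW₀ hW.1 (by
      filter_upwards [hver, hW.2] with x h1 h2
      filter_upwards [h1, h2] with ω e1 e2
      rw [e2, e1])
    filter_upwards [hB.valueProcess_ae_eq hGg hτY hint hW₀, hcomp] with ω h1 h2
    rw [h1]
    simp only [indicator, h2]
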